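/- Let $B$ be a Riemann surface and let $\pi : X \to B$ be a smooth symplectic family over $B$: a smooth fibre bundle with a Poisson structure $P : T^*X \to TX$ whose image is the vertical distribution $S=\ker d\pi$ (so that the symplectic leaves are the fibres, or their connected components if the fibres are disconnected). Let $\omega$ be the leafwise symplectic form of $P$, and let $I$ be the complex structure on $TX/S\cong\pi^*TB$ pulled back from $B$, with canonical line bundle $\kappa_I=\pi^*(T^*B)_{1,0}$. The pair $(P,I)$ is called generalized complex if there are a closed real $3$-form $H$ on $X$ and a generalized complex structure with curvature $H$ inducing $(P,I)$. That is, there is a smooth complex line bundle $\kappa\subset\bigwedge^\bullet T^*_{\mathbb C}X$ of pure spinors of real rank zero such that every nowhere vanishing local section $\rho$ of $\kappa$ satisfies $d\rho+H\wedge\rho=\iota_Y\rho+\xi\wedge\rho$ for some smooth local section $(Y,\xi)$ of $T_{\mathbb C}X\oplus T^*_{\mathbb C}X$, and such that at each point $\kappa=e^{b+iw}\wedge\kappa_I$ for some real $2$-covectors $b,w$ with $w|_S=\omega$. Let $F_n\Omega^m$ be the space of smooth complex $m$-forms on $X$ that vanish whenever more than $m-n$ of their arguments are vertical, let $H^{n;k}_{d_S}$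 be the cohomology, at $k$, of the complex $F_n\Omega^{n+\bullet}/F_{n+1}\Omega^{n+\bullet}$ with the differential $d_S$ induced by $d$, and let $\nabla : H^{n;k}_{d_S}\to H^{n+1;k}_{d_S}$, $[\sigma]\mapsto[d\sigma]$ (with $\sigma \in F_n$, $d\sigma\in F_{n+1}$) be the Gauss--Manin connection. Write $H^{n;k}_{d_S}=\bigoplus_{p+q=n}H^{p,q;k}_{d_S}$ according to complex type along $B$, and $\nabla=\partial+\bar\partial$ for the components of type $(1,0)$ and $(0,1)$. Let $[\omega]_{d_S}\in H^{0;2}_{d_S}$ be the class of any extension of $\omega$ to a real $2$-form on $X$. Then $(P,I)$ is generalized complex if and only if $\partial\bar\partial[\omega]_{d_S}=0$ in $H^{1,1;2}_{d_S}$. In particular, if the family is a symplectic fibre bundle, i.e. if there is a symplectic manifold $(F,\sigma)$ such that $\pi$ has, near every point of $B$, a smooth local trivialization with fibre $F$ identifying $\omega$ with $\sigma$ on each fibre, then $(P,I)$ is generalized complex. -/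

import Mathlib

open scoped Manifold ContDiff Topology

noncomputable section

namespace GenCplx

/-! ## Multilinear algebra on one tangent space

`E` is a finite-dimensional real vector space.  Real (complex) `k`-covectors are
`E [⋀^Fin k]→L[ℝ] ℝ` (`E [⋀^Fin k]→L[ℝ] ℂ`). -/

section LinearAlgebra

variable {E : Type*} [NormedAddCommGroup E] [NormedSpace ℝ E]

/-- The complexification of a real covector. -/
def toC {k : ℕ} (b : E [⋀^Fin k]→L[ℝ] ℝ) : E [⋀^Fin k]→L[ℝ] ℂ :=
  Complex.ofRealCLM.compContinuousAlternatingMap b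

/-- The tensor product of covectors,
`v ↦ α (v₁, …, v_a) * β (v_{a+1}, …, v_{a+b})`. -/
def tensor {a b k : ℕ} (h : a + b = k) (α : E [⋀^Fin a]→L[ℝ] ℂ) (β : E [⋀^Fin b]→L[ℝ] ℂ) :
    ContinuousMultilinearMap ℝ (fun _ : Fin k => E) ℂ where
  toFun v := α (fun i => v (Fin.cast h (Fin.castAdd b i))) *
    β (fun i => v (Fin.cast h (Fin.natAdd a i)))
  map_update_add' := by
    subst h
    intro inst v i x y
    obtain rfl : inst = instDecidableEqFin _ := Subsingleton.elim _ _
    have inj1 : Function.Injective (Fin.castAdd b : Fin a → Fin (a + b)) :=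
      Fin.castAdd_injective a b
    have inj2 : Function.Injective (Fin.natAdd a : Fin b → Fin (a + b)) :=
      Fin.natAdd_injective b a
    refine Fin.addCases (fun j => ?_) (fun j => ?_) i
    · have h1 : ∀ z : E, (fun l : Fin a =>
          Function.update v (Fin.castAdd b j) z (Fin.castAdd b l)) =
          Function.update (fun l => v (Fin.castAdd b l)) j z := fun z =>
        Function.update_comp_eq_of_injective v inj1 j z
      have h2 : ∀ z : E, (fun l : Fin b =>
          Function.update v (Fin.castAdd b j) z (Fin.natAdd a l)) =
          fun l => v (Fin.natAdd a l) := fun z => by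
        funext l
        apply Function.update_of_ne
        intro hh
        have := congrArg Fin.val hh
        simp at this
        omega
      simp only [Fin.cast_eq_self, h1, h2, α.map_update_add, add_mul]
    · have h1 : ∀ z : E, (fun l : Fin b =>
          Function.update v (Fin.natAdd a j) z (Fin.natAdd a l)) =
          Function.update (fun l => v (Fin.natAdd a l)) j z := fun z =>
        Function.update_comp_eq_of_injective v inj2 j z
      have h2 : ∀ z : E, (fun l : Fin a =>
          Function.update v (Fin.natAdd a j) z (Fin.castAdd b l)) =
          fun l => v (Fin.castAdd b l) := fun z => by
        funext l
        apply Function.update_of_ne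
        intro hh
        have := congrArg Fin.val hh
        simp at this
        omega
      simp only [Fin.cast_eq_self, h1, h2, β.map_update_add, mul_add]
  map_update_smul' := by
    subst h
    intro inst v i c x
    obtain rfl : inst = instDecidableEqFin _ := Subsingleton.elim _ _
    have inj1 : Function.Injective (Fin.castAdd b : Fin a → Fin (a + b)) :=
      Fin.castAdd_injective a b
    have inj2 : Function.Injective (Fin.natAdd a : Fin b → Fin (a + b)) :=
      Fin.natAdd_injective b a
    refine Fin.addCases (fun j => ?_) (fun j => ?_) i
    · have h1 : ∀ z : E, (fun l : Fin a =>
          Function.update v (Fin.castAdd b j) z (Fin.castAdd b l)) =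
          Function.update (fun l => v (Fin.castAdd b l)) j z := fun z =>
        Function.update_comp_eq_of_injective v inj1 j z
      have h2 : ∀ z : E, (fun l : Fin b =>
          Function.update v (Fin.castAdd b j) z (Fin.natAdd a l)) =
          fun l => v (Fin.natAdd a l) := fun z => by
        funext l
        apply Function.update_of_ne
        intro hh
        have := congrArg Fin.val hh
        simp at this
        omega
      simp only [Fin.cast_eq_self, h1, h2, α.map_update_smul, smul_mul_assoc]
    · have h1 : ∀ z : E, (fun l : Fin b =>
          Function.update v (Fin.natAdd a j) z (Fin.natAdd a l)) =
          Function.update (fun l => v (Fin.natAdd a l)) j z := fun z =>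
        Function.update_comp_eq_of_injective v inj2 j z
      have h2 : ∀ z : E, (fun l : Fin a =>
          Function.update v (Fin.natAdd a j) z (Fin.castAdd b l)) =
          fun l => v (Fin.castAdd b l) := fun z => by
        funext l
        apply Function.update_of_ne
        intro hh
        have := congrArg Fin.val hh
        simp at this
        omega
      simp only [Fin.cast_eq_self, h1, h2, β.map_update_smul, mul_smul_comm]
  cont := by
    refine Continuous.mul (α.cont.comp ?_) (β.cont.comp ?_) <;> fun_prop

/-- The wedge product of complex covectors, with the normalization
`(α ∧ β) v = (1 / (a! b!)) ∑_s sign s • α (v_{s 1}, …) β (…, v_{s (a + b)})`. -/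
def wedge {a b k : ℕ} (h : a + b = k) (α : E [⋀^Fin a]→L[ℝ] ℂ) (β : E [⋀^Fin b]→L[ℝ] ℂ) :
    E [⋀^Fin k]→L[ℝ] ℂ :=
  ((a.factorial * b.factorial : ℂ))⁻¹ • (tensor h α β).alternatization

/-- Values of spinors at a point: complex covectors of mixed degree.  (Only degrees at most
`dim E` contribute.) -/
abbrev Spinor (E : Type*) [NormedAddCommGroup E] [NormedSpace ℝ E] : Type _ :=
  ∀ k : ℕ, E [⋀^Fin k]→L[ℝ] ℂ

/-- `ρ ↦ α ∧ ρ` on spinors, for an `a`-covector `α`. -/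
def wedgeSpinor {a : ℕ} (α : E [⋀^Fin a]→L[ℝ] ℂ) (ρ : Spinor E) : Spinor E := fun k =>
  if h : a ≤ k then wedge (Nat.add_sub_of_le h) α (ρ (k - a)) else 0

/-- `ρ ↦ e^σ ∧ ρ = ∑_j (1 / j!) σ^j ∧ ρ` for a complex `2`-covector `σ`.  In degree `k`, the terms
with `2 * j > k` vanish, so the sum is finite. -/
def expWedge (σ : E [⋀^Fin 2]→L[ℝ] ℂ) (ρ : Spinor E) : Spinor E := fun k =>
  ∑ j ∈ Finset.range (k + 1), ((j.factorial : ℂ))⁻¹ • ((wedgeSpinor σ)^[j] ρ) k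

/-- Elements `(X, ξ)` of `T_ℂ ⊕ T_ℂ^*`, where `X = re + i im`. -/
structure GenVec (E : Type*) [NormedAddCommGroup E] [NormedSpace ℝ E] where
  re : E
  im : E
  form : E [⋀^Fin 1]→L[ℝ] ℂ

/-- The natural pairing `ξ (Y)` of a complex covector with `Y = u + i v`. -/
def evalC (ξ : E [⋀^Fin 1]→L[ℝ] ℂ) (u v : E) : ℂ :=
  ξ (fun _ => u) + Complex.I * ξ (fun _ => v)

/-- The standard symmetric pairing (up to the factor `1 / 2`):
`⟨(X, ξ), (Y, η)⟩ = ξ (Y) + η (X)`. -/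
def GenVec.pairing (a b : GenVec E) : ℂ :=
  evalC a.form b.re b.im + evalC b.form a.re a.im

/-- Complex conjugation on `T_ℂ ⊕ T_ℂ^*`. -/
def GenVec.conj (a : GenVec E) : GenVec E where
  re := a.re
  im := -a.im
  form := Complex.conjCLE.toContinuousLinearMap.compContinuousAlternatingMap a.form

/-- The Clifford action `(X, ξ) · ρ = ι_X ρ + ξ ∧ ρ`. -/
def GenVec.act (a : GenVec E) (ρ : Spinor E) : Spinor E := fun k =>
  (ρ (k + 1)).curryLeft a.re + Complex.I • (ρ (k + 1)).curryLeft a.im + wedgeSpinor a.form ρ k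

/-- The null space `L_ρ` of a spinor. -/
def nullSpace (ρ : Spinor E) : Set (GenVec E) := {a | a.act ρ = 0}

/-- `ρ` is pure: `L_ρ` is isotropic, and maximal with this property. -/
def IsPure (ρ : Spinor E) : Prop :=
  (∀ a ∈ nullSpace ρ, ∀ b ∈ nullSpace ρ, a.pairing b = 0) ∧
  ∀ w : GenVec E, (∀ a ∈ nullSpace ρ, w.pairing a = 0) → w.pairing w = 0 → w ∈ nullSpace ρ

/-- `ρ` has real rank zero: `L_ρ ∩ conj L_ρ = 0`. -/
def HasRealRankZero (ρ : Spinor E) : Prop :=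
  ∀ a ∈ nullSpace ρ, a.conj ∈ nullSpace ρ → a.re = 0 ∧ a.im = 0 ∧ a.form = 0

end LinearAlgebra

/-! ## Differential forms on a manifold

`X` is a smooth manifold modelled on `E`; its tangent space `TangentSpace 𝓘(ℝ, E) x` is by
definition `E`, by means of the preferred chart at `x`. -/

section Forms

variable {E : Type*} [NormedAddCommGroup E] [NormedSpace ℝ E]
  {X : Type*} [TopologicalSpace X] [ChartedSpace E X]
  {V : Type*} [NormedAddCommGroup V] [NormedSpace ℝ V]

/-- The derivative at `x` of a map between manifolds, as a linear map of model spaces. -/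
def deriv' {E' : Type*} [NormedAddCommGroup E'] [NormedSpace ℝ E']
    {Y : Type*} [TopologicalSpace Y] [ChartedSpace E' Y] (f : X → Y) (x : X) : E →L[ℝ] E' :=
  mfderiv 𝓘(ℝ, E) 𝓘(ℝ, E') f x

/-- The expression of the form `α` in the chart at `x₀`: its pullback by the inverse of the
chart. -/
def inChart {k : ℕ} (α : X → E [⋀^Fin k]→L[ℝ] V) (x₀ : X) (y : E) : E [⋀^Fin k]→L[ℝ] V :=
  (α ((chartAt E x₀).symm y)).compContinuousLinearMap (deriv' (chartAt E x₀).symm y)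

/-- The form `α` is smooth on `U`. -/
def SmoothFormOn {k : ℕ} (α : X → E [⋀^Fin k]→L[ℝ] V) (U : Set X) : Prop :=
  ∀ x₀ : X, ContDiffOn ℝ ∞ (inChart α x₀)
    ((chartAt E x₀).target ∩ (chartAt E x₀).symm ⁻¹' U)

/-- The exterior derivative: at `x` it is computed in the chart at `x`. -/
def extD {k : ℕ} (α : X → E [⋀^Fin k]→L[ℝ] V) (x : X) : E [⋀^Fin (k + 1)]→L[ℝ] V :=
  (extDeriv (inChart α x) (chartAt E x x)).compContinuousLinearMap (deriv' (chartAt E x) x)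

/-- The vector field `u` is smooth on `U`. -/
def SmoothVectorFieldOn [IsManifold 𝓘(ℝ, E) ∞ X] (u : X → E) (U : Set X) : Prop :=
  ContMDiffOn 𝓘(ℝ, E) (𝓘(ℝ, E).prod 𝓘(ℝ, E)) ∞
    (fun x => (⟨x, u x⟩ : TangentBundle 𝓘(ℝ, E) X)) U

theorem inChart_contDiffAt {k : ℕ} {α : X → E [⋀^Fin k]→L[ℝ] V} {U : Set X} (hU : IsOpen U)
    (hα : SmoothFormOn α U) (x₀ : X) {y : E} (hy : y ∈ (chartAt E x₀).target)
    (hyU : (chartAt E x₀).symm y ∈ U) : ContDiffAt ℝ ∞ (inChart α x₀) y := by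
  refine (hα x₀).contDiffAt (IsOpen.mem_nhds ?_ ⟨hy, hyU⟩)
  exact (chartAt E x₀).isOpen_inter_preimage_symm hU

variable [IsManifold 𝓘(ℝ, E) ∞ X]

theorem mdiff_symm (x₀ : X) {y : E} (hy : y ∈ (chartAt E x₀).target) :
    MDifferentiableAt 𝓘(ℝ, E) 𝓘(ℝ, E) (chartAt E x₀).symm y := by
  have := contMDiffOn_chart_symm (I := 𝓘(ℝ, E)) (n := ∞) (x := x₀)
  exact ((this y hy).contMDiffAt ((chartAt E x₀).open_target.mem_nhds hy)).mdifferentiableAt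
    (by simp)

theorem mdiff_chart (x₀ : X) {x : X} (hx : x ∈ (chartAt E x₀).source) :
    MDifferentiableAt 𝓘(ℝ, E) 𝓘(ℝ, E) (chartAt E x₀) x := by
  have := contMDiffOn_chart (I := 𝓘(ℝ, E)) (n := ∞) (x := x₀)
  exact ((this x hx).contMDiffAt ((chartAt E x₀).open_source.mem_nhds hx)).mdifferentiableAt
    (by simp)

/-- The exterior derivative is computed in every chart. -/
theorem inChart_extD {k : ℕ} {α : X → E [⋀^Fin k]→L[ℝ] V} {U : Set X} (hU : IsOpen U)
    (hα : SmoothFormOn α U) (x₀ : X) {y : E} (hy : y ∈ (chartAt E x₀).target)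
    (hyU : (chartAt E x₀).symm y ∈ U) :
    inChart (extD α) x₀ y = extDeriv (inChart α x₀) y := by
  set e := chartAt E x₀ with he
  set z := e.symm y with hz
  set f := chartAt E z with hf
  have hzf : z ∈ f.source := mem_chart_source E z
  set φ : E → E := fun y => f (e.symm y) with hφ
  have hopen : IsOpen (e.target ∩ e.symm ⁻¹' f.source) :=
    e.isOpen_inter_preimage_symm f.open_source
  have hφs : ContDiffAt ℝ ∞ φ y := by
    have h1 : ContMDiffAt 𝓘(ℝ, E) 𝓘(ℝ, E) ∞ e.symm y :=
      (contMDiffOn_chart_symm (I := 𝓘(ℝ, E)) (n := ∞) (x := x₀) y hy).contMDiffAt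
        (e.open_target.mem_nhds hy)
    have h2 : ContMDiffAt 𝓘(ℝ, E) 𝓘(ℝ, E) ∞ f (e.symm y) :=
      (contMDiffOn_chart (I := 𝓘(ℝ, E)) (n := ∞) (x := z) z hzf).contMDiffAt
        (f.open_source.mem_nhds hzf)
    exact (h2.comp y h1).contDiffAt
  have key : inChart α x₀ =ᶠ[𝓝 y]
      fun y' => (inChart α z (φ y')).compContinuousLinearMap (fderiv ℝ φ y') := by
    filter_upwards [hopen.mem_nhds ⟨hy, hzf⟩] with y' hy'
    have hinv : f.symm (f (e.symm y')) = e.symm y' := f.left_inv hy'.2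
    have hft : f (e.symm y') ∈ f.target := f.map_source hy'.2
    have heq : e.symm =ᶠ[𝓝 y'] fun w => f.symm (φ w) := by
      filter_upwards [hopen.mem_nhds hy'] with w hw
      exact (f.left_inv hw.2).symm
    have hd : MDifferentiableAt 𝓘(ℝ, E) 𝓘(ℝ, E) φ y' :=
      (mdiff_chart z hy'.2).comp y' (mdiff_symm x₀ hy'.1)
    have hD : mfderiv 𝓘(ℝ, E) 𝓘(ℝ, E) e.symm y' =
        (mfderiv 𝓘(ℝ, E) 𝓘(ℝ, E) f.symm (φ y')).comp (mfderiv 𝓘(ℝ, E) 𝓘(ℝ, E) φ y') := by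
      rw [heq.mfderiv_eq]
      exact mfderiv_comp y' (mdiff_symm z hft) hd
    have hD' : (deriv' e.symm y' : E →L[ℝ] E) = (deriv' f.symm (φ y')).comp (fderiv ℝ φ y') := by
      rw [mfderiv_eq_fderiv] at hD
      exact hD
    simp only [inChart, ← he, ← hf]
    rw [hD']
    simp only [hφ, hinv]
    rfl
  rw [key.extDeriv_eq, extDeriv_pullback (r := ∞) _ hφs (by simp; exact WithTop.coe_le_coe.2 (le_top : (2 : ℕ∞) ≤ ⊤))]
  · have hD : mfderiv 𝓘(ℝ, E) 𝓘(ℝ, E) φ y =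
        (mfderiv 𝓘(ℝ, E) 𝓘(ℝ, E) f z).comp (mfderiv 𝓘(ℝ, E) 𝓘(ℝ, E) e.symm y) :=
      mfderiv_comp y (mdiff_chart z hzf) (mdiff_symm x₀ hy)
    have hD' : fderiv ℝ φ y = (deriv' f z).comp (deriv' e.symm y : E →L[ℝ] E) := by
      rw [mfderiv_eq_fderiv] at hD
      exact hD
    rw [hD']
    rfl
  · refine (inChart_contDiffAt hU hα z (f.map_source hzf) ?_).differentiableAt (by simp)
    rw [← hf, f.left_inv hzf]
    exact hyU

theorem SmoothFormOn.extD {k : ℕ} {α : X → E [⋀^Fin k]→L[ℝ] V} {U : Set X} (hU : IsOpen U)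
    (hα : SmoothFormOn α U) : SmoothFormOn (extD α) U := by
  intro x₀ y hy
  refine ContDiffAt.contDiffWithinAt ?_
  have hev : inChart (GenCplx.extD α) x₀ =ᶠ[𝓝 y] extDeriv (inChart α x₀) := by
    filter_upwards [((chartAt E x₀).isOpen_inter_preimage_symm hU).mem_nhds hy] with w hw
    exact inChart_extD hU hα x₀ hw.1 hw.2
  refine ContDiffAt.congr_of_eventuallyEq ?_ hev
  have h := (inChart_contDiffAt hU hα x₀ hy.1 hy.2).fderiv_right (m := ∞) (by simp)
  exact (ContinuousAlternatingMap.alternatizeUncurryFinCLM ℝ E V).contDiff.contDiffAt.comp y h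

theorem extD_extD {k : ℕ} {α : X → E [⋀^Fin k]→L[ℝ] V} {U : Set X} (hU : IsOpen U)
    (hα : SmoothFormOn α U) {x : X} (hx : x ∈ U) : extD (extD α) x = 0 := by
  have hxs : chartAt E x x ∈ (chartAt E x).target := mem_chart_target E x
  have hxU : (chartAt E x).symm (chartAt E x x) ∈ U := by
    rwa [(chartAt E x).left_inv (mem_chart_source E x)]
  have hev : inChart (extD α) x =ᶠ[𝓝 (chartAt E x x)] extDeriv (inChart α x) := by
    filter_upwards [((chartAt E x).isOpen_inter_preimage_symm hU).mem_nhds ⟨hxs, hxU⟩] with w hw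
    exact inChart_extD hU hα x hw.1 hw.2
  have h0 : extDeriv (inChart (extD α) x) (chartAt E x x) = 0 := by
    rw [hev.extDeriv_eq]
    exact extDeriv_extDeriv_apply (inChart_contDiffAt hU hα x hxs hxU)
      (by simp; exact WithTop.coe_le_coe.2 (le_top : (2 : ℕ∞) ≤ ⊤))
  rw [extD, h0]
  rfl

end Forms

section Complex

variable {E : Type*} [NormedAddCommGroup E] [NormedSpace ℝ E]
  {X : Type*} [TopologicalSpace X] [ChartedSpace E X]

theorem inChart_add {k : ℕ} (α β : X → E [⋀^Fin k]→L[ℝ] ℂ) (x₀ : X) :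
    inChart (α + β) x₀ = inChart α x₀ + inChart β x₀ := by
  ext y v; rfl

theorem inChart_smul {k : ℕ} (c : ℂ) (α : X → E [⋀^Fin k]→L[ℝ] ℂ) (x₀ : X) :
    inChart (c • α) x₀ = c • inChart α x₀ := by
  ext y v; rfl

variable (E X) in
/-- Smooth complex `k`-forms among all `k`-forms. -/
def smoothForms (k : ℕ) : Submodule ℂ (X → E [⋀^Fin k]→L[ℝ] ℂ) where
  carrier := {α | SmoothFormOn α Set.univ}
  zero_mem' := fun x₀ => by
    have : inChart (0 : X → E [⋀^Fin k]→L[ℝ] ℂ) x₀ = 0 := by ext y v; rfl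
    rw [this]
    exact contDiffOn_const
  add_mem' := fun {α β} hα hβ x₀ => by
    rw [inChart_add]
    exact (hα x₀).add (hβ x₀)
  smul_mem' := fun c α hα x₀ => by
    rw [inChart_smul]
    exact (hα x₀).const_smul c

variable (E X) in
/-- The complex vector space `Ω^k(X)` of smooth complex `k`-forms. -/
def Omega (k : ℕ) : Type _ := ↥(smoothForms E X k)

instance (k : ℕ) : AddCommGroup (Omega E X k) := inferInstanceAs (AddCommGroup (smoothForms E X k))

instance (k : ℕ) : Module ℂ (Omega E X k) := inferInstanceAs (Module ℂ (smoothForms E X k))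

variable [IsManifold 𝓘(ℝ, E) ∞ X]

/-- The exterior derivative `d : Ω^k(X) → Ω^{k+1}(X)`. -/
def dOmega (k : ℕ) : Omega E X k →ₗ[ℂ] Omega E X (k + 1) where
  toFun α := ⟨extD α.1, SmoothFormOn.extD isOpen_univ α.2⟩
  map_add' α β := by
    apply Subtype.ext
    funext x
    have h1 := (inChart_contDiffAt isOpen_univ α.2 x (mem_chart_target E x)
      (Set.mem_univ _)).differentiableAt (by simp)
    have h2 := (inChart_contDiffAt isOpen_univ β.2 x (mem_chart_target E x)
      (Set.mem_univ _)).differentiableAt (by simp)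
    change extD (α.1 + β.1) x = extD α.1 x + extD β.1 x
    rw [extD, inChart_add, extDeriv_add h1 h2]
    rfl
  map_smul' c α := by
    apply Subtype.ext
    funext x
    have h1 := (inChart_contDiffAt isOpen_univ α.2 x (mem_chart_target E x)
      (Set.mem_univ _)).differentiableAt (by simp)
    change extD (c • α.1) x = c • extD α.1 x
    have h : extDeriv (c • inChart α.1 x) (chartAt E x x) =
        c • extDeriv (inChart α.1 x) (chartAt E x x) := by
      unfold extDeriv
      rw [fderiv_const_smul h1]
      ext v
      simp only [ContinuousAlternatingMap.alternatizeUncurryFin_apply,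
        ContinuousAlternatingMap.smul_apply, _root_.smul_apply, Finset.smul_sum]
      exact Finset.sum_congr rfl fun i _ => smul_comm _ _ _
    rw [extD, inChart_smul, h]
    rfl

theorem dOmega_dOmega (k : ℕ) (α : Omega E X k) : dOmega (k + 1) (dOmega k α) = 0 := by
  apply Subtype.ext
  funext x
  exact extD_extD isOpen_univ α.2 (Set.mem_univ x)

end Complex

/-! ## Fibrewise cohomology and the Gauss-Manin connection

`π : X → B` is a map to a Riemann surface.  The tangent space of `B` at a point is `ℂ` by means of
the preferred chart there; its complex structure is multiplication by `I`. -/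

section GaussManin

variable {E : Type*} [NormedAddCommGroup E] [NormedSpace ℝ E]
  {X : Type*} [TopologicalSpace X] [ChartedSpace E X]
  {B : Type*} [TopologicalSpace B] [ChartedSpace ℂ B] (π : X → B)

/-- `F_n Ω^m`: the `m`-forms generated by pullbacks of `n`-forms on the base, i.e. those that vanish
as soon as more than `m - n` of their arguments are vertical. -/
def filt (n m : ℕ) : Submodule ℂ (Omega E X m) where
  carrier := {α | ∀ (x : X) (v : Fin m → E) (s : Finset (Fin m)),
    (∀ i ∈ s, (deriv' π x : E →L[ℝ] ℂ) (v i) = 0) → m < n + s.card → α.1 x v = 0}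
  zero_mem' := fun _ _ _ _ _ => rfl
  add_mem' := fun {α β} hα hβ x v s hs hc => by
    change α.1 x v + β.1 x v = 0
    rw [hα x v s hs hc, hβ x v s hs hc, add_zero]
  smul_mem' := fun c α hα x v s hs hc => by
    change c • α.1 x v = 0
    rw [hα x v s hs hc, smul_zero]

/-- `m`-forms in `F_n` whose class in `F_n / F_{n+1}` has type `(p, q)` along the base, `p + q = n`:
replacing the `n` non-vertical arguments by vectors whose projections to the base are multiplied
by `l` multiplies the value by `l ^ p * conj l ^ q`. -/
def typeForms (p q n m : ℕ) : Submodule ℂ (Omega E X m) where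
  carrier := {α | α ∈ filt π n m ∧ ∀ (x : X) (l : ℂ) (v w : Fin m → E) (s : Finset (Fin m)),
    s.card + n = m →
    (∀ i ∈ s, (deriv' π x : E →L[ℝ] ℂ) (v i) = 0 ∧ w i = v i) →
    (∀ i ∉ s, (deriv' π x : E →L[ℝ] ℂ) (w i) = l * (deriv' π x : E →L[ℝ] ℂ) (v i)) →
    α.1 x w = l ^ p * (starRingEnd ℂ l) ^ q * α.1 x v}
  zero_mem' := ⟨Submodule.zero_mem _, fun _ _ _ _ _ _ _ _ => (mul_zero _).symm⟩
  add_mem' := fun {α β} hα hβ => ⟨Submodule.add_mem _ hα.1 hβ.1, fun x l v w s hc hs ht => by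
    change α.1 x w + β.1 x w = _ * (α.1 x v + β.1 x v)
    rw [hα.2 x l v w s hc hs ht, hβ.2 x l v w s hc hs ht, mul_add]⟩
  smul_mem' := fun c α hα => ⟨Submodule.smul_mem _ c hα.1, fun x l v w s hc hs ht => by
    change c * α.1 x w = _ * (c * α.1 x v)
    rw [hα.2 x l v w s hc hs ht]
    ring⟩

variable [IsManifold 𝓘(ℝ, E) ∞ X]

/-- Forms representing `d_S`-cocycles of `Λ^{n; m-n} = F_n Ω^m / F_{n+1} Ω^m`. -/
def cocycles (n m : ℕ) : Submodule ℂ (Omega E X m) :=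
  filt π n m ⊓ (filt π (n + 1) (m + 1)).comap (dOmega m)

/-- Forms representing `d_S`-coboundaries of `Λ^{n; m-n}`. -/
def coboundaries (n : ℕ) : (m : ℕ) → Submodule ℂ (Omega E X m)
  | 0 => filt π (n + 1) 0
  | m + 1 => (filt π n m).map (dOmega m) ⊔ filt π (n + 1) (m + 1)

/-- The complexified fibrewise cohomology `H_{d_S}^{n; m-n}(X)`; note that `m` is the total
degree. -/
abbrev FibCoh (n m : ℕ) : Type _ :=
  cocycles (E := E) π n m ⧸ (coboundaries (E := E) π n m).submoduleOf (cocycles π n m)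

/-- The class of a cocycle. -/
def FibCoh.mk (n m : ℕ) : cocycles (E := E) π n m →ₗ[ℂ] FibCoh (E := E) π n m :=
  Submodule.mkQ _

/-- The exterior derivative, from cocycles of `Λ^{n;•}` to cocycles of `Λ^{n+1;•}`. -/
def dCocycles (n m : ℕ) : cocycles (E := E) π n m →ₗ[ℂ] cocycles (E := E) π (n + 1) (m + 1) :=
  (dOmega m).restrict fun α hα => ⟨hα.2, by
    change dOmega (m + 1) (dOmega m α) ∈ filt π (n + 1 + 1) (m + 1 + 1)
    rw [dOmega_dOmega]
    exact Submodule.zero_mem _⟩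

/-- The Gauss-Manin connection `∇ : H^{n;k} → H^{n+1;k}`, i.e. the connecting homomorphism of
`0 → F_{n+1} / F_{n+2} → F_n / F_{n+2} → F_n / F_{n+1} → 0`: represent a class by a form in `F_n`
and apply `d`. -/
def gaussManin (n m : ℕ) : FibCoh (E := E) π n m →ₗ[ℂ] FibCoh (E := E) π (n + 1) (m + 1) :=
  Submodule.mapQ _ _ (dCocycles π n m) fun α hα => by
    change dOmega m α.1 ∈ (filt π (n + 1) m).map (dOmega m) ⊔ filt π (n + 1 + 1) (m + 1)
    refine Submodule.mem_sup_left ?_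
    have hα' : α.1 ∈ coboundaries π n m := hα
    cases m with
    | zero => exact Submodule.mem_map_of_mem hα'
    | succ m =>
      obtain ⟨_, ⟨τ, _, rfl⟩, μ, hμ, he⟩ := Submodule.mem_sup.1 hα'
      refine ⟨μ, hμ, ?_⟩
      rw [← he, map_add, dOmega_dOmega, zero_add]

/-- The subspace `H^{p,q;m-n}` of `H^{n;m-n}`, where `p + q = n`. -/
def typeClasses (p q n m : ℕ) : Submodule ℂ (FibCoh (E := E) π n m) :=
  ((typeForms π p q n m).submoduleOf (cocycles π n m)).map (FibCoh.mk π n m)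

/-- `c' = ∂ c`, for `c` of type `(p, q)`: `c'` is the component of type `(p + 1, q)` of
`∇ c`, the other component having type `(p, q + 1)`. -/
def IsDel (p q : ℕ) {n m : ℕ} (c : FibCoh (E := E) π n m)
    (c' : FibCoh (E := E) π (n + 1) (m + 1)) : Prop :=
  c ∈ typeClasses π p q n m ∧ c' ∈ typeClasses π (p + 1) q (n + 1) (m + 1) ∧
    gaussManin π n m c - c' ∈ typeClasses π p (q + 1) (n + 1) (m + 1)

/-- `c' = ∂̄ c`, for `c` of type `(p, q)`: `c'` is the component of type `(p, q + 1)` of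
`∇ c`, the other component having type `(p + 1, q)`. -/
def IsDelbar (p q : ℕ) {n m : ℕ} (c : FibCoh (E := E) π n m)
    (c' : FibCoh (E := E) π (n + 1) (m + 1)) : Prop :=
  c ∈ typeClasses π p q n m ∧ c' ∈ typeClasses π p (q + 1) (n + 1) (m + 1) ∧
    gaussManin π n m c - c' ∈ typeClasses π (p + 1) q (n + 1) (m + 1)

end GaussManin

/-! ## Poisson structures and symplectic families -/

section Families

variable (E : Type*) [NormedAddCommGroup E] [NormedSpace ℝ E]
  (X : Type*) [TopologicalSpace X] [ChartedSpace E X]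

variable {E X} in
/-- The bracket `{f, g} = df (P dg)` of a bundle map `P : T^*X → TX`. -/
def poissonBracket (P : X → (E →L[ℝ] ℝ) →L[ℝ] E) (f g : X → ℝ) (x : X) : ℝ :=
  (deriv' f x : E →L[ℝ] ℝ) (P x (deriv' g x))

/-- A (smooth) Poisson structure on `X`, as a skew map `P : T^*X → TX`.  Smoothness and the Jacobi
identity are stated through the bracket of smooth functions. -/
structure PoissonStructure where
  /-- the bundle map `T^*X → TX` -/
  map : X → (E →L[ℝ] ℝ) →L[ℝ] E
  skew : ∀ (x : X) (ξ η : E →L[ℝ] ℝ), ξ (map x η) = -η (map x ξ)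
  smooth : ∀ f g : X → ℝ, ContMDiff 𝓘(ℝ, E) 𝓘(ℝ, ℝ) ∞ f → ContMDiff 𝓘(ℝ, E) 𝓘(ℝ, ℝ) ∞ g →
    ContMDiff 𝓘(ℝ, E) 𝓘(ℝ, ℝ) ∞ (poissonBracket map f g)
  jacobi : ∀ f g h : X → ℝ, ContMDiff 𝓘(ℝ, E) 𝓘(ℝ, ℝ) ∞ f → ContMDiff 𝓘(ℝ, E) 𝓘(ℝ, ℝ) ∞ g →
    ContMDiff 𝓘(ℝ, E) 𝓘(ℝ, ℝ) ∞ h → ∀ x,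
    poissonBracket map f (poissonBracket map g h) x +
      poissonBracket map g (poissonBracket map h f) x +
      poissonBracket map h (poissonBracket map f g) x = 0

variable {E X}

/-- The real `2`-covector `b` at `x` restricts to the symplectic form of the leaf through `x`, i.e.
to the inverse of `P` on the image of `P`: `b (P ξ, P η) = ξ (P η)`. -/
def PoissonStructure.IsLeafForm (P : PoissonStructure E X) (x : X) (b : E [⋀^Fin 2]→L[ℝ] ℝ) :
    Prop :=
  ∀ ξ η : E →L[ℝ] ℝ, b ![P.map x ξ, P.map x η] = ξ (P.map x η)

variable {B : Type*} [TopologicalSpace B] [ChartedSpace ℂ B]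
  (G : Type*) [NormedAddCommGroup G] [NormedSpace ℝ G]
  (F : Type*) [TopologicalSpace F] [ChartedSpace G F]

variable {G F} in
/-- A local trivialization is smooth, together with its inverse. -/
def IsSmoothTrivialization {π : X → B} (e : Bundle.Trivialization F π) : Prop :=
  ContMDiffOn 𝓘(ℝ, E) (𝓘(ℝ, ℂ).prod 𝓘(ℝ, G)) ∞ e e.source ∧
  ContMDiffOn (𝓘(ℝ, ℂ).prod 𝓘(ℝ, G)) 𝓘(ℝ, E) ∞ e.toOpenPartialHomeomorph.symm e.target

/-- `π : X → B` with the Poisson structure `P` is a smooth symplectic family: a smooth fibre bundle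
with fibre `F`, whose vertical distribution is the image of `P` (so that the symplectic
leaves are the fibres, or their connected components if the fibres are not connected). -/
structure IsSmoothSymplecticFamily (π : X → B) (P : PoissonStructure E X) : Prop where
  trivial : ∀ b : B, ∃ e : Bundle.Trivialization F π, b ∈ e.baseSet ∧ IsSmoothTrivialization (E := E) (G := G) e
  range_eq : ∀ (x : X) (v : E),
    (∃ ξ : E →L[ℝ] ℝ, P.map x ξ = v) ↔ (deriv' π x : E →L[ℝ] ℂ) v = 0

/-- The family is a symplectic fibre bundle: `F` carries a symplectic form `σ` for which there are
local symplectic trivializations. -/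
def IsSymplecticFibreBundle (π : X → B) (P : PoissonStructure E X) : Prop :=
  ∃ σ : F → G [⋀^Fin 2]→L[ℝ] ℝ, SmoothFormOn σ Set.univ ∧ (∀ y, extD σ y = 0) ∧
    (∀ y u, (∀ v, σ y ![u, v] = 0) → u = 0) ∧
    ∀ b : B, ∃ e : Bundle.Trivialization F π, b ∈ e.baseSet ∧ IsSmoothTrivialization (E := E) (G := G) e ∧
      ∀ x ∈ e.source, P.IsLeafForm x
        ((σ (e x).2).compContinuousLinearMap (deriv' (fun z => (e z).2) x))

variable [IsManifold 𝓘(ℝ, E) ∞ X]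

/-- `c` is the class `[ω]` in `H^{0;2}` of the leafwise symplectic form `ω`: it is represented by an
extension of `ω` to a real `2`-form on `X`. -/
def IsLeafClass (π : X → B) (P : PoissonStructure E X) (c : FibCoh (E := E) π 0 2) : Prop :=
  ∃ (α : cocycles (E := E) π 0 2) (b : X → E [⋀^Fin 2]→L[ℝ] ℝ),
    (∀ x, P.IsLeafForm x (b x)) ∧ (∀ x, α.1.1 x = toC (b x)) ∧ c = FibCoh.mk π 0 2 α

/-- `∂ ∂̄ [ω] = 0`. -/
def IsPluriharmonic (π : X → B) (P : PoissonStructure E X) : Prop :=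
  ∃ (c : FibCoh (E := E) π 0 2) (c' : FibCoh (E := E) π 1 3),
    IsLeafClass π P c ∧ IsDelbar π 0 0 c c' ∧ IsDel π 0 1 c' 0

end Families

/-! ## Generalized complex structures -/

section GeneralizedComplex

variable {E : Type*} [NormedAddCommGroup E] [NormedSpace ℝ E]
  {X : Type*} [TopologicalSpace X] [ChartedSpace E X]

/-- Smoothness of spinor fields on `U`. -/
def SmoothSpinorOn (ρ : X → Spinor E) (U : Set X) : Prop :=
  ∀ k, SmoothFormOn (fun x => ρ x k) U

/-- The twisted exterior derivative `d_H ρ = d ρ + H ∧ ρ`. -/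
def dTwisted (H : X → E [⋀^Fin 3]→L[ℝ] ℝ) (ρ : X → Spinor E) (x : X) : Spinor E :=
  (fun k => match k with
    | 0 => 0
    | k + 1 => extD (fun z => ρ z k) x) + wedgeSpinor (toC (H x)) (ρ x)

variable (E X) in
/-- An almost generalized complex structure, given by its canonical line bundle: a smooth
complex line bundle of spinors which are pure and of real rank zero. -/
structure AlmostGenCplx where
  /-- the canonical line bundle -/
  line : X → Submodule ℂ (Spinor E)
  smooth : ∀ x₀ : X, ∃ (U : Set X) (ρ : X → Spinor E), IsOpen U ∧ x₀ ∈ U ∧ SmoothSpinorOn ρ U ∧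
    ∀ x ∈ U, ρ x ≠ 0 ∧ line x = Submodule.span ℂ {ρ x}
  pure : ∀ x, ∀ ρ ∈ line x, ρ ≠ 0 → IsPure ρ
  realRankZero : ∀ x, ∀ ρ ∈ line x, ρ ≠ 0 → HasRealRankZero ρ

variable [IsManifold 𝓘(ℝ, E) ∞ X]

/-- `J` is `H`-integrable: every (nowhere vanishing) local section `ρ` of the canonical line bundle
satisfies `d_H ρ = (Y, ξ) · ρ` for a smooth local section `(Y, ξ)` of `T_ℂ X ⊕ T_ℂ^* X`. -/
def AlmostGenCplx.IsIntegrable (J : AlmostGenCplx E X) (H : X → E [⋀^Fin 3]→L[ℝ] ℝ) : Prop :=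
  ∀ (U : Set X) (ρ : X → Spinor E), IsOpen U → SmoothSpinorOn ρ U →
    (∀ x ∈ U, ρ x ∈ J.line x ∧ ρ x ≠ 0) →
    ∃ a : X → GenVec E, SmoothVectorFieldOn (fun x => (a x).re) U ∧
      SmoothVectorFieldOn (fun x => (a x).im) U ∧ SmoothFormOn (fun x => (a x).form) U ∧
      ∀ x ∈ U, dTwisted H ρ x = (a x).act (ρ x)

variable {B : Type*} [TopologicalSpace B] [ChartedSpace ℂ B]

/-- The canonical line at `x` of the complex structure transverse to the fibres of `π` that is
pulled back from the Riemann surface `B`: the covectors `L ∘ dπ`, where `L` is complex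
linear. -/
def transverseLine (π : X → B) (x : X) : Set (Spinor E) :=
  {ρ | ∃ L : ℂ →L[ℂ] ℂ, ρ = Pi.single 1 (ContinuousAlternatingMap.ofSubsingleton ℝ E ℂ (0 : Fin 1)
    ((L.restrictScalars ℝ).comp (deriv' π x)))}

/-- `J` induces the Poisson structure `P` and the transverse complex structure pulled back
along `π`: at each point the canonical line is `e^{b + i w} ∧ κ_I`, where `b`, `w` are real
`2`-covectors and `w` restricts to the symplectic form of the leaf. -/
def AlmostGenCplx.Induces (J : AlmostGenCplx E X) (π : X → B) (P : PoissonStructure E X) : Prop :=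
  ∀ x, ∃ b w : E [⋀^Fin 2]→L[ℝ] ℝ, P.IsLeafForm x w ∧
    (J.line x : Set (Spinor E)) = expWedge (toC b + Complex.I • toC w) '' transverseLine π x

/-- The pair `(P, I)`, with `I` pulled back along `π`, is generalized complex: it is induced by a
generalized complex structure with curvature some closed real `3`-form `H`. -/
def IsGeneralizedComplex (π : X → B) (P : PoissonStructure E X) : Prop :=
  ∃ (H : X → E [⋀^Fin 3]→L[ℝ] ℝ) (J : AlmostGenCplx E X),
    SmoothFormOn H Set.univ ∧ (∀ x, extD H x = 0) ∧ J.IsIntegrable H ∧ J.Induces π P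

end GeneralizedComplex

end GenCplx

end

/-!
Let `θ = dπ`, a complex linear functional at each point whose kernel is the vertical space; it spans
the line `κ_I`.  The spinors inducing `(P, I)` are the multiples of `e^σ ∧ θ`, where `σ` is a
complex `2`-covector whose imaginary part extends the leafwise symplectic form `ω`, and only `σ ∧ θ`
matters (`expWedge_congr`).  Such spinors are always pure of real rank zero, by the nondegeneracy of
`ω` (`isPure_expWedge`, `hasRealRankZero_expWedge`), so that integrability is the only condition.

For a local coordinate `g` of the base, pulled back to `X`, and a smooth complex `2`-form `σ`,
`d_H (e^σ ∧ dg) = e^σ ∧ (dσ + H) ∧ dg` (`dTwisted_expWedge`), while an element `(Y, ξ)` acts on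
`e^σ ∧ dg` by `e^σ ∧ (dg(Y) + (ι_Y σ + ξ) ∧ dg)` (`act_expWedge`).  Since `e^σ` is injective
(`expWedge_injective`), and the first expression has degree four but the second has degrees zero and
two before `e^σ` is applied, integrability means that `K = dσ + H` satisfies `K ∧ κ_I = 0`.  As the
base has complex dimension one, this says that `K` is in `F_1` and has type `(1, 0)` along the base
(`mem_typeForms_of_wedge_eq_zero`, `wedge_eq_zero_of_type`).

If `(P, I)` is generalized complex, smooth local exponents `σ` are found by dividing the component
of degree three of a section by that of degree one, and they are glued by a partition of unity,
which is possible since the exponents of a line form an affine space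
(`AlmostGenCplx.Induces.exists_smooth_exponent`).  Then `w = Im σ` represents `[ω]`, and
`dw = (i/2) conj K - (i/2) K`, because `H` is real.  Both terms are closed, and they have types
`(0, 1)` and `(1, 0)`.  Thus `∂̄[ω]` is the class of a closed form, and `∂∂̄[ω] = 0`
(`IsSmoothSymplecticFamily.isPluriharmonic_of_isGeneralizedComplex`).

Conversely, if `∂∂̄[ω] = 0`, then `[ω]` has a representative `a` with `da = β + γ`, where `β` and
`γ` are closed and of types `(0, 1)` and `(1, 0)` up to elements of `F_2`: the obstructions to this
are of type `(0, 2)` or in `F_3`, and there are no such forms over a Riemann surface.  With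
`w = Re a` and `H = Im β - Im γ`, the form `H + i dw = i (conj β + γ)` has type `(1, 0)` modulo
`F_2`, so that `e^{i w} ∧ κ_I` is integrable with curvature `H`
(`IsSmoothSymplecticFamily.isGeneralizedComplex_of_isPluriharmonic`).

In a symplectic fibre bundle, the form of the fibre is pulled back by local trivializations, and the
pullbacks are averaged with functions on the base.  As the pullbacks are closed and agree along the
fibres, the average `w` satisfies `dw ∈ F_2`, whence `dw ∧ κ_I = 0`, and one may take `H = 0`
(`IsSmoothSymplecticFamily.isGeneralizedComplex_of_isSymplecticFibreBundle`).

Identities for wedge products are reduced to the antiderivation rule for contractions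
(`wedge_curryLeft`, `contract_wedgeSpinor`) and proved by induction on the degree; this includes the
Leibniz rule (`dSpinor_wedgeSpinor`).
-/

open scoped Manifold ContDiff Topology

noncomputable section

set_option maxSynthPendingDepth 3

namespace GenCplx

/-! ### Contraction of wedge products -/

section Wedge
variable {E : Type*} [NormedAddCommGroup E] [NormedSpace ℝ E]

/-- A permutation of `Fin (k + 1)` is given by the preimage `p` of `0` and a permutation of the
remaining `k` places. -/
theorem bijective_permOfPreimageZero (k : ℕ) :
    Function.Bijective (fun q : Fin (k + 1) × Equiv.Perm (Fin k) =>
      Equiv.Perm.decomposeFin.symm (0, q.2) * Fin.cycleRange q.1) := by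
  rw [Fintype.bijective_iff_injective_and_card]
  constructor
  · rintro ⟨p, e⟩ ⟨q, f⟩ h
    simp only at h
    have h0 : ∀ (p : Fin (k + 1)) (e : Equiv.Perm (Fin k)),
        (Equiv.Perm.decomposeFin.symm (0, e) * Fin.cycleRange p)⁻¹ 0 = p := by
      intro p e
      rw [Equiv.Perm.inv_eq_iff_eq, Equiv.Perm.mul_apply, Fin.cycleRange_self,
        Equiv.Perm.decomposeFin_symm_apply_zero]
    obtain rfl : p = q := by rw [← h0 p e, h, h0 q f]
    have := Equiv.Perm.decomposeFin.symm.injective (mul_right_cancel h)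
    simpa using this
  · simp [Fintype.card_perm, Nat.factorial_succ]

/-- The terms of the alternatization, grouped according to the slot `p` of the tensor in which the
first vector `u` is inserted. -/
theorem alternatization_vecCons {k : ℕ} (T : ContinuousMultilinearMap ℝ (fun _ : Fin (k + 1) => E) ℂ)
    (u : E) (v : Fin k → E) :
    T.alternatization (Matrix.vecCons u v) = ∑ p : Fin (k + 1), (-1 : ℂ) ^ (p : ℕ) *
      ∑ e : Equiv.Perm (Fin k), ((Equiv.Perm.sign e : ℤ) : ℂ) * T (p.insertNth u (v ∘ e)) := by
  rw [ContinuousMultilinearMap.alternatization_apply_apply,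
    ← Function.Bijective.sum_comp (bijective_permOfPreimageZero k), Fintype.sum_prod_type]
  refine Finset.sum_congr rfl fun p _ => ?_
  rw [Finset.mul_sum]
  refine Finset.sum_congr rfl fun e _ => ?_
  have h : (fun i => (Matrix.vecCons u v : Fin (k + 1) → E)
      ((Equiv.Perm.decomposeFin.symm (0, e) * Fin.cycleRange p) i)) = p.insertNth u (v ∘ e) := by
    rw [← Fin.cons_comp_cycleRange]
    funext i
    simp only [Equiv.Perm.coe_mul, Function.comp_apply]
    refine Fin.cases ?_ (fun j => ?_) (Fin.cycleRange p i)
    · simp [Matrix.vecCons]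
    · simp [Matrix.vecCons, Equiv.Perm.decomposeFin_symm_apply_succ]
  have h' := congrArg T h
  simp only [Function.comp_def] at h' ⊢
  rw [h']
  simp [Units.smul_def, Fin.sign_cycleRange]
  ring

theorem neg_one_pow_smul_complex (n : ℕ) (z : ℂ) : (-1 : ℤ) ^ n • z = (-1 : ℂ) ^ n * z := by
  simp [zsmul_eq_mul]

theorem tensor_insertNth_castAdd {a b k : ℕ} (h : a + 1 + b = k + 1) (h' : a + b = k)
    (α : E [⋀^Fin (a + 1)]→L[ℝ] ℂ) (β : E [⋀^Fin b]→L[ℝ] ℂ) (i : Fin (a + 1)) (u : E)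
    (y : Fin k → E) :
    tensor h α β ((Fin.cast h (Fin.castAdd b i)).insertNth u y) =
      (-1 : ℂ) ^ (i : ℕ) * tensor h' (α.curryLeft u) β y := by
  subst h'
  have h1 : (fun j => (Fin.cast h (Fin.castAdd b i)).insertNth (α := fun _ => E) u y (Fin.cast h (Fin.castAdd b j)))
      = i.insertNth (α := fun _ => E) u (fun j => y (Fin.castAdd b j)) := by
    symm
    rw [Fin.insertNth_eq_iff]
    refine ⟨by simp, ?_⟩
    funext j
    have : Fin.cast h (Fin.castAdd b (i.succAbove j)) =
        (Fin.cast h (Fin.castAdd b i)).succAbove (Fin.castAdd b j) := by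
      ext; simp [Fin.succAbove, Fin.lt_def]; split_ifs <;> simp
    rw [Fin.removeNth, this, Fin.insertNth_apply_succAbove]
  have h2 : ∀ j, (Fin.cast h (Fin.castAdd b i)).insertNth (α := fun _ => E) u y
      (Fin.cast h (Fin.natAdd (a + 1) j)) = y (Fin.natAdd a j) := by
    intro j
    have : Fin.cast h (Fin.natAdd (a + 1) j) =
        (Fin.cast h (Fin.castAdd b i)).succAbove (Fin.natAdd a j) := by
      have := i.2
      ext; simp [Fin.succAbove, Fin.lt_def]; split_ifs <;> simp <;> omega
    rw [this, Fin.insertNth_apply_succAbove]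
  change α _ * β _ = _ * (α _ * β _)
  simp only [h1, h2]
  have := AlternatingMap.map_insertNth α.toAlternatingMap i u (fun j => y (Fin.castAdd b j))
  simp only [ContinuousAlternatingMap.coe_toAlternatingMap] at this
  rw [this, neg_one_pow_smul_complex, mul_assoc]
  rfl

theorem tensor_insertNth_natAdd {a b k : ℕ} (h : a + (b + 1) = k + 1) (h' : a + b = k)
    (α : E [⋀^Fin a]→L[ℝ] ℂ) (β : E [⋀^Fin (b + 1)]→L[ℝ] ℂ) (i : Fin (b + 1)) (u : E)
    (y : Fin k → E) :
    tensor h α β ((Fin.cast h (Fin.natAdd a i)).insertNth u y) =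
      (-1 : ℂ) ^ (i : ℕ) * tensor h' α (β.curryLeft u) y := by
  subst h'
  have h1 : (fun j => (Fin.cast h (Fin.natAdd a i)).insertNth (α := fun _ => E) u y (Fin.cast h (Fin.natAdd a j)))
      = i.insertNth (α := fun _ => E) u (fun j => y (Fin.natAdd a j)) := by
    symm
    rw [Fin.insertNth_eq_iff]
    refine ⟨by simp, ?_⟩
    funext j
    have : Fin.cast h (Fin.natAdd a (i.succAbove j)) =
        (Fin.cast h (Fin.natAdd a i)).succAbove (Fin.natAdd a j) := by
      ext; simp [Fin.succAbove, Fin.lt_def]; split_ifs <;> simp; omega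
    rw [Fin.removeNth, this, Fin.insertNth_apply_succAbove]
  have h2 : ∀ j, (Fin.cast h (Fin.natAdd a i)).insertNth (α := fun _ => E) u y
      (Fin.cast h (Fin.castAdd (b + 1) j)) = y (Fin.castAdd b j) := by
    intro j
    have : Fin.cast h (Fin.castAdd (b + 1) j) =
        (Fin.cast h (Fin.natAdd a i)).succAbove (Fin.castAdd b j) := by
      have := j.2
      ext; simp [Fin.succAbove, Fin.lt_def]; split_ifs <;> simp <;> omega
    rw [this, Fin.insertNth_apply_succAbove]
  change α _ * β _ = _ * (α _ * β _)
  simp only [h1, h2]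
  have := AlternatingMap.map_insertNth β.toAlternatingMap i u (fun j => y (Fin.natAdd a j))
  simp only [ContinuousAlternatingMap.coe_toAlternatingMap] at this
  rw [this, neg_one_pow_smul_complex, mul_left_comm]
  rfl

theorem alternatization_tensor_castAdd {a b k : ℕ} (h : a + 1 + b = k + 1) (h' : a + b = k)
    (α : E [⋀^Fin (a + 1)]→L[ℝ] ℂ) (β : E [⋀^Fin b]→L[ℝ] ℂ) (u : E) (v : Fin k → E) :
    ∑ i : Fin (a + 1), (-1 : ℂ) ^ (i : ℕ) * ∑ e : Equiv.Perm (Fin k),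
      ((Equiv.Perm.sign e : ℤ) : ℂ) *
        tensor h α β ((Fin.cast h (Fin.castAdd b i)).insertNth u (v ∘ e)) =
      (a + 1) * (tensor h' (α.curryLeft u) β).alternatization v := by
  have key : ∀ i : Fin (a + 1), (-1 : ℂ) ^ (i : ℕ) * ∑ e : Equiv.Perm (Fin k),
      ((Equiv.Perm.sign e : ℤ) : ℂ) *
        tensor h α β ((Fin.cast h (Fin.castAdd b i)).insertNth u (v ∘ e)) =
      (tensor h' (α.curryLeft u) β).alternatization v := by
    intro i
    rw [ContinuousMultilinearMap.alternatization_apply_apply, Finset.mul_sum]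
    refine Finset.sum_congr rfl fun e _ => ?_
    rw [tensor_insertNth_castAdd h h', Units.smul_def, zsmul_eq_mul]
    have : (-1 : ℂ) ^ (i : ℕ) * (-1 : ℂ) ^ (i : ℕ) = 1 := by
      rw [← mul_pow]; simp
    linear_combination (((Equiv.Perm.sign e : ℤ) : ℂ) *
      tensor h' (α.curryLeft u) β (v ∘ e)) * this
  rw [Finset.sum_congr rfl fun i _ => key i]
  simp

theorem alternatization_tensor_natAdd {a b k : ℕ} (h : a + (b + 1) = k + 1) (h' : a + b = k)
    (α : E [⋀^Fin a]→L[ℝ] ℂ) (β : E [⋀^Fin (b + 1)]→L[ℝ] ℂ) (u : E) (v : Fin k → E) :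
    ∑ i : Fin (b + 1), (-1 : ℂ) ^ (a + i : ℕ) * ∑ e : Equiv.Perm (Fin k),
      ((Equiv.Perm.sign e : ℤ) : ℂ) *
        tensor h α β ((Fin.cast h (Fin.natAdd a i)).insertNth u (v ∘ e)) =
      (b + 1) * ((-1) ^ a * (tensor h' α (β.curryLeft u)).alternatization v) := by
  have key : ∀ i : Fin (b + 1), (-1 : ℂ) ^ (a + i : ℕ) * ∑ e : Equiv.Perm (Fin k),
      ((Equiv.Perm.sign e : ℤ) : ℂ) *
        tensor h α β ((Fin.cast h (Fin.natAdd a i)).insertNth u (v ∘ e)) =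
      (-1) ^ a * (tensor h' α (β.curryLeft u)).alternatization v := by
    intro i
    rw [ContinuousMultilinearMap.alternatization_apply_apply, Finset.mul_sum, Finset.mul_sum]
    refine Finset.sum_congr rfl fun e _ => ?_
    rw [tensor_insertNth_natAdd h h', Units.smul_def, zsmul_eq_mul, pow_add]
    have : (-1 : ℂ) ^ (i : ℕ) * (-1 : ℂ) ^ (i : ℕ) = 1 := by
      rw [← mul_pow]; simp
    linear_combination ((-1) ^ a * ((Equiv.Perm.sign e : ℤ) : ℂ) *
      tensor h' α (β.curryLeft u) (v ∘ e)) * this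
  rw [Finset.sum_congr rfl fun i _ => key i]
  simp

theorem sum_fin_of_add_eq {a b k : ℕ} (h : a + b = k) (f : Fin k → ℂ) :
    ∑ p, f p = ∑ i : Fin a, f (Fin.cast h (Fin.castAdd b i)) +
      ∑ i : Fin b, f (Fin.cast h (Fin.natAdd a i)) := by
  subst h
  exact Fin.sum_univ_add f

/-- Contraction with a vector is an antiderivation of the wedge product. -/
theorem wedge_curryLeft {a b k : ℕ} (h : a + 1 + (b + 1) = k + 1) (h₁ : a + (b + 1) = k)
    (h₂ : a + 1 + b = k) (α : E [⋀^Fin (a + 1)]→L[ℝ] ℂ) (β : E [⋀^Fin (b + 1)]→L[ℝ] ℂ) (u : E) :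
    (wedge h α β).curryLeft u =
      wedge h₁ (α.curryLeft u) β + (-1 : ℂ) ^ (a + 1) • wedge h₂ α (β.curryLeft u) := by
  ext v
  change _ * (tensor h α β).alternatization (Matrix.vecCons u v) =
    _ * (tensor h₁ (α.curryLeft u) β).alternatization v + (-1) ^ (a + 1) *
      (_ * (tensor h₂ α (β.curryLeft u)).alternatization v)
  rw [alternatization_vecCons, sum_fin_of_add_eq h]
  simp only [Fin.val_cast, Fin.val_castAdd, Fin.val_natAdd]
  rw [alternatization_tensor_castAdd h h₁, alternatization_tensor_natAdd h h₂]
  have ha : (a : ℂ) + 1 ≠ 0 := Nat.cast_add_one_ne_zero a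
  have hb : (b : ℂ) + 1 ≠ 0 := Nat.cast_add_one_ne_zero b
  have ha' : (a.factorial : ℂ) ≠ 0 := Nat.cast_ne_zero.2 a.factorial_ne_zero
  have hb' : (b.factorial : ℂ) ≠ 0 := Nat.cast_ne_zero.2 b.factorial_ne_zero
  simp only [Nat.factorial_succ, Nat.cast_mul, Nat.cast_add, Nat.cast_one]
  field_simp

/-- The antiderivation rule for a right factor of degree zero, which has no contraction. -/
theorem wedge_curryLeft_of_zero {a k : ℕ} (h : a + 1 + 0 = k + 1) (h₁ : a + 0 = k)
    (α : E [⋀^Fin (a + 1)]→L[ℝ] ℂ) (β : E [⋀^Fin 0]→L[ℝ] ℂ) (u : E) :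
    (wedge h α β).curryLeft u = wedge h₁ (α.curryLeft u) β := by
  ext v
  change _ * (tensor h α β).alternatization (Matrix.vecCons u v) =
    _ * (tensor h₁ (α.curryLeft u) β).alternatization v
  rw [alternatization_vecCons, sum_fin_of_add_eq h]
  simp only [Fin.val_cast, Fin.val_castAdd, Fin.val_natAdd]
  rw [alternatization_tensor_castAdd h h₁]
  have ha : (a : ℂ) + 1 ≠ 0 := Nat.cast_add_one_ne_zero a
  have ha' : (a.factorial : ℂ) ≠ 0 := Nat.cast_ne_zero.2 a.factorial_ne_zero
  simp only [Nat.factorial_succ, Nat.cast_mul, Nat.cast_add, Nat.cast_one, Finset.univ_eq_empty,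
    Finset.sum_empty, add_zero]
  field_simp

theorem zero_wedge_apply {b : ℕ} (h : 0 + b = b) (α : E [⋀^Fin 0]→L[ℝ] ℂ)
    (β : E [⋀^Fin b]→L[ℝ] ℂ) : wedge h α β = α 0 • β := by
  ext v
  change _ * (tensor h α β).alternatization v = α 0 * β v
  rw [ContinuousMultilinearMap.alternatization_apply_apply]
  have key : ∀ e : Equiv.Perm (Fin b), Equiv.Perm.sign e • tensor h α β (v ∘ e) =
      α 0 * β v := by
    intro e
    have h1 : (fun i : Fin 0 => v (e (Fin.cast h (Fin.castAdd b i)))) = 0 := by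
      funext i; exact i.elim0
    have h2 : (fun i : Fin b => v (e (Fin.cast h (Fin.natAdd 0 i)))) = v ∘ e := by
      funext i; simp
    change Equiv.Perm.sign e • (α (fun i : Fin 0 => v (e (Fin.cast h (Fin.castAdd b i)))) *
      β (fun i : Fin b => v (e (Fin.cast h (Fin.natAdd 0 i))))) = _
    rw [h1, h2]
    have := β.toAlternatingMap.map_perm v e
    simp only [ContinuousAlternatingMap.coe_toAlternatingMap] at this
    rw [this, mul_smul_comm, smul_smul, Int.units_mul_self, one_smul]
  rw [Finset.sum_congr rfl fun e _ => key e]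
  have hb : (b.factorial : ℂ) ≠ 0 := Nat.cast_ne_zero.2 b.factorial_ne_zero
  simp only [Finset.sum_const, Finset.card_univ, Fintype.card_perm, Fintype.card_fin,
    nsmul_eq_mul, Nat.factorial_zero, Nat.cast_one, one_mul]
  rw [inv_mul_cancel_left₀ hb]

/-- Contraction of a spinor with a real vector. -/
def contract (u : E) (ρ : Spinor E) : Spinor E := fun k => (ρ (k + 1)).curryLeft u

theorem wedgeSpinor_zero_degree (α : E [⋀^Fin 0]→L[ℝ] ℂ) (ρ : Spinor E) :
    wedgeSpinor α ρ = α 0 • ρ := by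
  funext k
  exact zero_wedge_apply _ α (ρ k)

theorem wedgeSpinor_apply_of_lt {a k : ℕ} (hk : k < a) (α : E [⋀^Fin a]→L[ℝ] ℂ) (ρ : Spinor E) :
    wedgeSpinor α ρ k = 0 := dif_neg (by omega)

/-- Forms of equal degree may be exchanged although the equality of the degrees is not
definitional. -/
theorem wedge_congr {a b b' k : ℕ} (h : a + b = k) (h' : a + b' = k) (α : E [⋀^Fin a]→L[ℝ] ℂ)
    (ρ : Spinor E) : wedge h α (ρ b) = wedge h' α (ρ b') := by
  obtain rfl : b = b' := by omega
  rfl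

theorem wedgeSpinor_apply {a b k : ℕ} (h : a + b = k) (α : E [⋀^Fin a]→L[ℝ] ℂ) (ρ : Spinor E) :
    wedgeSpinor α ρ k = wedge h α (ρ b) := by
  rw [wedgeSpinor, dif_pos (by omega)]
  exact wedge_congr _ _ _ _

/-- `ι_u (α ∧ ρ) = ι_u α ∧ ρ ± α ∧ ι_u ρ`.  As `ι_u` lowers the degree, identities between products
are proved from this rule by induction on the degree, without permutations. -/
theorem contract_wedgeSpinor {a : ℕ} (u : E) (α : E [⋀^Fin (a + 1)]→L[ℝ] ℂ) (ρ : Spinor E) :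
    contract u (wedgeSpinor α ρ) =
      wedgeSpinor (α.curryLeft u) ρ + (-1 : ℂ) ^ (a + 1) • wedgeSpinor α (contract u ρ) := by
  funext k
  change (wedgeSpinor α ρ (k + 1)).curryLeft u = wedgeSpinor (α.curryLeft u) ρ k +
    (-1 : ℂ) ^ (a + 1) • wedgeSpinor α (contract u ρ) k
  rcases lt_trichotomy k a with hk | hk | hk
  · rw [wedgeSpinor_apply_of_lt (by omega), wedgeSpinor_apply_of_lt hk,
      wedgeSpinor_apply_of_lt (by omega)]
    ext; simp
  · subst hk
    rw [wedgeSpinor_apply (b := 0) rfl, wedgeSpinor_apply (b := 0) (add_zero k),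
      wedgeSpinor_apply_of_lt (by omega), wedge_curryLeft_of_zero rfl rfl]
    simp
  · obtain ⟨b, rfl⟩ : ∃ b, k = a + b + 1 := ⟨k - a - 1, by omega⟩
    rw [wedgeSpinor_apply (b := b + 1) (by omega), wedgeSpinor_apply (b := b + 1) (by omega),
      wedgeSpinor_apply (b := b) (by omega)]
    exact wedge_curryLeft _ _ _ _ _ _

end Wedge

/-! ### The action of forms on spinors -/

section SpinorAlgebra
variable {E : Type*} [NormedAddCommGroup E] [NormedSpace ℝ E]

theorem wedge_apply {a b k : ℕ} (h : a + b = k) (α : E [⋀^Fin a]→L[ℝ] ℂ) (β : E [⋀^Fin b]→L[ℝ] ℂ)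
    (v : Fin k → E) : wedge h α β v = ((a.factorial * b.factorial : ℂ))⁻¹ *
      ∑ e : Equiv.Perm (Fin k), ((Equiv.Perm.sign e : ℤ) : ℂ) *
        (α (fun i => v (e (Fin.cast h (Fin.castAdd b i)))) *
          β (fun i => v (e (Fin.cast h (Fin.natAdd a i))))) := by
  change _ * (tensor h α β).alternatization v = _
  rw [ContinuousMultilinearMap.alternatization_apply_apply]
  congr 1
  refine Finset.sum_congr rfl fun e _ => ?_
  rw [Units.smul_def, zsmul_eq_mul]
  rfl

/-- The wedge product as a bilinear map. -/
def wedgeBilin {a b k : ℕ} (h : a + b = k) :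
    (E [⋀^Fin a]→L[ℝ] ℂ) →ₗ[ℂ] (E [⋀^Fin b]→L[ℝ] ℂ) →ₗ[ℂ] (E [⋀^Fin k]→L[ℝ] ℂ) :=
  LinearMap.mk₂ ℂ (wedge h)
    (fun α α' β => by
      ext v
      simp only [wedge_apply, ContinuousAlternatingMap.add_apply, add_mul, mul_add,
        Finset.sum_add_distrib])
    (fun c α β => by
      ext v
      simp only [wedge_apply, ContinuousAlternatingMap.smul_apply, smul_eq_mul, Finset.mul_sum]
      exact Finset.sum_congr rfl fun e _ => by ring)
    (fun α β β' => by
      ext v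
      simp only [wedge_apply, ContinuousAlternatingMap.add_apply, mul_add, Finset.sum_add_distrib])
    (fun c α β => by
      ext v
      simp only [wedge_apply, ContinuousAlternatingMap.smul_apply, smul_eq_mul, Finset.mul_sum]
      exact Finset.sum_congr rfl fun e _ => by ring)

/-- The wedge product of forms with spinors as a bilinear map. -/
def wedgeSpinorBilin (a : ℕ) : (E [⋀^Fin a]→L[ℝ] ℂ) →ₗ[ℂ] Spinor E →ₗ[ℂ] Spinor E :=
  LinearMap.mk₂ ℂ wedgeSpinor
    (fun α α' ρ => by
      funext k
      simp only [wedgeSpinor, Pi.add_apply]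
      split_ifs with h
      · exact (wedgeBilin _).map_add₂ α α' _
      · simp)
    (fun c α ρ => by
      funext k
      simp only [wedgeSpinor, Pi.smul_apply]
      split_ifs with h
      · exact (wedgeBilin _).map_smul₂ c α _
      · simp)
    (fun α ρ ρ' => by
      funext k
      simp only [wedgeSpinor, Pi.add_apply]
      split_ifs with h
      · exact (wedgeBilin _ α).map_add _ _
      · simp)
    (fun c α ρ => by
      funext k
      simp only [wedgeSpinor, Pi.smul_apply]
      split_ifs with h
      · exact (wedgeBilin _ α).map_smul c _
      · simp)

section
variable {a : ℕ} (α α' : E [⋀^Fin a]→L[ℝ] ℂ) (ρ ρ' : Spinor E) (c : ℂ)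

theorem wedgeSpinor_add : wedgeSpinor α (ρ + ρ') = wedgeSpinor α ρ + wedgeSpinor α ρ' :=
  (wedgeSpinorBilin a α).map_add ρ ρ'

theorem wedgeSpinor_sub : wedgeSpinor α (ρ - ρ') = wedgeSpinor α ρ - wedgeSpinor α ρ' :=
  (wedgeSpinorBilin a α).map_sub ρ ρ'

theorem wedgeSpinor_smul : wedgeSpinor α (c • ρ) = c • wedgeSpinor α ρ :=
  (wedgeSpinorBilin a α).map_smul c ρ

theorem wedgeSpinor_zero : wedgeSpinor α (0 : Spinor E) = 0 :=
  (wedgeSpinorBilin a α).map_zero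

theorem add_wedgeSpinor : wedgeSpinor (α + α') ρ = wedgeSpinor α ρ + wedgeSpinor α' ρ :=
  (wedgeSpinorBilin a).map_add₂ α α' ρ

theorem sub_wedgeSpinor : wedgeSpinor (α - α') ρ = wedgeSpinor α ρ - wedgeSpinor α' ρ :=
  (wedgeSpinorBilin a).map_sub₂ α α' ρ

theorem smul_wedgeSpinor : wedgeSpinor (c • α) ρ = c • wedgeSpinor α ρ :=
  (wedgeSpinorBilin a).map_smul₂ c α ρ

end

theorem curryLeft_ext {k : ℕ} {V : Type*} [NormedAddCommGroup V] [NormedSpace ℝ V]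
    {α β : E [⋀^Fin (k + 1)]→L[ℝ] V} (h : ∀ u, α.curryLeft u = β.curryLeft u) : α = β := by
  ext v
  have := congrArg (fun γ => γ (Matrix.vecTail v)) (h (Matrix.vecHead v))
  simpa using this

theorem form_zero_ext {V : Type*} [NormedAddCommGroup V] [NormedSpace ℝ V]
    {α β : E [⋀^Fin 0]→L[ℝ] V} (h : α 0 = β 0) : α = β := by
  ext v
  rwa [Subsingleton.elim v 0]

theorem contract_wedgeSpinor_zero_degree (u : E) (α : E [⋀^Fin 0]→L[ℝ] ℂ) (ρ : Spinor E) :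
    contract u (wedgeSpinor α ρ) = wedgeSpinor α (contract u ρ) := by
  rw [wedgeSpinor_zero_degree, wedgeSpinor_zero_degree]
  rfl

/-- Left multiplications by forms commute up to the sign. -/
theorem wedgeSpinor_comm {a b : ℕ} (α : E [⋀^Fin a]→L[ℝ] ℂ) (β : E [⋀^Fin b]→L[ℝ] ℂ)
    (ρ : Spinor E) : wedgeSpinor α (wedgeSpinor β ρ) =
      (-1 : ℂ) ^ (a * b) • wedgeSpinor β (wedgeSpinor α ρ) := by
  funext k
  induction k generalizing a b ρ with
  | zero =>
    rcases a with _ | a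
    · rw [wedgeSpinor_zero_degree, wedgeSpinor_zero_degree, wedgeSpinor_smul]; simp
    rcases b with _ | b
    · rw [wedgeSpinor_zero_degree, wedgeSpinor_zero_degree, wedgeSpinor_smul]; simp
    rw [Pi.smul_apply, wedgeSpinor_apply_of_lt (by omega), wedgeSpinor_apply_of_lt (by omega),
      smul_zero]
  | succ k ih =>
    rcases a with _ | a
    · rw [wedgeSpinor_zero_degree, wedgeSpinor_zero_degree, wedgeSpinor_smul]; simp
    rcases b with _ | b
    · rw [wedgeSpinor_zero_degree, wedgeSpinor_zero_degree, wedgeSpinor_smul]; simp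
    refine curryLeft_ext fun u => ?_
    change contract u (wedgeSpinor α (wedgeSpinor β ρ)) k =
      (-1 : ℂ) ^ ((a + 1) * (b + 1)) • contract u (wedgeSpinor β (wedgeSpinor α ρ)) k
    simp only [contract_wedgeSpinor, wedgeSpinor_add, wedgeSpinor_smul, Pi.add_apply,
      Pi.smul_apply]
    rw [ih (α.curryLeft u), ih α (β.curryLeft u), ih α β]
    rcases Nat.even_or_odd a with ha | ha <;> rcases Nat.even_or_odd b with hb | hb <;>
      simp only [pow_add, mul_add, add_mul, pow_mul, ha.neg_one_pow, hb.neg_one_pow, one_pow,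
        pow_one, one_mul, mul_one, Pi.smul_apply] <;> module

theorem wedgeSpinor_comm_of_even {a b : ℕ} (ha : Even a) (α : E [⋀^Fin a]→L[ℝ] ℂ)
    (β : E [⋀^Fin b]→L[ℝ] ℂ) (ρ : Spinor E) :
    wedgeSpinor α (wedgeSpinor β ρ) = wedgeSpinor β (wedgeSpinor α ρ) := by
  rw [wedgeSpinor_comm, (ha.mul_right b).neg_one_pow, one_smul]

/-! ### Exponentials of two-forms -/

theorem wedgeSpinor_apply_eq_zero {a k : ℕ} (α : E [⋀^Fin a]→L[ℝ] ℂ) {ρ : Spinor E}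
    (h : ∀ l < k, ρ l = 0) {l : ℕ} (hl : l < k + a) : wedgeSpinor α ρ l = 0 := by
  by_cases hal : a ≤ l
  · rw [wedgeSpinor_apply (b := l - a) (by omega), h _ (by omega)]
    exact (wedgeBilin _ α).map_zero
  · exact wedgeSpinor_apply_of_lt (by omega) α ρ

theorem iterate_wedgeSpinor_apply_eq_zero (σ : E [⋀^Fin 2]→L[ℝ] ℂ) {k : ℕ} {ρ : Spinor E}
    (h : ∀ l < k, ρ l = 0) (j : ℕ) : ∀ l < k + 2 * j, ((wedgeSpinor σ)^[j] ρ) l = 0 := by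
  induction j with
  | zero => simpa using h
  | succ j ih =>
    intro l hl
    rw [Function.iterate_succ_apply']
    exact wedgeSpinor_apply_eq_zero σ ih (by omega)

/-- In degree `k`, the exponential series may be summed up to any bound above `k`. -/
theorem expWedge_apply_eq_sum (σ : E [⋀^Fin 2]→L[ℝ] ℂ) (ρ : Spinor E) {k N : ℕ} (hN : k < N) :
    expWedge σ ρ k = ∑ j ∈ Finset.range N, ((j.factorial : ℂ))⁻¹ • ((wedgeSpinor σ)^[j] ρ) k := by
  refine Finset.sum_subset (fun j hj => ?_) fun j _ hj => ?_
  · simp only [Finset.mem_range] at hj ⊢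
    omega
  · simp only [Finset.mem_range, not_lt] at hj
    rw [iterate_wedgeSpinor_apply_eq_zero σ (k := 0) (by simp) j k (by omega), smul_zero]

/-- If `ρ` has no components below degree `k`, then `e^σ ∧ ρ` agrees with `ρ` in degrees `k` and
`k + 1`. -/
theorem expWedge_apply_of_lowest (σ : E [⋀^Fin 2]→L[ℝ] ℂ) {ρ : Spinor E} {k : ℕ}
    (h : ∀ l < k, ρ l = 0) {l : ℕ} (hl : l < k + 2) : expWedge σ ρ l = ρ l := by
  rw [expWedge, Finset.sum_eq_single 0]
  · simp
  · intro j _ hj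
    rw [iterate_wedgeSpinor_apply_eq_zero σ h j l (by omega), smul_zero]
  · simp

theorem expWedge_injective (σ : E [⋀^Fin 2]→L[ℝ] ℂ) {ρ : Spinor E} (h : expWedge σ ρ = 0) :
    ρ = 0 := by
  funext k
  induction k using Nat.strong_induction_on with
  | _ k ih => rw [← expWedge_apply_of_lowest σ ih (Nat.lt_add_of_pos_right two_pos), h]

theorem iterate_wedgeSpinor_eq (σ : E [⋀^Fin 2]→L[ℝ] ℂ) (j : ℕ) (ρ : Spinor E) :
    (wedgeSpinor σ)^[j] ρ = ((wedgeSpinorBilin 2 σ) ^ j) ρ := by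
  rw [Module.End.pow_apply]
  rfl

theorem iterate_wedgeSpinor_add (σ : E [⋀^Fin 2]→L[ℝ] ℂ) (j : ℕ) (ρ ρ' : Spinor E) :
    (wedgeSpinor σ)^[j] (ρ + ρ') = (wedgeSpinor σ)^[j] ρ + (wedgeSpinor σ)^[j] ρ' := by
  simp only [iterate_wedgeSpinor_eq, map_add]

theorem iterate_wedgeSpinor_smul (σ : E [⋀^Fin 2]→L[ℝ] ℂ) (j : ℕ) (c : ℂ) (ρ : Spinor E) :
    (wedgeSpinor σ)^[j] (c • ρ) = c • (wedgeSpinor σ)^[j] ρ := by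
  simp only [iterate_wedgeSpinor_eq, map_smul]

theorem expWedge_add (σ : E [⋀^Fin 2]→L[ℝ] ℂ) (ρ ρ' : Spinor E) :
    expWedge σ (ρ + ρ') = expWedge σ ρ + expWedge σ ρ' := by
  funext k
  simp only [expWedge, iterate_wedgeSpinor_add, Pi.add_apply, smul_add, Finset.sum_add_distrib]

theorem expWedge_smul (σ : E [⋀^Fin 2]→L[ℝ] ℂ) (c : ℂ) (ρ : Spinor E) :
    expWedge σ (c • ρ) = c • expWedge σ ρ := by
  funext k
  simp only [expWedge, iterate_wedgeSpinor_smul, Pi.smul_apply, Finset.smul_sum]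
  exact Finset.sum_congr rfl fun j _ => smul_comm _ _ _

theorem expWedge_zero (σ : E [⋀^Fin 2]→L[ℝ] ℂ) : expWedge σ (0 : Spinor E) = 0 := by
  have := expWedge_smul σ 0 (0 : Spinor E)
  rwa [zero_smul, zero_smul] at this

theorem expWedge_sub (σ : E [⋀^Fin 2]→L[ℝ] ℂ) (ρ ρ' : Spinor E) :
    expWedge σ (ρ - ρ') = expWedge σ ρ - expWedge σ ρ' := by
  rw [sub_eq_add_neg, ← neg_one_smul ℂ ρ', expWedge_add, expWedge_smul, neg_one_smul,
    sub_eq_add_neg]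

theorem iterate_wedgeSpinor_comm (σ : E [⋀^Fin 2]→L[ℝ] ℂ) {a : ℕ} (α : E [⋀^Fin a]→L[ℝ] ℂ)
    (j : ℕ) (ρ : Spinor E) :
    (wedgeSpinor σ)^[j] (wedgeSpinor α ρ) = wedgeSpinor α ((wedgeSpinor σ)^[j] ρ) := by
  induction j with
  | zero => rw [Function.iterate_zero, id, id]
  | succ j ih =>
    rw [Function.iterate_succ_apply', ih, wedgeSpinor_comm_of_even even_two,
      Function.iterate_succ_apply']

theorem wedgeSpinor_sum_apply {a : ℕ} (α : E [⋀^Fin a]→L[ℝ] ℂ) (N : ℕ) (f : ℕ → Spinor E) :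
    wedgeSpinor α (∑ j ∈ Finset.range N, f j) = ∑ j ∈ Finset.range N, wedgeSpinor α (f j) :=
  map_sum (wedgeSpinorBilin a α) _ _

/-- `e^σ` commutes with the left multiplications, as it has even degree. -/
theorem expWedge_wedgeSpinor (σ : E [⋀^Fin 2]→L[ℝ] ℂ) {a : ℕ} (α : E [⋀^Fin a]→L[ℝ] ℂ)
    (ρ : Spinor E) : expWedge σ (wedgeSpinor α ρ) = wedgeSpinor α (expWedge σ ρ) := by
  funext k
  by_cases hk : a ≤ k
  · have h1 : (expWedge σ ρ) (k - a) =
        (∑ j ∈ Finset.range (k + 1), ((j.factorial : ℂ))⁻¹ • (wedgeSpinor σ)^[j] ρ) (k - a) := by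
      rw [expWedge_apply_eq_sum σ ρ (N := k + 1) (by omega), Finset.sum_apply]
      rfl
    rw [wedgeSpinor_apply (Nat.add_sub_of_le hk) α (expWedge σ ρ), h1,
      ← wedgeSpinor_apply (Nat.add_sub_of_le hk), wedgeSpinor_sum_apply, Finset.sum_apply]
    refine Finset.sum_congr rfl fun j _ => ?_
    rw [iterate_wedgeSpinor_comm, wedgeSpinor_smul, Pi.smul_apply]
  · rw [wedgeSpinor_apply_of_lt (by omega), expWedge]
    refine Finset.sum_eq_zero fun j _ => ?_
    rw [iterate_wedgeSpinor_comm, wedgeSpinor_apply_of_lt (by omega), smul_zero]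

/-- The spinor `e^σ ∧ ρ` depends on `σ` only through `σ ∧ ρ`.  For `ρ = θ`, this says that the
exponent of a line `e^σ ∧ κ_I` matters only modulo the multiples of `θ`. -/
theorem expWedge_congr {σ σ' : E [⋀^Fin 2]→L[ℝ] ℂ} {ρ : Spinor E}
    (h : wedgeSpinor σ ρ = wedgeSpinor σ' ρ) : expWedge σ ρ = expWedge σ' ρ := by
  have key : ∀ j, (wedgeSpinor σ)^[j] ρ = (wedgeSpinor σ')^[j] ρ := by
    intro j
    induction j with
    | zero => rw [Function.iterate_zero, Function.iterate_zero]
    | succ j ih =>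
      rw [Function.iterate_succ_apply', ih, ← iterate_wedgeSpinor_comm, h,
        ← Function.iterate_succ_apply]
  funext k
  simp only [expWedge, key]

theorem sum_inv_factorial_smul_add {V : Type*} [AddCommGroup V] [Module ℂ V] (f g : ℕ → V)
    (N : ℕ) : ∑ j ∈ Finset.range (N + 1), ((j.factorial : ℂ))⁻¹ • (f j + (j : ℂ) • g (j - 1)) =
      ∑ j ∈ Finset.range (N + 1), ((j.factorial : ℂ))⁻¹ • f j +
        ∑ j ∈ Finset.range N, ((j.factorial : ℂ))⁻¹ • g j := by
  simp only [smul_add, Finset.sum_add_distrib]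
  congr 1
  rw [Finset.sum_range_succ']
  simp only [Nat.cast_zero, zero_smul, smul_zero, add_zero, Nat.add_sub_cancel]
  refine Finset.sum_congr rfl fun j _ => ?_
  rw [smul_smul, Nat.factorial_succ, Nat.cast_mul]
  congr 1
  have : ((j + 1 : ℕ) : ℂ) ≠ 0 := Nat.cast_ne_zero.2 (Nat.succ_ne_zero j)
  rw [mul_inv_rev, mul_assoc, inv_mul_cancel₀ this, mul_one]

/-- The exponential series `∑ (1 / j!) (L^j τ + j L^(j - 1) μ)` is `e^σ ∧ (τ + μ)`, where `L` is
left multiplication by `σ`.  -/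
theorem sum_exp_derivation (σ : E [⋀^Fin 2]→L[ℝ] ℂ) (τ μ : Spinor E) {k N : ℕ} (hN : k < N) :
    ∑ j ∈ Finset.range (N + 1), ((j.factorial : ℂ))⁻¹ • (((wedgeSpinor σ)^[j] τ) k +
      (j : ℂ) • ((wedgeSpinor σ)^[j - 1] μ) k) = expWedge σ (τ + μ) k := by
  rw [expWedge_add, Pi.add_apply, expWedge_apply_eq_sum σ τ (N := N + 1) (by omega),
    expWedge_apply_eq_sum σ μ hN]
  exact sum_inv_factorial_smul_add (fun j => ((wedgeSpinor σ)^[j] τ) k)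
    (fun j => ((wedgeSpinor σ)^[j] μ) k) N

/-- `ι_u (σ^j ∧ ρ) = σ^j ∧ ι_u ρ + j σ^(j - 1) ∧ ι_u σ ∧ ρ`. -/
theorem contract_iterate_wedgeSpinor (σ : E [⋀^Fin 2]→L[ℝ] ℂ) (u : E) (ρ : Spinor E) (j : ℕ) :
    contract u ((wedgeSpinor σ)^[j] ρ) = (wedgeSpinor σ)^[j] (contract u ρ) +
      (j : ℂ) • (wedgeSpinor σ)^[j - 1] (wedgeSpinor (σ.curryLeft u) ρ) := by
  induction j with
  | zero => simp
  | succ j ih =>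
    rw [Function.iterate_succ_apply', contract_wedgeSpinor, ih, wedgeSpinor_add, wedgeSpinor_smul,
      ← Function.iterate_succ_apply' (wedgeSpinor σ), Nat.add_sub_cancel, ← iterate_wedgeSpinor_comm]
    rcases j with _ | j
    · simp [add_comm]
    · rw [Nat.add_sub_cancel, ← Function.iterate_succ_apply' (wedgeSpinor σ)]
      push_cast
      simp only [even_two.neg_one_pow, one_smul, add_smul]
      abel

/-- `ι_u (e^σ ∧ ρ) = e^σ ∧ (ι_u ρ + ι_u σ ∧ ρ)`. -/
theorem contract_expWedge (σ : E [⋀^Fin 2]→L[ℝ] ℂ) (u : E) (ρ : Spinor E) :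
    contract u (expWedge σ ρ) =
      expWedge σ (contract u ρ + wedgeSpinor (σ.curryLeft u) ρ) := by
  funext k
  rw [← sum_exp_derivation σ _ _ (N := k + 1) (by omega)]
  have h := fun j => congrFun (contract_iterate_wedgeSpinor σ u ρ j) k
  simp only [Pi.add_apply, Pi.smul_apply] at h
  simp only [← h]
  ext v
  simp only [contract, expWedge, ContinuousAlternatingMap.curryLeft_apply_apply,
    ContinuousAlternatingMap.sum_apply, ContinuousAlternatingMap.smul_apply]

/-- `(Y, ξ) · (e^σ ∧ ρ) = e^σ ∧ (ι_Y ρ + (ι_Y σ + ξ) ∧ ρ)`, where `Y = re + i im`. -/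
theorem act_expWedge (a : GenVec E) (σ : E [⋀^Fin 2]→L[ℝ] ℂ) (ρ : Spinor E) :
    a.act (expWedge σ ρ) = expWedge σ (contract a.re ρ + Complex.I • contract a.im ρ +
      wedgeSpinor (σ.curryLeft a.re + Complex.I • σ.curryLeft a.im + a.form) ρ) := by
  have h : a.act (expWedge σ ρ) = contract a.re (expWedge σ ρ) +
      Complex.I • contract a.im (expWedge σ ρ) + wedgeSpinor a.form (expWedge σ ρ) := rfl
  rw [h, contract_expWedge, contract_expWedge, ← expWedge_wedgeSpinor, ← expWedge_smul,
    ← expWedge_add, ← expWedge_add, add_wedgeSpinor, add_wedgeSpinor, smul_wedgeSpinor, smul_add]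
  congr 1
  abel

end SpinorAlgebra

/-! ### The Leibniz rule for spinor fields on a vector space -/

section Leibniz
variable {E : Type*} [NormedAddCommGroup E] [NormedSpace ℝ E]

/-- The alternating sum `∑ (-1)^i A (v_i) (v_0, …, v̂_i, …)` for a map `A` from vectors to spinors.
It is the exterior derivative when `A` is the differential of a spinor field; linearity of `A` is
not needed for the identities below.  -/
def altSum (A : E → Spinor E) : (k : ℕ) → (Fin k → E) → ℂ
  | 0, _ => 0
  | k + 1, v => ∑ i : Fin (k + 1), (-1 : ℂ) ^ (i : ℕ) * A (v i) k (i.removeNth v)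

/-- Cartan's formula for `altSum`: contraction with `u` gives `A u` minus the alternating sum of
the contracted spinors. -/
theorem altSum_vecCons (A : E → Spinor E) (k : ℕ) (u : E) (v : Fin k → E) :
    altSum A (k + 1) (Matrix.vecCons u v) = A u k v - altSum (fun w => contract u (A w)) k v := by
  rw [altSum, Fin.sum_univ_succ]
  cases k with
  | zero =>
    simp [altSum, Fin.removeNth_zero]
  | succ k =>
    have h0 : (0 : Fin (k + 2)).removeNth (Matrix.vecCons u v) = v := by
      rw [Fin.removeNth_zero]; rfl
    rw [h0, altSum, sub_eq_add_neg, ← Finset.sum_neg_distrib]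
    congr 1
    · simp
    · refine Finset.sum_congr rfl fun i _ => ?_
      have h1 : i.succ.removeNth (Matrix.vecCons u v) = Matrix.vecCons u (i.removeNth v) := by
        funext j
        refine Fin.cases ?_ (fun j => ?_) j
        · simp [Fin.removeNth]
        · simp [Fin.removeNth]
      rw [h1]
      simp only [contract, ContinuousAlternatingMap.curryLeft_apply_apply, Fin.val_succ,
        Matrix.cons_val_succ]
      ring

theorem altSum_add (A B : E → Spinor E) (k : ℕ) (v : Fin k → E) :
    altSum (fun w => A w + B w) k v = altSum A k v + altSum B k v := by
  cases k with
  | zero => simp [altSum]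
  | succ k =>
    simp only [altSum, Pi.add_apply, ContinuousAlternatingMap.add_apply, mul_add,
      Finset.sum_add_distrib]

theorem altSum_smul (c : ℂ) (A : E → Spinor E) (k : ℕ) (v : Fin k → E) :
    altSum (fun w => c • A w) k v = c * altSum A k v := by
  cases k with
  | zero => simp [altSum]
  | succ k =>
    simp only [altSum, Pi.smul_apply, ContinuousAlternatingMap.smul_apply, Finset.mul_sum,
      smul_eq_mul]
    exact Finset.sum_congr rfl fun i _ => by ring

/-- Cartan's formula for the alternatization of a form-valued linear map. -/
theorem alternatizeUncurryFin_curryLeft {a : ℕ} (A : E →L[ℝ] E [⋀^Fin (a + 1)]→L[ℝ] ℂ) (u : E) :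
    (ContinuousAlternatingMap.alternatizeUncurryFin A).curryLeft u = A u -
      ContinuousAlternatingMap.alternatizeUncurryFin ((ContinuousLinearMap.apply ℝ
        (E [⋀^Fin a]→L[ℝ] ℂ) u).comp
          ((ContinuousAlternatingMap.curryLeftLI).toContinuousLinearMap.comp A)) := by
  ext v
  have h := altSum_vecCons (fun w => Pi.single (a + 1) (A w)) (a + 1) u v
  simp only [altSum, contract, Pi.single_eq_same] at h
  simp only [ContinuousAlternatingMap.curryLeft_apply_apply, ContinuousAlternatingMap.sub_apply,
    ContinuousAlternatingMap.alternatizeUncurryFin_apply, zsmul_eq_mul, Int.cast_pow, Int.cast_neg,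
    Int.cast_one]
  exact h

/-- The first half of the Leibniz rule, where the first factor is differentiated. -/
theorem altSum_wedgeSpinor_left {a : ℕ} (A : E →L[ℝ] E [⋀^Fin a]→L[ℝ] ℂ) (τ : Spinor E) (k : ℕ)
    (v : Fin k → E) : altSum (fun w => wedgeSpinor (A w) τ) k v =
      wedgeSpinor (ContinuousAlternatingMap.alternatizeUncurryFin A) τ k v := by
  induction k generalizing a τ with
  | zero => rw [wedgeSpinor_apply_of_lt (by omega)]; rfl
  | succ k ih =>
    obtain ⟨u, y, rfl⟩ : ∃ u y, v = Matrix.vecCons u y :=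
      ⟨Matrix.vecHead v, Matrix.vecTail v, (Matrix.cons_head_tail v).symm⟩
    rw [altSum_vecCons]
    have hr : wedgeSpinor (ContinuousAlternatingMap.alternatizeUncurryFin A) τ (k + 1)
        (Matrix.vecCons u y) = contract u
          (wedgeSpinor (ContinuousAlternatingMap.alternatizeUncurryFin A) τ) k y := rfl
    rw [hr, contract_wedgeSpinor]
    rcases a with _ | a
    · simp only [contract_wedgeSpinor_zero_degree]
      rw [ih A]
      have : (ContinuousAlternatingMap.alternatizeUncurryFin A).curryLeft u = A u := by
        refine form_zero_ext ?_
        rw [ContinuousAlternatingMap.curryLeft_apply_apply,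
          ContinuousAlternatingMap.alternatizeUncurryFin_apply]
        simp
      rw [this]
      simp
      ring
    · simp only [contract_wedgeSpinor]
      rw [altSum_add, altSum_smul, ih A, alternatizeUncurryFin_curryLeft, sub_wedgeSpinor]
      have := ih ((ContinuousLinearMap.apply ℝ (E [⋀^Fin a]→L[ℝ] ℂ) u).comp
          ((ContinuousAlternatingMap.curryLeftLI).toContinuousLinearMap.comp A)) τ y
      simp only [Pi.add_apply, Pi.sub_apply, Pi.smul_apply, ContinuousAlternatingMap.add_apply,
        ContinuousAlternatingMap.sub_apply, ContinuousAlternatingMap.smul_apply, smul_eq_mul]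
      rw [← this]
      simp only [ContinuousLinearMap.comp_apply, ContinuousLinearMap.apply_apply]
      change _ - (altSum (fun w => wedgeSpinor ((A w).curryLeft u) τ) k y + _) =
        _ - altSum (fun w => wedgeSpinor ((A w).curryLeft u) τ) k y + _
      ring

/-- The second half of the Leibniz rule, where the second factor is differentiated; `Θ` stands for
its exterior derivative. -/
theorem altSum_wedgeSpinor_right {a : ℕ} (σ : E [⋀^Fin a]→L[ℝ] ℂ) (B : E → Spinor E)
    (Θ : Spinor E) (hΘ : ∀ k v, Θ k v = altSum B k v) (k : ℕ) (v : Fin k → E) :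
    altSum (fun w => wedgeSpinor σ (B w)) k v = (-1) ^ a * wedgeSpinor σ Θ k v := by
  induction k generalizing a B Θ with
  | zero =>
    have h0 : Θ 0 = 0 := by ext v; rw [hΘ]; rfl
    rw [wedgeSpinor_apply_eq_zero (k := 1) σ (fun l hl => by
      obtain rfl : l = 0 := by omega
      exact h0) (by omega)]
    simp [altSum]
  | succ k ih =>
    obtain ⟨u, y, rfl⟩ : ∃ u y, v = Matrix.vecCons u y :=
      ⟨Matrix.vecHead v, Matrix.vecTail v, (Matrix.cons_head_tail v).symm⟩
    rw [altSum_vecCons]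
    have hr : wedgeSpinor σ Θ (k + 1) (Matrix.vecCons u y) = contract u (wedgeSpinor σ Θ) k y := rfl
    have hΘ' : ∀ k v, (B u - contract u Θ) k v = altSum (fun w => contract u (B w)) k v := by
      intro k v
      have : contract u Θ k v = Θ (k + 1) (Matrix.vecCons u v) := rfl
      rw [Pi.sub_apply, ContinuousAlternatingMap.sub_apply, this, hΘ, altSum_vecCons]
      ring
    rcases a with _ | a
    · rw [hr]
      simp only [contract_wedgeSpinor_zero_degree]
      rw [ih σ _ _ hΘ', wedgeSpinor_sub]
      simp
    · rw [hr, contract_wedgeSpinor]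
      simp only [contract_wedgeSpinor]
      rw [altSum_add, altSum_smul, ih σ _ _ hΘ', ih (σ.curryLeft u) B Θ hΘ, wedgeSpinor_sub]
      simp only [Pi.add_apply, Pi.sub_apply, Pi.smul_apply, ContinuousAlternatingMap.add_apply,
        ContinuousAlternatingMap.sub_apply, ContinuousAlternatingMap.smul_apply, smul_eq_mul]
      have : ((-1 : ℂ) ^ a) * (-1) ^ a = 1 := by rw [← mul_pow]; simp
      ring_nf
      rw [show a * 2 = a + a by ring, pow_add, this]
      ring

/-- The exterior derivative of a spinor field on a vector space. -/
def dSpinor (ρ : E → Spinor E) (y : E) : Spinor E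
  | 0 => 0
  | k + 1 => extDeriv (fun z => ρ z k) y

theorem dSpinor_apply_eq_altSum (ρ : E → Spinor E) (y : E) (k : ℕ) (v : Fin k → E) :
    dSpinor ρ y k v = altSum (fun w l => fderiv ℝ (fun z => ρ z l) y w) k v := by
  cases k with
  | zero => rfl
  | succ k =>
    simp only [dSpinor, altSum, extDeriv, ContinuousAlternatingMap.alternatizeUncurryFin_apply,
      zsmul_eq_mul, Int.cast_pow, Int.cast_neg, Int.cast_one]

theorem real_smul_eq_complex_smul {k : ℕ} (r : ℝ) (α : E [⋀^Fin k]→L[ℝ] ℂ) : r • α = (r : ℂ) • α := by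
  ext v
  simp

variable [FiniteDimensional ℝ E]

instance finiteDimensional_form (k : ℕ) {V : Type*} [NormedAddCommGroup V] [NormedSpace ℝ V]
    [FiniteDimensional ℝ V] : FiniteDimensional ℝ (E [⋀^Fin k]→L[ℝ] V) := by
  let f : (E [⋀^Fin k]→L[ℝ] V) →ₗ[ℝ] MultilinearMap ℝ (fun _ : Fin k => E) V :=
    { toFun := fun α => α.toMultilinearMap
      map_add' := fun _ _ => rfl
      map_smul' := fun _ _ => rfl }
  refine Module.Finite.of_injective f fun α β h => ?_
  ext v
  exact congrArg (fun g => g v) h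

/-- The wedge product as a continuous bilinear map. -/
def wedgeCLM {a b k : ℕ} (h : a + b = k) :
    (E [⋀^Fin a]→L[ℝ] ℂ) →L[ℝ] (E [⋀^Fin b]→L[ℝ] ℂ) →L[ℝ] (E [⋀^Fin k]→L[ℝ] ℂ) :=
  (LinearMap.mk₂ ℝ (wedge h)
    (fun α α' β => (wedgeBilin h).map_add₂ α α' β)
    (fun c α β => by
      rw [real_smul_eq_complex_smul, real_smul_eq_complex_smul]
      exact (wedgeBilin h).map_smul₂ _ α β)
    (fun α β β' => (wedgeBilin h α).map_add β β')
    (fun c α β => by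
      rw [real_smul_eq_complex_smul, real_smul_eq_complex_smul]
      exact (wedgeBilin h α).map_smul _ β)).toContinuousBilinearMap

theorem wedgeCLM_apply {a b k : ℕ} (h : a + b = k) (α : E [⋀^Fin a]→L[ℝ] ℂ)
    (β : E [⋀^Fin b]→L[ℝ] ℂ) : wedgeCLM h α β = wedge h α β := rfl

section
variable {M : Type*} [NormedAddCommGroup M] [NormedSpace ℝ M]

theorem ContDiffAt.wedge {a b k : ℕ} (h : a + b = k) {α : M → E [⋀^Fin a]→L[ℝ] ℂ}
    {β : M → E [⋀^Fin b]→L[ℝ] ℂ} {y : M} {n : WithTop ℕ∞} (hα : ContDiffAt ℝ n α y)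
    (hβ : ContDiffAt ℝ n β y) : ContDiffAt ℝ n (fun z => wedge h (α z) (β z)) y := by
  have h1 : ContDiffAt ℝ n (fun z => wedgeCLM (E := E) h (α z)) y :=
    (wedgeCLM (E := E) h).contDiff.contDiffAt.comp y hα
  have h2 := h1.clm_apply hβ
  simpa only [wedgeCLM_apply] using h2

theorem ContDiffAt.wedgeSpinor {a : ℕ} {α : M → E [⋀^Fin a]→L[ℝ] ℂ} {ρ : M → Spinor E} {y : M}
    {n : WithTop ℕ∞} (hα : ContDiffAt ℝ n α y) (hρ : ∀ k, ContDiffAt ℝ n (fun z => ρ z k) y)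
    (k : ℕ) : ContDiffAt ℝ n (fun z => wedgeSpinor (α z) (ρ z) k) y := by
  unfold GenCplx.wedgeSpinor
  split_ifs with h
  · exact ContDiffAt.wedge _ hα (hρ _)
  · exact contDiffAt_const

theorem ContDiffAt.iterate_wedgeSpinor {σ : M → E [⋀^Fin 2]→L[ℝ] ℂ} {ρ : M → Spinor E} {y : M}
    {n : WithTop ℕ∞} (hσ : ContDiffAt ℝ n σ y) (hρ : ∀ k, ContDiffAt ℝ n (fun z => ρ z k) y)
    (j k : ℕ) : ContDiffAt ℝ n (fun z => ((GenCplx.wedgeSpinor (σ z))^[j] (ρ z)) k) y := by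
  induction j generalizing k with
  | zero => exact hρ k
  | succ j ih =>
    simp only [Function.iterate_succ_apply']
    exact ContDiffAt.wedgeSpinor hσ ih k

theorem ContDiffAt.expWedge {σ : M → E [⋀^Fin 2]→L[ℝ] ℂ} {ρ : M → Spinor E} {y : M}
    {n : WithTop ℕ∞} (hσ : ContDiffAt ℝ n σ y) (hρ : ∀ k, ContDiffAt ℝ n (fun z => ρ z k) y)
    (k : ℕ) : ContDiffAt ℝ n (fun z => expWedge (σ z) (ρ z) k) y := by
  unfold GenCplx.expWedge
  exact ContDiffAt.sum fun j _ => (ContDiffAt.iterate_wedgeSpinor hσ hρ j k).const_smul _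

theorem fderiv_wedge {a b k : ℕ} (h : a + b = k) {α : M → E [⋀^Fin a]→L[ℝ] ℂ}
    {β : M → E [⋀^Fin b]→L[ℝ] ℂ} {y : M} (hα : DifferentiableAt ℝ α y)
    (hβ : DifferentiableAt ℝ β y) (w : M) :
    fderiv ℝ (fun z => wedge h (α z) (β z)) y w =
      wedge h (fderiv ℝ α y w) (β y) + wedge h (α y) (fderiv ℝ β y w) := by
  have := ((wedgeCLM h).hasFDerivAt_of_bilinear hα.hasFDerivAt hβ.hasFDerivAt).fderiv
  have h2 := congrArg (fun L => L w) this
  refine h2.trans ?_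
  simp only [add_apply, ContinuousLinearMap.precompL_apply, wedgeCLM_apply]
  rw [add_comm]
  rfl

theorem fderiv_wedgeSpinor {a : ℕ} {α : M → E [⋀^Fin a]→L[ℝ] ℂ} {ρ : M → Spinor E} {y : M}
    (hα : DifferentiableAt ℝ α y) (hρ : ∀ k, DifferentiableAt ℝ (fun z => ρ z k) y) (k : ℕ)
    (w : M) : fderiv ℝ (fun z => wedgeSpinor (α z) (ρ z) k) y w =
      wedgeSpinor (fderiv ℝ α y w) (ρ y) k +
        wedgeSpinor (α y) (fun l => fderiv ℝ (fun z => ρ z l) y w) k := by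
  unfold GenCplx.wedgeSpinor
  split_ifs with h
  · exact fderiv_wedge _ hα (hρ _) w
  · simp

end

/-- `d (α ∧ ρ) = dα ∧ ρ ± α ∧ dρ`. -/
theorem dSpinor_wedgeSpinor {a : ℕ} {α : E → E [⋀^Fin a]→L[ℝ] ℂ} {ρ : E → Spinor E} {y : E}
    (hα : DifferentiableAt ℝ α y) (hρ : ∀ k, DifferentiableAt ℝ (fun z => ρ z k) y) :
    dSpinor (fun z => wedgeSpinor (α z) (ρ z)) y =
      wedgeSpinor (extDeriv α y) (ρ y) + (-1 : ℂ) ^ a • wedgeSpinor (α y) (dSpinor ρ y) := by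
  funext k
  ext v
  rw [dSpinor_apply_eq_altSum]
  simp only [fderiv_wedgeSpinor hα hρ]
  refine (altSum_add (fun w => wedgeSpinor (fderiv ℝ α y w) (ρ y)) (fun w => wedgeSpinor (α y)
    (fun l => fderiv ℝ (fun z => ρ z l) y w)) k v).trans ?_
  rw [altSum_wedgeSpinor_left, altSum_wedgeSpinor_right (α y) _ (dSpinor ρ y)
    (dSpinor_apply_eq_altSum ρ y)]
  rfl

/-- `d (σ^j ∧ ρ) = σ^j ∧ dρ + j σ^(j - 1) ∧ dσ ∧ ρ`. -/
theorem dSpinor_iterate_wedgeSpinor {σ : E → E [⋀^Fin 2]→L[ℝ] ℂ} {ρ : E → Spinor E} {y : E}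
    (hσ : ContDiffAt ℝ ∞ σ y) (hρ : ∀ k, ContDiffAt ℝ ∞ (fun z => ρ z k) y) (j : ℕ) :
    dSpinor (fun z => (wedgeSpinor (σ z))^[j] (ρ z)) y = (wedgeSpinor (σ y))^[j] (dSpinor ρ y) +
      (j : ℂ) • (wedgeSpinor (σ y))^[j - 1] (wedgeSpinor (extDeriv σ y) (ρ y)) := by
  induction j with
  | zero => simp
  | succ j ih =>
    simp only [Function.iterate_succ_apply']
    rw [dSpinor_wedgeSpinor (hσ.differentiableAt (by simp)) fun k =>
      (ContDiffAt.iterate_wedgeSpinor hσ hρ j k).differentiableAt (by simp), ih, wedgeSpinor_add,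
      wedgeSpinor_smul, Nat.add_sub_cancel, ← iterate_wedgeSpinor_comm]
    rcases j with _ | j
    · simp [add_comm]
    · rw [Nat.add_sub_cancel, ← Function.iterate_succ_apply' (wedgeSpinor (σ y)) j]
      push_cast
      simp only [even_two.neg_one_pow, one_smul, add_smul]
      abel

/-- `d (e^σ ∧ ρ) = e^σ ∧ (dρ + dσ ∧ ρ)`. -/
theorem dSpinor_expWedge {σ : E → E [⋀^Fin 2]→L[ℝ] ℂ} {ρ : E → Spinor E} {y : E}
    (hσ : ContDiffAt ℝ ∞ σ y) (hρ : ∀ k, ContDiffAt ℝ ∞ (fun z => ρ z k) y) :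
    dSpinor (fun z => expWedge (σ z) (ρ z)) y =
      expWedge (σ y) (dSpinor ρ y + wedgeSpinor (extDeriv σ y) (ρ y)) := by
  funext k
  rw [← sum_exp_derivation (σ y) _ _ (N := k + 1) (by omega)]
  have h := fun j => congrFun (dSpinor_iterate_wedgeSpinor hσ hρ j) k
  simp only [Pi.add_apply, Pi.smul_apply] at h
  simp only [← h]
  cases k with
  | zero => simp [dSpinor]
  | succ k =>
    have h1 : (fun z => expWedge (σ z) (ρ z) k) = fun z => ∑ j ∈ Finset.range (k + 3),
        ((j.factorial : ℂ))⁻¹ • ((wedgeSpinor (σ z))^[j] (ρ z)) k := by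
      funext z
      exact expWedge_apply_eq_sum _ _ (by omega)
    have hd : ∀ j, DifferentiableAt ℝ (fun z => ((wedgeSpinor (σ z))^[j] (ρ z)) k) y := fun j =>
      (ContDiffAt.iterate_wedgeSpinor hσ hρ j k).differentiableAt (by simp)
    simp only [dSpinor, h1, extDeriv]
    rw [fderiv_fun_sum fun j _ => (hd j).fun_const_smul _]
    ext v
    simp only [ContinuousAlternatingMap.sum_apply,
      ContinuousAlternatingMap.alternatizeUncurryFin_apply, FunLike.coe_sum, Finset.sum_apply,
      Finset.smul_sum, ContinuousAlternatingMap.smul_apply]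
    rw [Finset.sum_comm]
    refine Finset.sum_congr rfl fun j _ => Finset.sum_congr rfl fun i _ => ?_
    rw [fderiv_fun_const_smul (hd j)]
    exact smul_comm _ _ _

end Leibniz

/-! ### Pullback of spinors by linear maps -/

section Pullback
variable {E : Type*} [NormedAddCommGroup E] [NormedSpace ℝ E]
  {E' : Type*} [NormedAddCommGroup E'] [NormedSpace ℝ E']

/-- The pullback of a spinor by a linear map. -/
def pullSpinor (f : E' →L[ℝ] E) (ρ : Spinor E) : Spinor E' := fun k =>
  (ρ k).compContinuousLinearMap f

theorem wedge_compContinuousLinearMap {a b k : ℕ} (h : a + b = k) (α : E [⋀^Fin a]→L[ℝ] ℂ)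
    (β : E [⋀^Fin b]→L[ℝ] ℂ) (f : E' →L[ℝ] E) : (wedge h α β).compContinuousLinearMap f =
      wedge h (α.compContinuousLinearMap f) (β.compContinuousLinearMap f) := by
  ext v
  rw [wedge_apply, ContinuousAlternatingMap.compContinuousLinearMap_apply, wedge_apply]
  rfl

theorem pullSpinor_wedgeSpinor (f : E' →L[ℝ] E) {a : ℕ} (α : E [⋀^Fin a]→L[ℝ] ℂ) (ρ : Spinor E) :
    pullSpinor f (wedgeSpinor α ρ) =
      wedgeSpinor (α.compContinuousLinearMap f) (pullSpinor f ρ) := by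
  funext k
  simp only [pullSpinor, wedgeSpinor]
  split_ifs with h
  · exact wedge_compContinuousLinearMap _ _ _ _
  · rfl

theorem pullSpinor_add (f : E' →L[ℝ] E) (ρ ρ' : Spinor E) :
    pullSpinor f (ρ + ρ') = pullSpinor f ρ + pullSpinor f ρ' := rfl

theorem pullSpinor_smul (f : E' →L[ℝ] E) (c : ℂ) (ρ : Spinor E) :
    pullSpinor f (c • ρ) = c • pullSpinor f ρ := rfl

theorem pullSpinor_iterate (f : E' →L[ℝ] E) (σ : E [⋀^Fin 2]→L[ℝ] ℂ) (ρ : Spinor E) (j : ℕ) :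
    pullSpinor f ((wedgeSpinor σ)^[j] ρ) =
      (wedgeSpinor (σ.compContinuousLinearMap f))^[j] (pullSpinor f ρ) := by
  induction j with
  | zero => rw [Function.iterate_zero, Function.iterate_zero, id, id]
  | succ j ih => rw [Function.iterate_succ_apply', Function.iterate_succ_apply',
      pullSpinor_wedgeSpinor, ih]

theorem pullSpinor_expWedge (f : E' →L[ℝ] E) (σ : E [⋀^Fin 2]→L[ℝ] ℂ) (ρ : Spinor E) :
    pullSpinor f (expWedge σ ρ) = expWedge (σ.compContinuousLinearMap f) (pullSpinor f ρ) := by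
  funext k
  simp only [expWedge, ← pullSpinor_iterate]
  ext v
  simp only [pullSpinor, ContinuousAlternatingMap.compContinuousLinearMap_apply,
    ContinuousAlternatingMap.sum_apply, ContinuousAlternatingMap.smul_apply, expWedge]

instance finiteDimensional_continuousMultilinearMap [FiniteDimensional ℝ E] (k : ℕ) {V : Type*}
    [NormedAddCommGroup V] [NormedSpace ℝ V] [FiniteDimensional ℝ V] :
    FiniteDimensional ℝ (ContinuousMultilinearMap ℝ (fun _ : Fin k => E) V) := by
  refine Module.Finite.of_injective
    (ContinuousMultilinearMap.toMultilinearMapLinear :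
      ContinuousMultilinearMap ℝ (fun _ : Fin k => E) V →ₗ[ℝ] _) fun α β h => ?_
  ext v
  exact congrArg (fun g => g v) h

/-- The pullback of a smoothly varying form by a smoothly varying linear map varies smoothly. -/
theorem ContDiffAt.compContinuousLinearMap {M : Type*} [NormedAddCommGroup M] [NormedSpace ℝ M]
    [FiniteDimensional ℝ E'] [FiniteDimensional ℝ E]
    {V : Type*} [NormedAddCommGroup V] [NormedSpace ℝ V] [FiniteDimensional ℝ V] {k : ℕ}
    {α : M → E [⋀^Fin k]→L[ℝ] V} {L : M → E' →L[ℝ] E} {y : M} {n : WithTop ℕ∞}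
    (hα : ContDiffAt ℝ n α y) (hL : ContDiffAt ℝ n L y) :
    ContDiffAt ℝ n (fun z => (α z).compContinuousLinearMap (L z)) y := by
  -- composition is known to be smooth for multilinear maps; a left inverse of the linear inclusion
  -- of alternating maps into multilinear maps carries this over
  let f := ContinuousAlternatingMap.toContinuousMultilinearMapLinear (R := ℝ) (A := ℝ)
    (M := E') (N := V) (ι := Fin k)
  obtain ⟨g, hg⟩ := f.exists_leftInverse_of_injective
    (LinearMap.ker_eq_bot.2 ContinuousAlternatingMap.toContinuousMultilinearMap_injective)
  have h1 : ContDiffAt ℝ n (fun z => ContinuousMultilinearMap.compContinuousLinearMapContinuousMultilinear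
      ℝ (fun _ : Fin k => E') (fun _ => E) V (fun _ => L z)) y :=
    (ContinuousMultilinearMap.contDiff _).contDiffAt.comp y (contDiffAt_pi.2 fun _ => hL)
  have h2 : ContDiffAt ℝ n (fun z => (α z).toContinuousMultilinearMap) y :=
    (ContinuousAlternatingMap.toContinuousMultilinearMapCLM ℝ :
      (E [⋀^Fin k]→L[ℝ] V) →L[ℝ] _).contDiff.contDiffAt.comp y hα
  have h3 := (LinearMap.toContinuousLinearMap g).contDiff.contDiffAt.comp y (h1.clm_apply h2)
  refine h3.congr_of_eventuallyEq (Filter.Eventually.of_forall fun z => ?_)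
  exact (congrArg (fun T => T ((α z).compContinuousLinearMap (L z))) hg).symm

end Pullback

/-! ### Smooth forms in charts -/

section SmoothForms
variable {E : Type*} [NormedAddCommGroup E] [NormedSpace ℝ E]
  {X : Type*} [TopologicalSpace X] [ChartedSpace E X]
  {V : Type*} [NormedAddCommGroup V] [NormedSpace ℝ V]
  {W : Type*} [NormedAddCommGroup W] [NormedSpace ℝ W]

/-- The form `α` is smooth at `x`: its expressions in all charts around `x` are. -/
def SmoothFormAt {k : ℕ} (α : X → E [⋀^Fin k]→L[ℝ] V) (x : X) : Prop :=
  ∀ x₀ : X, x ∈ (chartAt E x₀).source → ContDiffAt ℝ ∞ (inChart α x₀) (chartAt E x₀ x)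

theorem smoothFormOn_iff {k : ℕ} {α : X → E [⋀^Fin k]→L[ℝ] V} {U : Set X} (hU : IsOpen U) :
    SmoothFormOn α U ↔ ∀ x ∈ U, SmoothFormAt α x := by
  constructor
  · intro h x hx x₀ hx₀
    refine inChart_contDiffAt hU h x₀ ((chartAt E x₀).map_source hx₀) ?_
    rwa [(chartAt E x₀).left_inv hx₀]
  · intro h x₀ y hy
    have := h _ hy.2 x₀ ((chartAt E x₀).map_target hy.1)
    rw [(chartAt E x₀).right_inv hy.1] at this
    exact this.contDiffWithinAt

theorem SmoothFormOn.smoothFormAt {k : ℕ} {α : X → E [⋀^Fin k]→L[ℝ] V} {U : Set X} (hU : IsOpen U)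
    (h : SmoothFormOn α U) {x : X} (hx : x ∈ U) : SmoothFormAt α x :=
  (smoothFormOn_iff hU).1 h x hx

theorem eventuallyEq_inChart {k : ℕ} {α β : X → E [⋀^Fin k]→L[ℝ] V} {x : X} (h : α =ᶠ[𝓝 x] β)
    {x₀ : X} (hx : x ∈ (chartAt E x₀).source) :
    inChart α x₀ =ᶠ[𝓝 (chartAt E x₀ x)] inChart β x₀ := by
  have hc : Filter.Tendsto (chartAt E x₀).symm (𝓝 (chartAt E x₀ x)) (𝓝 x) := by
    have := (chartAt E x₀).continuousAt_symm ((chartAt E x₀).map_source hx)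
    rwa [ContinuousAt, (chartAt E x₀).left_inv hx] at this
  filter_upwards [hc.eventually h] with y hy
  rw [inChart, inChart, hy]

theorem SmoothFormAt.congr {k : ℕ} {α β : X → E [⋀^Fin k]→L[ℝ] V} {x : X} (hα : SmoothFormAt α x)
    (h : β =ᶠ[𝓝 x] α) : SmoothFormAt β x := fun x₀ hx =>
  (hα x₀ hx).congr_of_eventuallyEq (eventuallyEq_inChart h hx)

theorem smoothFormAt_zero {k : ℕ} (x : X) :
    SmoothFormAt (fun _ : X => (0 : E [⋀^Fin k]→L[ℝ] V)) x := fun _ _ =>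
  contDiffAt_const (c := (0 : E [⋀^Fin k]→L[ℝ] V))

theorem SmoothFormAt.add {k : ℕ} {α β : X → E [⋀^Fin k]→L[ℝ] V} {x : X} (hα : SmoothFormAt α x)
    (hβ : SmoothFormAt β x) : SmoothFormAt (fun z => α z + β z) x := fun x₀ hx =>
  (hα x₀ hx).add (hβ x₀ hx)

theorem SmoothFormAt.sub {k : ℕ} {α β : X → E [⋀^Fin k]→L[ℝ] V} {x : X} (hα : SmoothFormAt α x)
    (hβ : SmoothFormAt β x) : SmoothFormAt (fun z => α z - β z) x := fun x₀ hx =>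
  (hα x₀ hx).sub (hβ x₀ hx)

theorem SmoothFormAt.sum {ι : Type*} {k : ℕ} {α : ι → X → E [⋀^Fin k]→L[ℝ] V} {x : X}
    {s : Finset ι} (hα : ∀ i ∈ s, SmoothFormAt (α i) x) :
    SmoothFormAt (fun z => ∑ i ∈ s, α i z) x := by
  classical
  induction s using Finset.induction_on with
  | empty => simpa using smoothFormAt_zero x
  | insert i s hi ih =>
    simp only [Finset.sum_insert hi]
    exact (hα i (Finset.mem_insert_self i s)).add
      (ih fun j hj => hα j (Finset.mem_insert_of_mem hj))

theorem SmoothFormAt.clm_comp {k : ℕ} {α : X → E [⋀^Fin k]→L[ℝ] V} {x : X} (hα : SmoothFormAt α x)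
    (L : V →L[ℝ] W) : SmoothFormAt (fun z => L.compContinuousAlternatingMap (α z)) x :=
  fun x₀ hx => (ContinuousLinearMap.compContinuousAlternatingMapCLM ℝ E V W (Fin k) L).contDiff.contDiffAt.comp _
    (hα x₀ hx)

theorem smoothFormAt_const_smul {k : ℕ} {α : X → E [⋀^Fin k]→L[ℝ] ℂ} {x : X}
    (hα : SmoothFormAt α x) (c : ℂ) : SmoothFormAt (fun z => c • α z) x := fun x₀ hx =>
  (hα x₀ hx).const_smul c

/-- A locally finite sum is finite near each point, with a fixed set of indices. -/
theorem exists_finset_finsum_eq {ι : Type*} {A : Type*} [AddCommGroup A] [Module ℝ A]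
    {φ : ι → X → ℝ} (hlf : LocallyFinite fun i => Function.support (φ i)) (α : ι → X → A) (x : X) :
    ∃ s : Finset ι, ∀ᶠ z in 𝓝 x, ∑ᶠ i, φ i z • α i z = ∑ i ∈ s, φ i z • α i z := by
  -- the indices of the functions whose support meets a small neighbourhood
  obtain ⟨N, hN, hfin⟩ := hlf x
  refine ⟨hfin.toFinset, ?_⟩
  filter_upwards [hN] with z hz
  refine finsum_eq_sum_of_support_subset _ fun i hi => ?_
  simp only [Set.Finite.coe_toFinset, Set.mem_ofPred_eq]
  refine ⟨z, ?_, hz⟩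
  rw [Function.mem_support] at hi ⊢
  exact left_ne_zero_of_smul hi

theorem extD_congr {k : ℕ} {α β : X → E [⋀^Fin k]→L[ℝ] V} {x : X} (h : α =ᶠ[𝓝 x] β) :
    extD α x = extD β x := by
  rw [extD, extD, (eventuallyEq_inChart h (mem_chart_source E x)).extDeriv_eq]

theorem SmoothFormAt.differentiableAt {k : ℕ} {α : X → E [⋀^Fin k]→L[ℝ] V} {x : X}
    (h : SmoothFormAt α x) : DifferentiableAt ℝ (inChart α x) (chartAt E x x) :=
  (h x (mem_chart_source E x)).differentiableAt (by simp)

theorem extD_add {k : ℕ} {α β : X → E [⋀^Fin k]→L[ℝ] V} {x : X} (hα : SmoothFormAt α x)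
    (hβ : SmoothFormAt β x) : extD (fun z => α z + β z) x = extD α x + extD β x := by
  have h : inChart (fun z => α z + β z) x = inChart α x + inChart β x := rfl
  rw [extD, h, extDeriv_add hα.differentiableAt hβ.differentiableAt]
  rfl

theorem extD_clm_comp {k : ℕ} {α : X → E [⋀^Fin k]→L[ℝ] V} {x : X} (hα : SmoothFormAt α x)
    (L : V →L[ℝ] W) : extD (fun z => L.compContinuousAlternatingMap (α z)) x =
      L.compContinuousAlternatingMap (extD α x) := by
  have h : inChart (fun z => L.compContinuousAlternatingMap (α z)) x =
    ContinuousLinearMap.compContinuousAlternatingMapCLM ℝ E V W (Fin k) L ∘ inChart α x := rfl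
  have hd : extDeriv (inChart (fun z => L.compContinuousAlternatingMap (α z)) x) (chartAt E x x) =
      L.compContinuousAlternatingMap (extDeriv (inChart α x) (chartAt E x x)) := by
    rw [h, extDeriv, extDeriv, fderiv_comp _ (ContinuousLinearMap.differentiableAt _)
      hα.differentiableAt, ContinuousLinearMap.fderiv]
    ext v
    simp [ContinuousAlternatingMap.alternatizeUncurryFin_apply]
  rw [extD, hd]
  rfl

theorem extD_zero {k : ℕ} (x : X) : extD (fun _ : X => (0 : E [⋀^Fin k]→L[ℝ] V)) x = 0 := by
  -- zero is the composition with the zero map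
  have h := extD_clm_comp (smoothFormAt_zero (E := E) (V := V) (k := k) x) (0 : V →L[ℝ] V)
  have h2 : (fun _ : X => (0 : V →L[ℝ] V).compContinuousAlternatingMap
      (0 : E [⋀^Fin k]→L[ℝ] V)) = fun _ => 0 := by
    funext z; ext v; rfl
  rw [h2] at h
  rw [h]
  ext v
  rfl

theorem extD_sub {k : ℕ} {α β : X → E [⋀^Fin k]→L[ℝ] V} {x : X} (hα : SmoothFormAt α x)
    (hβ : SmoothFormAt β x) : extD (fun z => α z - β z) x = extD α x - extD β x := by
  have h := extD_add hα (hβ.clm_comp (-ContinuousLinearMap.id ℝ V))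
  rw [extD_clm_comp hβ] at h
  simp only [sub_eq_add_neg]
  exact h

theorem extD_const_smul {k : ℕ} {α : X → E [⋀^Fin k]→L[ℝ] ℂ} {x : X} (hα : SmoothFormAt α x)
    (c : ℂ) : extD (fun z => c • α z) x = c • extD α x :=
  extD_clm_comp hα (c • ContinuousLinearMap.id ℝ ℂ)

theorem extD_sum {ι : Type*} {k : ℕ} {α : ι → X → E [⋀^Fin k]→L[ℝ] V} {x : X}
    {s : Finset ι} (hα : ∀ i ∈ s, SmoothFormAt (α i) x) :
    extD (fun z => ∑ i ∈ s, α i z) x = ∑ i ∈ s, extD (α i) x := by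
  classical
  induction s using Finset.induction_on with
  | empty => simpa using extD_zero x
  | insert i s hi ih =>
    simp only [Finset.sum_insert hi]
    rw [extD_add (hα i (Finset.mem_insert_self i s)) (SmoothFormAt.sum
      fun j hj => hα j (Finset.mem_insert_of_mem hj)),
      ih fun j hj => hα j (Finset.mem_insert_of_mem hj)]

theorem inChart_constOfIsEmpty (f : X → V) (x₀ : X) :
    inChart (fun z => ContinuousAlternatingMap.constOfIsEmpty ℝ E (Fin 0) (f z)) x₀ =
    fun y => ContinuousAlternatingMap.constOfIsEmpty ℝ E (Fin 0) (f ((chartAt E x₀).symm y)) := rfl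

variable [IsManifold 𝓘(ℝ, E) ∞ X]

theorem contDiffAt_comp_chart_symm {f : X → V} {x : X} (hf : ContMDiffAt 𝓘(ℝ, E) 𝓘(ℝ, V) ∞ f x)
    {x₀ : X} (hx : x ∈ (chartAt E x₀).source) :
    ContDiffAt ℝ ∞ (fun y => f ((chartAt E x₀).symm y)) (chartAt E x₀ x) := by
  have hy := (chartAt E x₀).map_source hx
  have h1 : ContMDiffAt 𝓘(ℝ, E) 𝓘(ℝ, E) ∞ (chartAt E x₀).symm (chartAt E x₀ x) :=
    (contMDiffOn_chart_symm (I := 𝓘(ℝ, E)) (n := ∞) (x := x₀) _ hy).contMDiffAt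
      ((chartAt E x₀).open_target.mem_nhds hy)
  have h2 : ContMDiffAt 𝓘(ℝ, E) 𝓘(ℝ, V) ∞ f ((chartAt E x₀).symm (chartAt E x₀ x)) := by
    rwa [(chartAt E x₀).left_inv hx]
  exact (h2.comp _ h1).contDiffAt

theorem contMDiffAt_of_comp_chart_symm {f : X → V} {x : X}
    (hf : ContDiffAt ℝ ∞ (fun y => f ((chartAt E x).symm y)) (chartAt E x x)) :
    ContMDiffAt 𝓘(ℝ, E) 𝓘(ℝ, V) ∞ f x := by
  have hx := mem_chart_source E x
  have h1 : ContMDiffAt 𝓘(ℝ, E) 𝓘(ℝ, E) ∞ (chartAt E x) x :=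
    (contMDiffOn_chart (I := 𝓘(ℝ, E)) (n := ∞) (x := x) x hx).contMDiffAt
      ((chartAt E x).open_source.mem_nhds hx)
  have h2 := (contMDiffAt_iff_contDiffAt.2 hf).comp x h1
  refine h2.congr_of_eventuallyEq ?_
  filter_upwards [(chartAt E x).open_source.mem_nhds hx] with z hz
  simp only [Function.comp_apply]
  rw [(chartAt E x).left_inv hz]

theorem SmoothFormAt.smul {k : ℕ} {α : X → E [⋀^Fin k]→L[ℝ] V} {f : X → ℝ} {x : X}
    (hf : ContMDiffAt 𝓘(ℝ, E) 𝓘(ℝ, ℝ) ∞ f x) (hα : SmoothFormAt α x) :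
    SmoothFormAt (fun z => f z • α z) x := fun x₀ hx =>
  (contDiffAt_comp_chart_symm hf hx).smul (hα x₀ hx)

theorem SmoothFormAt.complex_smul {k : ℕ} {α : X → E [⋀^Fin k]→L[ℝ] ℂ} {f : X → ℂ} {x : X}
    (hf : ContMDiffAt 𝓘(ℝ, E) 𝓘(ℝ, ℂ) ∞ f x) (hα : SmoothFormAt α x) :
    SmoothFormAt (fun z => f z • α z) x := fun x₀ hx =>
  (contDiffAt_comp_chart_symm hf hx).smul (hα x₀ hx)

/-- Forms that are smooth on the supports of a locally finite family of functions are glued to a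
smooth form. -/
theorem smoothFormAt_finsum {ι : Type*} {k : ℕ} {φ : ι → X → ℝ} {α : ι → X → E [⋀^Fin k]→L[ℝ] V}
    (hlf : LocallyFinite fun i => Function.support (φ i)) {x : X}
    (hφ : ∀ i, ContMDiffAt 𝓘(ℝ, E) 𝓘(ℝ, ℝ) ∞ (φ i) x)
    (hα : ∀ i, x ∈ tsupport (φ i) → SmoothFormAt (α i) x) :
    SmoothFormAt (fun z => ∑ᶠ i, φ i z • α i z) x := by
  obtain ⟨s, hs⟩ := exists_finset_finsum_eq hlf α x
  refine SmoothFormAt.congr (SmoothFormAt.sum (s := s) (α := fun i z => φ i z • α i z)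
    fun i _ => ?_) hs
  by_cases hx : x ∈ tsupport (φ i)
  · exact (hα i hx).smul (hφ i)
  · refine (smoothFormAt_zero x).congr ?_
    filter_upwards [(isClosed_tsupport (φ i)).isOpen_compl.mem_nhds hx] with z hz
    rw [image_eq_zero_of_notMem_tsupport hz, zero_smul]

/-! ### Charts and derivatives -/

theorem deriv_chart_symm_comp_deriv_chart {x₀ x : X} (hx : x ∈ (chartAt E x₀).source) :
    (deriv' (chartAt E x₀).symm (chartAt E x₀ x) : E →L[ℝ] E).comp (deriv' (chartAt E x₀) x) =
      ContinuousLinearMap.id ℝ E := by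
  have h1 := mdiff_chart x₀ hx
  have h2 := mdiff_symm x₀ ((chartAt E x₀).map_source hx)
  have h3 := mfderiv_comp x h2 h1
  have h4 : (chartAt E x₀).symm ∘ (chartAt E x₀) =ᶠ[𝓝 x] id := by
    filter_upwards [(chartAt E x₀).open_source.mem_nhds hx] with z hz
    exact (chartAt E x₀).left_inv hz
  rw [h4.mfderiv_eq, mfderiv_id] at h3
  exact h3.symm

/-- A form is recovered from its expression in a chart. -/
theorem inChart_compContinuousLinearMap {k : ℕ} (α : X → E [⋀^Fin k]→L[ℝ] V) {x₀ x : X}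
    (hx : x ∈ (chartAt E x₀).source) :
    (inChart α x₀ (chartAt E x₀ x)).compContinuousLinearMap (deriv' (chartAt E x₀) x) = α x := by
  have h := deriv_chart_symm_comp_deriv_chart (E := E) hx
  rw [inChart, (chartAt E x₀).left_inv hx]
  ext v
  have hv : ∀ i, (deriv' (chartAt E x₀).symm (chartAt E x₀ x) : E →L[ℝ] E)
      ((deriv' (chartAt E x₀) x : E →L[ℝ] E) (v i)) = v i := fun i =>
    congrArg (fun L => L (v i)) h
  change α x (fun i => _) = _
  exact congrArg (α x) (funext hv)

/-! ### The exterior derivative -/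

theorem fderiv_comp_chart_symm {f : X → V} {x : X} (hf : MDifferentiableAt 𝓘(ℝ, E) 𝓘(ℝ, V) f x)
    {x₀ : X} (hx : x ∈ (chartAt E x₀).source) :
    (fderiv ℝ (fun y => f ((chartAt E x₀).symm y)) (chartAt E x₀ x)).comp
      (deriv' (chartAt E x₀) x : E →L[ℝ] E) = deriv' f x := by
  have hf' : MDifferentiableAt 𝓘(ℝ, E) 𝓘(ℝ, V) f ((chartAt E x₀).symm (chartAt E x₀ x)) := by
    rwa [(chartAt E x₀).left_inv hx]
  have h1 := mfderiv_comp (chartAt E x₀ x) hf' (mdiff_symm x₀ ((chartAt E x₀).map_source hx))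
  rw [mfderiv_eq_fderiv, (chartAt E x₀).left_inv hx] at h1
  have h2 : fderiv ℝ (fun y => f ((chartAt E x₀).symm y)) (chartAt E x₀ x) =
    (deriv' f x : E →L[ℝ] V).comp (deriv' (chartAt E x₀).symm (chartAt E x₀ x) : E →L[ℝ] E) := h1
  rw [h2, ContinuousLinearMap.comp_assoc, deriv_chart_symm_comp_deriv_chart hx,
    ContinuousLinearMap.comp_id]

/-- `d (f α) = f dα + df ∧ α`, evaluated on vectors. -/
theorem extD_smul_apply {k : ℕ} {f : X → ℝ} {α : X → E [⋀^Fin k]→L[ℝ] V} {x : X}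
    (hf : ContMDiffAt 𝓘(ℝ, E) 𝓘(ℝ, ℝ) ∞ f x) (hα : SmoothFormAt α x) (v : Fin (k + 1) → E) :
    extD (fun z => f z • α z) x v = f x • extD α x v +
      ∑ i : Fin (k + 1), (-1 : ℝ) ^ (i : ℕ) • (deriv' f x : E →L[ℝ] ℝ) (v i) • α x (i.removeNth v) := by
  have hx := mem_chart_source E x
  have hf' := (contDiffAt_comp_chart_symm hf hx).differentiableAt (by simp)
  have h : inChart (fun z => f z • α z) x =
    (fun y => f ((chartAt E x).symm y)) • inChart α x := rfl
  have hfx : f ((chartAt E x).symm (chartAt E x x)) = f x := by rw [(chartAt E x).left_inv hx]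
  have hα' : ∀ w : Fin k → E, inChart α x (chartAt E x x)
      (fun i => (deriv' (chartAt E x) x : E →L[ℝ] E) (w i)) = α x w := fun w =>
    congrArg (fun L => L w) (inChart_compContinuousLinearMap α hx)
  have hdf : ∀ w : E, fderiv ℝ (fun y => f ((chartAt E x).symm y)) (chartAt E x x)
      ((deriv' (chartAt E x) x : E →L[ℝ] E) w) = (deriv' f x : E →L[ℝ] ℝ) w := fun w =>
    congrArg (fun L => L w) (fderiv_comp_chart_symm (hf.mdifferentiableAt (by simp)) hx)
  rw [extD, extD, h]
  simp only [extDeriv, ContinuousAlternatingMap.compContinuousLinearMap_apply,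
    ContinuousAlternatingMap.alternatizeUncurryFin_apply]
  rw [fderiv_smul hf' hα.differentiableAt, Finset.smul_sum, ← Finset.sum_add_distrib]
  refine Finset.sum_congr rfl fun i _ => ?_
  simp only [add_apply, smul_apply, ContinuousLinearMap.smulRight_apply,
    ContinuousAlternatingMap.add_apply, ContinuousAlternatingMap.smul_apply, hfx, hdf,
    Function.comp_apply]
  have hr := hα' (i.removeNth v)
  have hr' : (i.removeNth fun j => (deriv' (chartAt E x) x : E →L[ℝ] E) (v j)) =
    fun j => (deriv' (chartAt E x) x : E →L[ℝ] E) (i.removeNth v j) := rfl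
  simp only [Function.comp_def] at *
  rw [hr', hr, smul_add, smul_comm]
  simp only [← Int.cast_smul_eq_zsmul ℝ, Int.cast_pow, Int.cast_neg, Int.cast_one]

/-- The one-form `df` as the exterior derivative of a zero-form. -/
theorem extD_constOfIsEmpty {f : X → V} {x : X} (hf : MDifferentiableAt 𝓘(ℝ, E) 𝓘(ℝ, V) f x) :
    extD (fun z => ContinuousAlternatingMap.constOfIsEmpty ℝ E (Fin 0) (f z)) x =
      ContinuousAlternatingMap.ofSubsingleton ℝ E V (0 : Fin 1) (deriv' f x) := by
  have h : inChart (fun z => ContinuousAlternatingMap.constOfIsEmpty ℝ E (Fin 0) (f z)) x =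
    fun y => ContinuousAlternatingMap.constOfIsEmpty ℝ E (Fin 0) (f ((chartAt E x).symm y)) := rfl
  rw [extD, h, extDeriv_constOfIsEmpty, ← fderiv_comp_chart_symm hf (mem_chart_source E x)]
  rfl

theorem smoothFormAt_constOfIsEmpty {f : X → V} {x : X}
    (hf : ContMDiffAt 𝓘(ℝ, E) 𝓘(ℝ, V) ∞ f x) :
    SmoothFormAt (fun z => ContinuousAlternatingMap.constOfIsEmpty ℝ E (Fin 0) (f z)) x :=
  fun x₀ hx => by
    rw [inChart_constOfIsEmpty]
    exact (ContinuousAlternatingMap.constOfIsEmptyLIE ℝ E V (Fin 0)).contDiff.contDiffAt.comp _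
      (contDiffAt_comp_chart_symm hf hx)

end SmoothForms

/-! ### Spinor fields on manifolds -/

section SpinorFields
variable {E : Type*} [NormedAddCommGroup E] [NormedSpace ℝ E]
  {X : Type*} [TopologicalSpace X] [ChartedSpace E X]

/-- The exterior derivative of a spinor field on a manifold. -/
def extDSpinor (ρ : X → Spinor E) (x : X) : Spinor E
  | 0 => 0
  | k + 1 => extD (fun z => ρ z k) x

theorem dTwisted_eq (H : X → E [⋀^Fin 3]→L[ℝ] ℝ) (ρ : X → Spinor E) (x : X) :
    dTwisted H ρ x = extDSpinor ρ x + wedgeSpinor (toC (H x)) (ρ x) := by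
  funext k
  cases k <;> rfl

/-- The chart in which `d` is computed at `x` does not depend on the degree, so that the rules on a
vector space carry over to manifolds. -/
theorem extDSpinor_eq_pullSpinor (ρ : X → Spinor E) (x : X) :
    extDSpinor ρ x = pullSpinor (deriv' (chartAt E x) x)
      (dSpinor (fun y l => inChart (fun z => ρ z l) x y) (chartAt E x x)) := by
  funext k
  cases k <;> rfl

theorem extDSpinor_congr {ρ ρ' : X → Spinor E} {x : X} (h : ρ =ᶠ[𝓝 x] ρ') :
    extDSpinor ρ x = extDSpinor ρ' x := by
  funext k
  cases k with
  | zero => rfl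
  | succ k =>
    refine extD_congr ?_
    filter_upwards [h] with z hz
    rw [hz]

variable [FiniteDimensional ℝ E]

theorem SmoothFormAt.wedgeSpinor {a : ℕ} {α : X → E [⋀^Fin a]→L[ℝ] ℂ} {ρ : X → Spinor E} {x : X}
    (hα : SmoothFormAt α x) (hρ : ∀ k, SmoothFormAt (fun z => ρ z k) x) (k : ℕ) :
    SmoothFormAt (fun z => wedgeSpinor (α z) (ρ z) k) x := fun x₀ hx => by
  have h : inChart (fun z => GenCplx.wedgeSpinor (α z) (ρ z) k) x₀ = fun y =>
      GenCplx.wedgeSpinor (inChart α x₀ y) (fun l => inChart (fun z => ρ z l) x₀ y) k := by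
    funext y
    exact congrFun (pullSpinor_wedgeSpinor _ _ _) k
  rw [h]
  exact ContDiffAt.wedgeSpinor (hα x₀ hx) (fun l => hρ l x₀ hx) k

theorem SmoothFormAt.expWedge {σ : X → E [⋀^Fin 2]→L[ℝ] ℂ} {ρ : X → Spinor E} {x : X}
    (hσ : SmoothFormAt σ x) (hρ : ∀ k, SmoothFormAt (fun z => ρ z k) x) (k : ℕ) :
    SmoothFormAt (fun z => expWedge (σ z) (ρ z) k) x := fun x₀ hx => by
  have h : inChart (fun z => GenCplx.expWedge (σ z) (ρ z) k) x₀ = fun y =>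
      GenCplx.expWedge (inChart σ x₀ y) (fun l => inChart (fun z => ρ z l) x₀ y) k := by
    funext y
    exact congrFun (pullSpinor_expWedge _ _ _) k
  rw [h]
  exact ContDiffAt.expWedge (hσ x₀ hx) (fun l => hρ l x₀ hx) k

variable [IsManifold 𝓘(ℝ, E) ∞ X]

/-- `d (α ∧ ρ) = dα ∧ ρ ± α ∧ dρ` on a manifold. -/
theorem extDSpinor_wedgeSpinor {a : ℕ} {α : X → E [⋀^Fin a]→L[ℝ] ℂ} {ρ : X → Spinor E} {x : X}
    (hα : SmoothFormAt α x) (hρ : ∀ k, SmoothFormAt (fun z => ρ z k) x) :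
    extDSpinor (fun z => wedgeSpinor (α z) (ρ z)) x =
      wedgeSpinor (extD α x) (ρ x) + (-1 : ℂ) ^ a • wedgeSpinor (α x) (extDSpinor ρ x) := by
  have h : (fun y l => inChart (fun z => wedgeSpinor (α z) (ρ z) l) x y) = fun y =>
      wedgeSpinor (inChart α x y) (fun l => inChart (fun z => ρ z l) x y) := by
    funext y
    exact pullSpinor_wedgeSpinor _ _ _
  rw [extDSpinor_eq_pullSpinor, extDSpinor_eq_pullSpinor, h,
    dSpinor_wedgeSpinor hα.differentiableAt fun k => (hρ k).differentiableAt, pullSpinor_add,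
    pullSpinor_smul, pullSpinor_wedgeSpinor, pullSpinor_wedgeSpinor,
    inChart_compContinuousLinearMap α (mem_chart_source E x)]
  have h2 : pullSpinor (deriv' (chartAt E x) x) (fun l => inChart (fun z => ρ z l) x
      (chartAt E x x)) = ρ x := by
    funext l
    exact inChart_compContinuousLinearMap (fun z => ρ z l) (mem_chart_source E x)
  rw [h2]
  rfl

/-- `d (e^σ ∧ ρ) = e^σ ∧ (dρ + dσ ∧ ρ)` on a manifold. -/
theorem extDSpinor_expWedge {σ : X → E [⋀^Fin 2]→L[ℝ] ℂ} {ρ : X → Spinor E} {x : X}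
    (hσ : SmoothFormAt σ x) (hρ : ∀ k, SmoothFormAt (fun z => ρ z k) x) :
    extDSpinor (fun z => expWedge (σ z) (ρ z)) x =
      expWedge (σ x) (extDSpinor ρ x + wedgeSpinor (extD σ x) (ρ x)) := by
  have h : (fun y l => inChart (fun z => expWedge (σ z) (ρ z) l) x y) = fun y =>
      expWedge (inChart σ x y) (fun l => inChart (fun z => ρ z l) x y) := by
    funext y
    exact pullSpinor_expWedge _ _ _
  rw [extDSpinor_eq_pullSpinor, extDSpinor_eq_pullSpinor, h,
    dSpinor_expWedge (hσ x (mem_chart_source E x)) fun k => hρ k x (mem_chart_source E x),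
    pullSpinor_expWedge, pullSpinor_add, pullSpinor_wedgeSpinor,
    inChart_compContinuousLinearMap σ (mem_chart_source E x)]
  have h2 : pullSpinor (deriv' (chartAt E x) x) (fun l => inChart (fun z => ρ z l) x
      (chartAt E x x)) = ρ x := by
    funext l
    exact inChart_compContinuousLinearMap (fun z => ρ z l) (mem_chart_source E x)
  rw [h2]
  rfl

/-- `d_H (e^σ ∧ ρ) = e^σ ∧ (dρ + (dσ + H) ∧ ρ)`. -/
theorem dTwisted_expWedge (H : X → E [⋀^Fin 3]→L[ℝ] ℝ) {σ : X → E [⋀^Fin 2]→L[ℝ] ℂ}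
    {ρ : X → Spinor E} {x : X}
    (hσ : SmoothFormAt σ x) (hρ : ∀ k, SmoothFormAt (fun z => ρ z k) x) :
    dTwisted H (fun z => expWedge (σ z) (ρ z)) x =
      expWedge (σ x) (extDSpinor ρ x + wedgeSpinor (extD σ x + toC (H x)) (ρ x)) := by
  rw [dTwisted_eq, extDSpinor_expWedge hσ hρ, ← expWedge_wedgeSpinor, ← expWedge_add,
    add_wedgeSpinor, add_assoc]

end SpinorFields

/-! ### Pullback of forms by smooth maps -/

section Pullback
variable {E : Type*} [NormedAddCommGroup E] [NormedSpace ℝ E]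
  {X : Type*} [TopologicalSpace X] [ChartedSpace E X] [IsManifold 𝓘(ℝ, E) ∞ X]
  {G : Type*} [NormedAddCommGroup G] [NormedSpace ℝ G]
  {Y : Type*} [TopologicalSpace Y] [ChartedSpace G Y] [IsManifold 𝓘(ℝ, G) ∞ Y]
  {V : Type*} [NormedAddCommGroup V] [NormedSpace ℝ V]

/-- The map `f` in the chart at `x₀` and the preferred chart at `f x`. -/
def mapInCharts (f : X → Y) (x₀ x : X) (y : E) : G :=
  chartAt G (f x) (f ((chartAt E x₀).symm y))

theorem contDiffAt_mapInCharts {f : X → Y} {x : X} (hf : ContMDiffAt 𝓘(ℝ, E) 𝓘(ℝ, G) ∞ f x)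
    {x₀ : X} (hx : x ∈ (chartAt E x₀).source) :
    ContDiffAt ℝ ∞ (mapInCharts (E := E) (G := G) f x₀ x) (chartAt E x₀ x) := by
  have h2 : ContMDiffAt 𝓘(ℝ, G) 𝓘(ℝ, G) ∞ (chartAt G (f x)) (f x) :=
    (contMDiffOn_chart (I := 𝓘(ℝ, G)) (n := ∞) (x := f x) _ (mem_chart_source G _)).contMDiffAt
      ((chartAt G (f x)).open_source.mem_nhds (mem_chart_source G _))
  exact contDiffAt_comp_chart_symm (f := fun z => chartAt G (f x) (f z)) (h2.comp x hf) hx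

/-- In charts, the pullback by `f` is the pullback by the map `mapInCharts` of vector spaces. -/
theorem eventuallyEq_inChart_pullback {k : ℕ} (α : Y → G [⋀^Fin k]→L[ℝ] V) {f : X → Y} {U : Set X}
    (hU : IsOpen U) (hf : ContMDiffOn 𝓘(ℝ, E) 𝓘(ℝ, G) ∞ f U) {x : X} (hxU : x ∈ U) {x₀ : X}
    (hx : x ∈ (chartAt E x₀).source) :
    inChart (fun z => (α (f z)).compContinuousLinearMap (deriv' f z : E →L[ℝ] G)) x₀
      =ᶠ[𝓝 (chartAt E x₀ x)] fun y => (inChart α (f x) (mapInCharts f x₀ x y)).compContinuousLinearMap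
        (fderiv ℝ (mapInCharts f x₀ x) y) := by
  set e := chartAt E x₀ with he
  set c := chartAt G (f x) with hc
  have hfx : x ∈ U ∩ f ⁻¹' c.source := ⟨hxU, mem_chart_source G (f x)⟩
  have hW : IsOpen (U ∩ f ⁻¹' c.source) := hf.continuousOn.isOpen_inter_preimage hU c.open_source
  have hW' : IsOpen (e.target ∩ e.symm ⁻¹' (U ∩ f ⁻¹' c.source)) := e.isOpen_inter_preimage_symm hW
  filter_upwards [hW'.mem_nhds ⟨e.map_source hx, by
    rw [Set.mem_preimage, e.left_inv hx]; exact hfx⟩] with y hy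
  have hfd : MDifferentiableAt 𝓘(ℝ, E) 𝓘(ℝ, G) f (e.symm y) :=
    (hf.contMDiffAt (hU.mem_nhds hy.2.1)).mdifferentiableAt (by simp)
  have hfe : MDifferentiableAt 𝓘(ℝ, E) 𝓘(ℝ, G) (fun w => f (e.symm w)) y :=
    MDifferentiableAt.comp (I' := 𝓘(ℝ, E)) y hfd (mdiff_symm x₀ hy.1)
  have hφ : MDifferentiableAt 𝓘(ℝ, E) 𝓘(ℝ, G) (mapInCharts f x₀ x) y :=
    MDifferentiableAt.comp (I' := 𝓘(ℝ, G)) y (mdiff_chart (f x) hy.2.2) hfe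
  have hct : mapInCharts f x₀ x y ∈ c.target := c.map_source hy.2.2
  have hinv : c.symm (mapInCharts f x₀ x y) = f (e.symm y) := c.left_inv hy.2.2
  have heq : (fun w => f (e.symm w)) =ᶠ[𝓝 y] fun w => c.symm (mapInCharts f x₀ x w) := by
    filter_upwards [hW'.mem_nhds hy] with w hw
    exact (c.left_inv hw.2.2).symm
  have h1 : mfderiv 𝓘(ℝ, E) 𝓘(ℝ, G) (fun w => f (e.symm w)) y =
      (mfderiv 𝓘(ℝ, E) 𝓘(ℝ, G) f (e.symm y)).comp (mfderiv 𝓘(ℝ, E) 𝓘(ℝ, E) e.symm y) :=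
    mfderiv_comp y hfd (mdiff_symm x₀ hy.1)
  have h2 : mfderiv 𝓘(ℝ, E) 𝓘(ℝ, G) (fun w => c.symm (mapInCharts f x₀ x w)) y =
      (mfderiv 𝓘(ℝ, G) 𝓘(ℝ, G) c.symm (mapInCharts f x₀ x y)).comp
        (mfderiv 𝓘(ℝ, E) 𝓘(ℝ, G) (mapInCharts f x₀ x) y) :=
    mfderiv_comp y (mdiff_symm (f x) hct) hφ
  rw [← heq.mfderiv_eq, h1, mfderiv_eq_fderiv] at h2
  have h3 : (deriv' f (e.symm y) : E →L[ℝ] G).comp (deriv' e.symm y : E →L[ℝ] E) =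
      (deriv' c.symm (mapInCharts f x₀ x y) : G →L[ℝ] G).comp
        (fderiv ℝ (mapInCharts f x₀ x) y) := h2
  simp only [inChart, ← he, ← hc, hinv]
  ext v
  have h4 : ∀ i, (deriv' f (e.symm y) : E →L[ℝ] G) ((deriv' e.symm y : E →L[ℝ] E) (v i)) =
      (deriv' c.symm (mapInCharts f x₀ x y) : G →L[ℝ] G)
        (fderiv ℝ (mapInCharts f x₀ x) y (v i)) := fun i => congrArg (fun L => L (v i)) h3
  exact congrArg (α (f (e.symm y))) (funext h4)

theorem smoothFormAt_pullback [FiniteDimensional ℝ E] [FiniteDimensional ℝ G]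
    [FiniteDimensional ℝ V] {k : ℕ} {α : Y → G [⋀^Fin k]→L[ℝ] V} {f : X → Y} {U : Set X}
    (hU : IsOpen U) (hf : ContMDiffOn 𝓘(ℝ, E) 𝓘(ℝ, G) ∞ f U) {x : X} (hxU : x ∈ U)
    (hα : SmoothFormAt α (f x)) :
    SmoothFormAt (fun z => (α (f z)).compContinuousLinearMap (deriv' f z : E →L[ℝ] G)) x := by
  intro x₀ hx
  refine ContDiffAt.congr_of_eventuallyEq ?_ (eventuallyEq_inChart_pullback α hU hf hxU hx)
  have h1 := contDiffAt_mapInCharts (hf.contMDiffAt (hU.mem_nhds hxU)) hx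
  have h2 : mapInCharts f x₀ x (chartAt E x₀ x) = chartAt G (f x) (f x) := by
    rw [mapInCharts, (chartAt E x₀).left_inv hx]
  refine ContDiffAt.compContinuousLinearMap ?_ (h1.fderiv_right (m := ∞) (by simp))
  refine ContDiffAt.comp (g := inChart α (f x)) _ ?_ h1
  rw [h2]
  exact hα (f x) (mem_chart_source G (f x))

/-- The exterior derivative commutes with pullback. -/
theorem extD_pullback {k : ℕ} {α : Y → G [⋀^Fin k]→L[ℝ] V} {f : X → Y} {U : Set X}
    (hU : IsOpen U) (hf : ContMDiffOn 𝓘(ℝ, E) 𝓘(ℝ, G) ∞ f U) {x : X} (hxU : x ∈ U)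
    (hα : SmoothFormAt α (f x)) :
    extD (fun z => (α (f z)).compContinuousLinearMap (deriv' f z : E →L[ℝ] G)) x =
      (extD α (f x)).compContinuousLinearMap (deriv' f x : E →L[ℝ] G) := by
  have hx := mem_chart_source E x
  have h1 := contDiffAt_mapInCharts (hf.contMDiffAt (hU.mem_nhds hxU)) hx
  have h2 : mapInCharts f x x (chartAt E x x) = chartAt G (f x) (f x) := by
    rw [mapInCharts, (chartAt E x).left_inv hx]
  have hfd : MDifferentiableAt 𝓘(ℝ, E) 𝓘(ℝ, G) f x :=
    (hf.contMDiffAt (hU.mem_nhds hxU)).mdifferentiableAt (by simp)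
  have hcf := mdiff_chart (f x) (mem_chart_source G (f x))
  have h3 : (fderiv ℝ (mapInCharts f x x) (chartAt E x x)).comp
      (deriv' (chartAt E x) x : E →L[ℝ] E) = (deriv' (chartAt G (f x)) (f x) : G →L[ℝ] G).comp
        (deriv' f x : E →L[ℝ] G) :=
    (fderiv_comp_chart_symm (f := fun z => chartAt G (f x) (f z))
      (MDifferentiableAt.comp (I' := 𝓘(ℝ, G)) x hcf hfd) hx).trans (mfderiv_comp x hcf hfd)
  rw [extD, (eventuallyEq_inChart_pullback α hU hf hxU hx).extDeriv_eq,
    extDeriv_pullback (r := ∞) (by rw [h2]; exact hα.differentiableAt) h1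
      (by simp; exact WithTop.coe_le_coe.2 (le_top : (2 : ℕ∞) ≤ ⊤)), h2, extD]
  ext v
  have h4 : ∀ i, fderiv ℝ (mapInCharts f x x) (chartAt E x x)
      ((deriv' (chartAt E x) x : E →L[ℝ] E) (v i)) =
        (deriv' (chartAt G (f x)) (f x) : G →L[ℝ] G) ((deriv' f x : E →L[ℝ] G) (v i)) := fun i =>
    congrArg (fun L => L (v i)) h3
  exact congrArg (extDeriv (inChart α (f x)) (chartAt G (f x) (f x))) (funext h4)

end Pullback

/-! ### Products with a one-form -/

section OneForms
variable {E : Type*} [NormedAddCommGroup E] [NormedSpace ℝ E]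

/-- A complex linear functional as a covector of degree one. -/
def oneForm (θ : E →L[ℝ] ℂ) : E [⋀^Fin 1]→L[ℝ] ℂ :=
  ContinuousAlternatingMap.ofSubsingleton ℝ E ℂ (0 : Fin 1) θ

/-- A complex linear functional as a spinor. -/
def oneSpinor (θ : E →L[ℝ] ℂ) : Spinor E := Pi.single 1 (oneForm θ)

@[simp] theorem oneForm_apply (θ : E →L[ℝ] ℂ) (v : Fin 1 → E) : oneForm θ v = θ (v 0) := rfl

/-- Spinors concentrated in one degree. -/
def homogSpinor {k : ℕ} (α : E [⋀^Fin k]→L[ℝ] ℂ) : Spinor E := Pi.single k α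

theorem homogSpinor_same {k : ℕ} (α : E [⋀^Fin k]→L[ℝ] ℂ) : homogSpinor α k = α :=
  Pi.single_eq_same _ _

theorem homogSpinor_of_ne {k l : ℕ} (h : l ≠ k) (α : E [⋀^Fin k]→L[ℝ] ℂ) :
    homogSpinor α l = 0 := Pi.single_eq_of_ne h _

theorem homogSpinor_eq_zero_iff {k : ℕ} {α : E [⋀^Fin k]→L[ℝ] ℂ} : homogSpinor α = 0 ↔ α = 0 := by
  constructor
  · intro h
    rw [← homogSpinor_same α, h]
    rfl
  · rintro rfl
    exact Pi.single_zero _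

theorem homogSpinor_smul {k : ℕ} (c : ℂ) (α : E [⋀^Fin k]→L[ℝ] ℂ) :
    homogSpinor (c • α) = c • homogSpinor α := Pi.single_smul _ _ _

theorem homogSpinor_sub {k : ℕ} (α β : E [⋀^Fin k]→L[ℝ] ℂ) :
    homogSpinor (α - β) = homogSpinor α - homogSpinor β := Pi.single_sub _ _ _

theorem contract_homogSpinor {k : ℕ} (u : E) (α : E [⋀^Fin (k + 1)]→L[ℝ] ℂ) :
    contract u (homogSpinor α) = homogSpinor (α.curryLeft u) := by
  funext l
  by_cases h : l = k
  · subst h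
    rw [contract, homogSpinor_same, homogSpinor_same]
  · rw [contract, homogSpinor_of_ne (by omega), homogSpinor_of_ne h]
    rfl

theorem wedgeSpinor_homogSpinor_zero {k : ℕ} (α : E [⋀^Fin k]→L[ℝ] ℂ)
    (c : E [⋀^Fin 0]→L[ℝ] ℂ) : wedgeSpinor α (homogSpinor c) = c 0 • homogSpinor α := by
  funext l
  rcases lt_trichotomy l k with h | rfl | h
  · rw [wedgeSpinor_apply_of_lt h, Pi.smul_apply, homogSpinor_of_ne h.ne, smul_zero]
  · rw [wedgeSpinor_apply (add_zero l), homogSpinor_same, Pi.smul_apply, homogSpinor_same]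
    ext v
    rw [wedge_apply]
    have : ∀ e : Equiv.Perm (Fin l), ((Equiv.Perm.sign e : ℤ) : ℂ) *
        ((α fun i => v (e (Fin.cast (add_zero l) (Fin.castAdd 0 i)))) *
          c fun i => v (e (Fin.cast (add_zero l) (Fin.natAdd l i)))) = c 0 * α v := by
      intro e
      have h1 : (α fun i => v (e (Fin.cast (add_zero l) (Fin.castAdd 0 i)))) =
          Equiv.Perm.sign e • α v := α.toAlternatingMap.map_perm v e
      have h2 : (fun i => v (e (Fin.cast (add_zero l) (Fin.natAdd l i)))) = 0 :=
        Subsingleton.elim _ _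
      rw [h1, h2]
      rcases Int.units_eq_one_or (Equiv.Perm.sign e) with h | h <;> simp [h, mul_comm]
    rw [Finset.sum_congr rfl fun e _ => this e, Finset.sum_const, Finset.card_univ,
      Fintype.card_perm, Fintype.card_fin, nsmul_eq_mul]
    have : (l.factorial : ℂ) ≠ 0 := by exact_mod_cast l.factorial_ne_zero
    simp [this]
  · rw [wedgeSpinor_apply (Nat.add_sub_of_le h.le), homogSpinor_of_ne (by omega), Pi.smul_apply,
      homogSpinor_of_ne h.ne', smul_zero]
    exact map_zero (wedgeBilin (E := E) (Nat.add_sub_of_le h.le) α)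

theorem contract_oneSpinor (u : E) (θ : E →L[ℝ] ℂ) :
    contract u (oneSpinor θ) = homogSpinor ((oneForm θ).curryLeft u) := contract_homogSpinor _ _

/-- `ι_u (K ∧ θ) = ι_u K ∧ θ ± θ(u) K`. -/
theorem contract_wedgeSpinor_oneSpinor {k : ℕ} (u : E) (K : E [⋀^Fin (k + 1)]→L[ℝ] ℂ)
    (θ : E →L[ℝ] ℂ) : contract u (wedgeSpinor K (oneSpinor θ)) =
      wedgeSpinor (K.curryLeft u) (oneSpinor θ) + ((-1) ^ (k + 1) * θ u) • homogSpinor K := by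
  rw [contract_wedgeSpinor, contract_oneSpinor, wedgeSpinor_homogSpinor_zero, smul_smul]
  rfl

theorem wedgeSpinor_oneSpinor_apply_of_ne {k l : ℕ} (K : E [⋀^Fin k]→L[ℝ] ℂ) (θ : E →L[ℝ] ℂ)
    (h : l ≠ k + 1) : wedgeSpinor K (oneSpinor θ) l = 0 := by
  rcases lt_or_ge l k with h' | h'
  · exact wedgeSpinor_apply_of_lt h' _ _
  · rw [wedgeSpinor_apply (Nat.add_sub_of_le h'), oneSpinor, Pi.single_eq_of_ne (by omega)]
    exact map_zero (wedgeBilin (E := E) (Nat.add_sub_of_le h') K)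

theorem wedgeSpinor_oneSpinor {k : ℕ} (K : E [⋀^Fin k]→L[ℝ] ℂ) (θ : E →L[ℝ] ℂ) :
    wedgeSpinor K (oneSpinor θ) = homogSpinor (wedge rfl K (oneForm θ)) := by
  funext l
  by_cases h : l = k + 1
  · subst h
    rw [homogSpinor_same, wedgeSpinor_apply rfl]
    rfl
  · rw [wedgeSpinor_oneSpinor_apply_of_ne _ _ h, homogSpinor_of_ne h]

/-- Forms of positive degree are determined by their contractions. -/
theorem homogSpinor_ext {k : ℕ} {α β : E [⋀^Fin (k + 1)]→L[ℝ] ℂ}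
    (h : ∀ u, contract u (homogSpinor α) = contract u (homogSpinor β)) : α = β := by
  refine curryLeft_ext fun u => ?_
  have := h u
  rw [contract_homogSpinor, contract_homogSpinor] at this
  rw [← homogSpinor_same (α.curryLeft u), this, homogSpinor_same]

/-- A covector `ζ` of degree one satisfies `ζ ∧ θ = 0` if and only if it is proportional to `θ`. -/
theorem wedgeSpinor_oneSpinor_eq_zero_iff {ζ : E [⋀^Fin 1]→L[ℝ] ℂ} {θ : E →L[ℝ] ℂ} :
    wedgeSpinor ζ (oneSpinor θ) = 0 ↔ ∀ u v : E, ζ ![u] * θ v = θ u * ζ ![v] := by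
  have key : ∀ u, contract u (wedgeSpinor ζ (oneSpinor θ)) =
      homogSpinor (ζ ![u] • oneForm θ - θ u • ζ) := by
    intro u
    rw [contract_wedgeSpinor_oneSpinor, wedgeSpinor_zero_degree, homogSpinor_sub, homogSpinor_smul,
      homogSpinor_smul, sub_eq_add_neg, ← neg_smul]
    have : (ζ.curryLeft u) 0 = ζ ![u] := by
      rw [ContinuousAlternatingMap.curryLeft_apply_apply]
      congr 1
      funext i
      fin_cases i; rfl
    rw [this]
    congr 2
    simp
  constructor
  · intro h u v
    have h1 := key u
    rw [h, show contract u (0 : Spinor E) = 0 from rfl, eq_comm, homogSpinor_eq_zero_iff] at h1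
    have h2 := congrArg (fun f => f ![v]) h1
    simp only [ContinuousAlternatingMap.sub_apply, ContinuousAlternatingMap.smul_apply,
      oneForm_apply, smul_eq_mul] at h2
    exact sub_eq_zero.1 h2
  · intro h
    rw [wedgeSpinor_oneSpinor, homogSpinor_eq_zero_iff]
    refine homogSpinor_ext fun u => ?_
    rw [← wedgeSpinor_oneSpinor, key u, (homogSpinor_eq_zero_iff (α := 0)).2 rfl,
      show contract u (0 : Spinor E) = 0 from rfl, homogSpinor_eq_zero_iff]
    ext v
    have hv : v = ![v 0] := by
      funext i
      fin_cases i; rfl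
    rw [hv]
    exact sub_eq_zero.2 (h u (v 0))

/-- The condition `K ∧ θ = 0` is inherited by contractions with vertical vectors. -/
theorem wedgeSpinor_curryLeft_eq_zero {k : ℕ} {K : E [⋀^Fin (k + 1)]→L[ℝ] ℂ} {θ : E →L[ℝ] ℂ}
    (h : wedgeSpinor K (oneSpinor θ) = 0) {y : E} (hy : θ y = 0) :
    wedgeSpinor (K.curryLeft y) (oneSpinor θ) = 0 := by
  have := contract_wedgeSpinor_oneSpinor y K θ
  rw [h, hy, mul_zero, zero_smul, add_zero] at this
  exact this.symm

/-- A form `K` with `K ∧ θ = 0`, `θ ≠ 0`, vanishes when all its arguments are vertical. -/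
theorem apply_vertical_eq_zero {θ : E →L[ℝ] ℂ} (hθ : θ ≠ 0) :
    ∀ {k : ℕ} {K : E [⋀^Fin k]→L[ℝ] ℂ}, wedgeSpinor K (oneSpinor θ) = 0 →
      ∀ v : Fin k → E, (∀ i, θ (v i) = 0) → K v = 0
  | 0, K, h, v, _ => by
    rw [wedgeSpinor_zero_degree] at h
    obtain rfl : v = 0 := Subsingleton.elim _ _
    refine (smul_eq_zero.1 h).resolve_right fun h' => hθ ?_
    have h2 := homogSpinor_eq_zero_iff.1 h'
    ext u
    exact congrArg (fun f => f ![u]) h2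
  | k + 1, K, h, v, hv => by
    have h1 := apply_vertical_eq_zero hθ (wedgeSpinor_curryLeft_eq_zero h (hv 0)) (Fin.tail v) fun i => hv _
    rwa [ContinuousAlternatingMap.curryLeft_apply_apply, ← Fin.cons_self_tail v] at *

/-- A form `K` with `K ∧ θ = 0` has type `(1, 0)`: when all its arguments but one are vertical, it
is complex linear in the remaining one with respect to `θ`. -/
theorem apply_vecCons_of_wedge_eq_zero {θ : E →L[ℝ] ℂ} (hθ : Function.Surjective θ) :
    ∀ {k : ℕ} {K : E [⋀^Fin (k + 1)]→L[ℝ] ℂ}, wedgeSpinor K (oneSpinor θ) = 0 →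
      ∀ (a b : E) (l : ℂ) (v : Fin k → E), θ a = l * θ b → (∀ i, θ (v i) = 0) →
        K (Matrix.vecCons a v) = l * K (Matrix.vecCons b v)
  | 0, K, h, a, b, l, v, hab, _ => by
    obtain ⟨e, he⟩ := hθ 1
    have h1 := wedgeSpinor_oneSpinor_eq_zero_iff.1 h
    obtain rfl : v = ![] := Subsingleton.elim _ _
    have ha := h1 a e
    have hb := h1 b e
    rw [he, mul_one] at ha hb
    rw [ha, hb, hab, mul_assoc]
  | k + 1, K, h, a, b, l, v, hab, hv => by
    have h1 := apply_vecCons_of_wedge_eq_zero hθ (wedgeSpinor_curryLeft_eq_zero h (hv 0)) a b l (Fin.tail v)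
      hab fun i => hv _
    have h2 : ∀ c, K.curryLeft (v 0) (Matrix.vecCons c (Fin.tail v)) =
        - K (Matrix.vecCons c v) := by
      intro c
      rw [ContinuousAlternatingMap.curryLeft_apply_apply]
      have := K.toAlternatingMap.map_swap (Matrix.vecCons c v) (i := 0) (j := 1) (by simp)
      rw [show K (Matrix.vecCons c v) = K.toAlternatingMap (Matrix.vecCons c v) from rfl, ← this]
      refine congrArg K ?_
      funext i
      refine Fin.cases ?_ (fun i => Fin.cases ?_ (fun j => ?_) i) i
      · simp
      · simp
      · have : (Equiv.swap (0 : Fin (k + 2)) 1) j.succ.succ = j.succ.succ :=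
          Equiv.swap_apply_of_ne_of_ne (Fin.succ_ne_zero _) (by
            rw [← Fin.succ_zero_eq_one]; exact (Fin.succ_injective _).ne (Fin.succ_ne_zero _))
        simp only [Function.comp_apply, this]
        rfl
    rw [h2, h2, mul_neg, neg_inj] at h1
    exact h1

/-- A form which vanishes on contraction with two vectors spanning a complement of the vertical
space, and on contraction with vertical vectors, is zero. -/
theorem eq_zero_of_curryLeft_eq_zero {θ : E →L[ℝ] ℂ} {e₁ e₂ : E} (h₁ : θ e₁ = 1)
    (h₂ : θ e₂ = Complex.I) {k : ℕ} {α : E [⋀^Fin (k + 1)]→L[ℝ] ℂ} (ha : α.curryLeft e₁ = 0)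
    (hb : α.curryLeft e₂ = 0) (hy : ∀ y, θ y = 0 → α.curryLeft y = 0) : α = 0 := by
  refine curryLeft_ext fun u => ?_
  have hu : u = (θ u).re • e₁ + (θ u).im • e₂ + (u - (θ u).re • e₁ - (θ u).im • e₂) := by abel
  have hv : θ (u - (θ u).re • e₁ - (θ u).im • e₂) = 0 := by
    rw [map_sub, map_sub, map_smul, map_smul, h₁, h₂]
    apply Complex.ext <;> simp
  rw [hu, map_add, map_add, map_smul, map_smul, ha, hb, hy _ hv]
  ext v
  simp

theorem curryLeft_curryLeft_swap {k : ℕ} (α : E [⋀^Fin (k + 2)]→L[ℝ] ℂ) (u v : E) :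
    (α.curryLeft u).curryLeft v = -(α.curryLeft v).curryLeft u := by
  have h : ∀ w : E, (α.curryLeft w).curryLeft w = 0 := α.curryLeft_same
  have h3 := h (u + v)
  ext m
  have h4 := congrArg (fun f => f m) h3
  have hu := congrArg (fun f => f m) (h u)
  have hv := congrArg (fun f => f m) (h v)
  simp only [map_add, ContinuousAlternatingMap.curryLeft_add, _root_.add_apply,
    ContinuousAlternatingMap.add_apply] at h4 hu hv
  have hz : (0 : E [⋀^Fin k]→L[ℝ] ℂ) m = 0 := rfl
  simp only [ContinuousAlternatingMap.neg_apply]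
  linear_combination h4 - hu - hv - hz

/-- As the vertical space has codimension two, a form of degree at least three that vanishes on
contraction with vertical vectors is zero. -/
theorem eq_zero_of_curryLeft_vertical {θ : E →L[ℝ] ℂ} (hθ : Function.Surjective θ) {k : ℕ}
    {α : E [⋀^Fin (k + 3)]→L[ℝ] ℂ} (hy : ∀ y, θ y = 0 → α.curryLeft y = 0) : α = 0 := by
  obtain ⟨e₁, h₁⟩ := hθ 1
  obtain ⟨e₂, h₂⟩ := hθ Complex.I
  have same : ∀ {m : ℕ} (β : E [⋀^Fin (m + 2)]→L[ℝ] ℂ) (w : E),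
      (β.curryLeft w).curryLeft w = 0 := fun β => β.curryLeft_same
  have vert : ∀ {m : ℕ} {β : E [⋀^Fin (m + 2)]→L[ℝ] ℂ}, (∀ y, θ y = 0 → β.curryLeft y = 0) →
      ∀ w y, θ y = 0 → (β.curryLeft w).curryLeft y = 0 := fun hβ w y h => by
    rw [curryLeft_curryLeft_swap, hβ y h]
    ext; simp
  -- contraction with both `e₁` and `e₂` already gives zero
  have h12 : (α.curryLeft e₁).curryLeft e₂ = 0 := by
    refine eq_zero_of_curryLeft_eq_zero h₁ h₂ ?_ (same _ _) (vert (vert hy _) _)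
    rw [curryLeft_curryLeft_swap, same]
    ext; simp
  refine eq_zero_of_curryLeft_eq_zero h₁ h₂ ?_ ?_ hy
  · exact eq_zero_of_curryLeft_eq_zero h₁ h₂ (same _ _) h12 (vert hy _)
  · refine eq_zero_of_curryLeft_eq_zero h₁ h₂ ?_ (same _ _) (vert hy _)
    rw [curryLeft_curryLeft_swap, h12]
    ext; simp

/-- A `4`-form that vanishes on contraction with two vertical vectors is zero. -/
theorem eq_zero_of_curryLeft_curryLeft_vertical {θ : E →L[ℝ] ℂ} (hθ : Function.Surjective θ)
    {α : E [⋀^Fin 4]→L[ℝ] ℂ}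
    (hy : ∀ y y', θ y = 0 → θ y' = 0 → (α.curryLeft y).curryLeft y' = 0) : α = 0 :=
  eq_zero_of_curryLeft_vertical hθ fun y h =>
    eq_zero_of_curryLeft_vertical hθ fun y' h' => hy y y' h h'

/-- A `3`-form of type `(1, 0)` is annihilated by `θ`.  Only its values on two vertical arguments
matter, as `K ∧ θ` has degree four and the base has dimension two. -/
theorem wedge_eq_zero_of_type {θ : E →L[ℝ] ℂ} (hθ : Function.Surjective θ)
    {K : E [⋀^Fin 3]→L[ℝ] ℂ}
    (hK' : ∀ a b l y y', θ a = l * θ b → θ y = 0 → θ y' = 0 → K ![y, y', a] = l * K ![y, y', b]) :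
    wedgeSpinor K (oneSpinor θ) = 0 := by
  rw [wedgeSpinor_oneSpinor, homogSpinor_eq_zero_iff]
  refine eq_zero_of_curryLeft_curryLeft_vertical hθ fun y y' h h' => ?_
  have h1 : contract y' (contract y (homogSpinor (wedge rfl K (oneForm θ)))) = 0 := by
    rw [← wedgeSpinor_oneSpinor, contract_wedgeSpinor_oneSpinor, h, mul_zero, zero_smul, add_zero,
      contract_wedgeSpinor_oneSpinor, h', mul_zero, zero_smul, add_zero,
      wedgeSpinor_oneSpinor_eq_zero_iff]
    obtain ⟨e, he⟩ := hθ 1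
    have key : ∀ u, (K.curryLeft y).curryLeft y' ![u] = θ u * K ![y, y', e] := fun u =>
      hK' u e (θ u) y y' (by rw [he, mul_one]) h h'
    intro u v
    rw [key, key]
    ring
  rw [contract_homogSpinor, contract_homogSpinor] at h1
  exact homogSpinor_eq_zero_iff.1 h1

/-- A `2`-form whose product with `θ` vanishes is zero on vertical vectors. -/
theorem apply_vertical_eq_zero_two {θ : E →L[ℝ] ℂ} (hθ : θ ≠ 0) {τ : E [⋀^Fin 2]→L[ℝ] ℂ}
    (h : wedgeSpinor τ (oneSpinor θ) = 0) {u v : E} (hu : θ u = 0) (hv : θ v = 0) :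
    τ ![u, v] = 0 :=
  apply_vertical_eq_zero hθ h _ fun i => by fin_cases i <;> assumption

end OneForms

/-! ### Purity and real rank zero -/

theorem one_covector_eta {E : Type*} (v : Fin 1 → E) : v = ![v 0] := by
  funext i
  fin_cases i; rfl

section Pure
variable {E : Type*} [NormedAddCommGroup E] [NormedSpace ℝ E]

/-- The covector `ι_Y σ + ξ`, for `(Y, ξ)` in `T_ℂ ⊕ T_ℂ^*`. -/
def GenVec.shear (σ : E [⋀^Fin 2]→L[ℝ] ℂ) (a : GenVec E) : E [⋀^Fin 1]→L[ℝ] ℂ :=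
  σ.curryLeft a.re + Complex.I • σ.curryLeft a.im + a.form

theorem GenVec.shear_apply (σ : E [⋀^Fin 2]→L[ℝ] ℂ) (a : GenVec E) (v : Fin 1 → E) :
    a.shear σ v = σ ![a.re, v 0] + Complex.I * σ ![a.im, v 0] + a.form v := by
  conv_lhs => rw [one_covector_eta v]
  conv_rhs => rw [one_covector_eta v]
  rfl

theorem two_covector_swap {V : Type*} [NormedAddCommGroup V] [NormedSpace ℝ V]
    (σ : E [⋀^Fin 2]→L[ℝ] V) (u v : E) : σ ![u, v] = -σ ![v, u] := by
  have h := σ.toAlternatingMap.map_swap ![v, u] (i := 0) (j := 1) (by simp)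
  rw [show -σ ![v, u] = -σ.toAlternatingMap ![v, u] from rfl, ← h]
  refine congrArg σ ?_
  funext i
  fin_cases i <;> rfl

/-- The pairing is unchanged by shearing, by skew-symmetry of `σ`. -/
theorem GenVec.pairing_eq (σ : E [⋀^Fin 2]→L[ℝ] ℂ) (a b : GenVec E) :
    a.pairing b = evalC (a.shear σ) b.re b.im + evalC (b.shear σ) a.re a.im := by
  simp only [GenVec.pairing, evalC, GenVec.shear_apply]
  rw [two_covector_swap σ a.re b.re, two_covector_swap σ a.re b.im, two_covector_swap σ a.im b.re,
    two_covector_swap σ a.im b.im]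
  ring_nf

/-- The null space of `e^σ ∧ θ` consists of the `(Y, ξ)` with `θ(Y) = 0` for which `ι_Y σ + ξ` is
proportional to `θ`. -/
theorem mem_nullSpace_expWedge_iff {σ : E [⋀^Fin 2]→L[ℝ] ℂ} {θ : E →L[ℝ] ℂ} {a : GenVec E} :
    a ∈ nullSpace (expWedge σ (oneSpinor θ)) ↔ θ a.re + Complex.I * θ a.im = 0 ∧
      ∀ u v, a.shear σ ![u] * θ v = θ u * a.shear σ ![v] := by
  rw [nullSpace, Set.mem_ofPred_eq, act_expWedge, ← wedgeSpinor_oneSpinor_eq_zero_iff]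
  have h0 : ∀ {ρ : Spinor E}, expWedge σ ρ = 0 ↔ ρ = 0 := fun {ρ} =>
    ⟨expWedge_injective σ, fun h => by rw [h, expWedge_zero]⟩
  rw [h0]
  constructor
  · intro h
    have h1 := congrFun h 0
    have h2 : wedgeSpinor (a.shear σ) (oneSpinor θ) 0 = 0 :=
      wedgeSpinor_oneSpinor_apply_of_ne _ _ (by norm_num)
    have h3 : wedgeSpinor (a.shear σ) (oneSpinor θ) = 0 := by
      funext l
      by_cases hl : l = 2
      · subst hl
        have h4 := congrFun h 2
        rw [contract_oneSpinor, contract_oneSpinor, Pi.add_apply, Pi.add_apply, Pi.smul_apply,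
          homogSpinor_of_ne (by norm_num), homogSpinor_of_ne (by norm_num), smul_zero, zero_add,
          zero_add] at h4
        exact h4
      · exact wedgeSpinor_oneSpinor_apply_of_ne _ _ hl
    refine ⟨?_, h3⟩
    have h5 : contract a.re (oneSpinor θ) 0 + Complex.I • contract a.im (oneSpinor θ) 0 +
      wedgeSpinor (a.shear σ) (oneSpinor θ) 0 = 0 := h1
    rw [h2, add_zero, contract_oneSpinor, contract_oneSpinor, homogSpinor_same, homogSpinor_same]
      at h5
    exact congrArg (fun f => f ![]) h5
  · rintro ⟨h1, h2⟩
    have h3 : wedgeSpinor (σ.curryLeft a.re + Complex.I • σ.curryLeft a.im + a.form)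
      (oneSpinor θ) = 0 := h2
    rw [h3, add_zero, contract_oneSpinor, contract_oneSpinor, ← homogSpinor_smul]
    rw [homogSpinor, homogSpinor, ← Pi.single_add]
    refine homogSpinor_eq_zero_iff.2 ?_
    ext v
    exact h1

/-- A multiple of `θ` vanishes on the complex vectors killed by `θ`. -/
theorem evalC_eq_zero {ζ : E [⋀^Fin 1]→L[ℝ] ℂ} {θ : E →L[ℝ] ℂ} (hθ : Function.Surjective θ)
    (h : ∀ u v, ζ ![u] * θ v = θ u * ζ ![v]) {u v : E} (huv : θ u + Complex.I * θ v = 0) :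
    evalC ζ u v = 0 := by
  obtain ⟨e, he⟩ := hθ 1
  have h1 := h u e
  have h2 := h v e
  rw [he, mul_one] at h1 h2
  have h3 : evalC ζ u v = ζ ![u] + Complex.I * ζ ![v] := by
    rw [evalC, one_covector_eta fun _ => u, one_covector_eta fun _ => v]
  rw [h3, h1, h2]
  linear_combination huv * ζ ![e]

/-- The spinor `e^σ ∧ θ` is pure. -/
theorem isPure_expWedge (σ : E [⋀^Fin 2]→L[ℝ] ℂ) {θ : E →L[ℝ] ℂ} (hθ : Function.Surjective θ) :
    IsPure (expWedge σ (oneSpinor θ)) := by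
  refine ⟨fun a ha b hb => ?_, fun w hw _ => ?_⟩
  · rw [mem_nullSpace_expWedge_iff] at ha hb
    rw [a.pairing_eq σ, evalC_eq_zero hθ ha.2 hb.1, evalC_eq_zero hθ hb.2 ha.1, add_zero]
  · rw [mem_nullSpace_expWedge_iff]
    constructor
    · -- pair with `θ` itself
      have hθ' := hw ⟨0, 0, oneForm θ⟩ (by
        rw [mem_nullSpace_expWedge_iff]
        refine ⟨by simp, fun u v => ?_⟩
        have hz : ∀ u : E, σ ![0, u] = 0 := fun u => by
          rw [two_covector_swap, ← two_covector_swap]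
          exact σ.map_coord_zero (m := ![0, u]) 0 rfl
        simp [GenVec.shear_apply, hz])
      have hz : ∀ ξ : E [⋀^Fin 1]→L[ℝ] ℂ, evalC ξ 0 0 = 0 := fun ξ => by
        have : (ξ fun _ => (0 : E)) = 0 := ξ.map_coord_zero 0 rfl
        rw [evalC, this]
        ring
      rw [GenVec.pairing, hz, zero_add] at hθ'
      exact hθ'
    · -- pair with `θ(v) u - θ(u) v`, made isotropic by subtracting its contraction with `σ`
      intro u v
      set r : E := (θ v).re • u - (θ u).re • v with hr
      set s : E := (θ v).im • u - (θ u).im • v with hs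
      have h0 : ∀ (f : E →L[ℝ] ℂ), f r + Complex.I * f s = θ v * f u - θ u * f v := fun f => by
        rw [hr, hs, map_sub, map_sub, map_smul, map_smul, map_smul, map_smul]
        apply Complex.ext <;> simp <;> ring
      set a : GenVec E := ⟨r, s, -(σ.curryLeft r + Complex.I • σ.curryLeft s)⟩ with ha
      have hsh : a.shear σ = 0 := by
        rw [GenVec.shear]
        exact add_neg_cancel _
      have h1 := hw a (by
        rw [mem_nullSpace_expWedge_iff, hsh]
        refine ⟨?_, fun _ _ => ?_⟩
        · rw [ha]
          rw [h0]
          ring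
        · simp)
      rw [w.pairing_eq σ, hsh] at h1
      have h2 := h0 ((ContinuousAlternatingMap.ofSubsingleton ℝ E ℂ (0 : Fin 1)).symm (w.shear σ))
      have h3 : ∀ z : E, (ContinuousAlternatingMap.ofSubsingleton ℝ E ℂ (0 : Fin 1)).symm
          (w.shear σ) z = w.shear σ ![z] := fun z =>
        congrArg (w.shear σ) (one_covector_eta fun _ => z)
      have h4 : evalC (w.shear σ) r s = w.shear σ ![r] + Complex.I * w.shear σ ![s] := by
        rw [evalC, one_covector_eta fun _ => r, one_covector_eta fun _ => s]
      have h5 : evalC (0 : E [⋀^Fin 1]→L[ℝ] ℂ) w.re w.im = 0 := by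
        simp [evalC]
      rw [h3, h3, h3, h3] at h2
      rw [h5, add_zero] at h1
      have h6 : evalC (w.shear σ) r s = 0 := h1
      linear_combination h6 - h2 - h4

/-- The spinor `e^σ ∧ θ` has real rank zero if the imaginary part of `σ` is nondegenerate on the
kernel of `θ`. -/
theorem hasRealRankZero_expWedge {σ : E [⋀^Fin 2]→L[ℝ] ℂ} {θ : E →L[ℝ] ℂ}
    (hθ : Function.Surjective θ)
    (hσ : ∀ u, θ u = 0 → (∀ v, θ v = 0 → (σ ![u, v]).im = 0) → u = 0) :
    HasRealRankZero (expWedge σ (oneSpinor θ)) := by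
  intro a ha hb
  rw [mem_nullSpace_expWedge_iff] at ha hb
  obtain ⟨ha1, ha2⟩ := ha
  obtain ⟨hb1, hb2⟩ := hb
  obtain ⟨e, he⟩ := hθ 1
  -- `θ` vanishes on `Y` and on its conjugate, hence on the real and imaginary parts of `Y`
  obtain ⟨e', he'⟩ := hθ Complex.I
  have hb1' : θ a.re - Complex.I * θ a.im = 0 := by
    rw [← hb1, GenVec.conj]
    simp [sub_eq_add_neg]
  have hre : θ a.re = 0 := by linear_combination (ha1 + hb1') / 2
  have him : θ a.im = 0 := by
    have : Complex.I * θ a.im = 0 := by linear_combination (ha1 - hb1') / 2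
    exact (mul_eq_zero.1 this).resolve_left Complex.I_ne_zero
  have hneg : ∀ u v : E, σ ![-u, v] = -σ ![u, v] := fun u v => by
    have h := σ.curryLeft.map_neg u
    exact congrArg (fun f => f ![v]) h
  have hconj : ∀ v, a.conj.shear σ ![v] =
      σ ![a.re, v] - Complex.I * σ ![a.im, v] + starRingEnd ℂ (a.form ![v]) := fun v => by
    rw [GenVec.shear_apply]
    simp only [GenVec.conj, Matrix.cons_val_zero, hneg, mul_neg, ← sub_eq_add_neg]
    rfl
  -- on the kernel of `θ`, both sheared covectors `ι_Y σ + ξ` and `ι_(conj Y) σ + conj ξ` vanish;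
  -- taking the conjugate of one of them eliminates `ξ`
  have key : ∀ v, θ v = 0 →
      (σ ![a.re, v]).im = 0 ∧ (σ ![a.im, v]).im = 0 := fun v hv => by
    have h1 := ha2 v e
    have h2 := hb2 v e
    rw [he, hv, mul_one, zero_mul] at h1 h2
    rw [GenVec.shear_apply] at h1
    rw [hconj] at h2
    simp only [Matrix.cons_val_zero] at h1
    have r1 := congrArg Complex.re h1
    have i1 := congrArg Complex.im h1
    have r2 := congrArg Complex.re h2
    have i2 := congrArg Complex.im h2
    simp at r1 i1 r2 i2
    constructor <;> linarith
  have hre0 := hσ _ hre fun v hv => (key v hv).1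
  have him0 := hσ _ him fun v hv => (key v hv).2
  refine ⟨hre0, him0, ?_⟩
  -- now `ξ` and its conjugate are both multiples of `θ`, so that `ξ` has types `(1, 0)` and
  -- `(0, 1)`
  have hz : ∀ u : E, σ ![0, u] = 0 := fun u => σ.map_coord_zero (m := ![0, u]) 0 rfl
  have hs : ∀ v, a.shear σ ![v] = a.form ![v] := fun v => by
    rw [GenVec.shear_apply, hre0, him0]
    simp [hz]
  have hs' : ∀ v, a.conj.shear σ ![v] = starRingEnd ℂ (a.form ![v]) := fun v => by
    rw [hconj, hre0, him0]
    simp [hz]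
  have h1 := ha2 e' e
  have h2 := hb2 e' e
  rw [hs, hs, he, he'] at h1
  rw [hs', hs', he, he'] at h2
  have h3 : a.form ![e] = 0 := by
    have r1 := congrArg Complex.re h1
    have i1 := congrArg Complex.im h1
    have r2 := congrArg Complex.re h2
    have i2 := congrArg Complex.im h2
    simp at r1 i1 r2 i2
    apply Complex.ext <;> simp <;> linarith
  ext v
  have h4 := ha2 (v 0) e
  rw [hs, hs, he, h3, mul_one, mul_zero] at h4
  rw [one_covector_eta v, h4]
  rfl

end Pure

/-! ### Charts of Riemann surfaces -/

section RiemannSurface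
variable {B : Type*} [TopologicalSpace B] [ChartedSpace ℂ B] [IsManifold 𝓘(ℂ, ℂ) ω B]

/-- The transition maps of a Riemann surface are holomorphic. -/
theorem contDiffOn_transition {e e' : OpenPartialHomeomorph B ℂ} (he : e ∈ atlas ℂ B)
    (he' : e' ∈ atlas ℂ B) : ContDiffOn ℂ ω (e.symm ≫ₕ e') (e.symm ≫ₕ e').source :=
  (contMDiffOn_of_mem_contDiffGroupoid (I := 𝓘(ℂ, ℂ)) (n := ω)
    (HasGroupoid.compatible he he')).contDiffOn

variable (B) in
/-- A Riemann surface is a real smooth manifold. -/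
theorem isManifold_real : IsManifold 𝓘(ℝ, ℂ) ∞ B := by
  refine isManifold_of_contDiffOn 𝓘(ℝ, ℂ) ∞ B fun e e' he he' => ?_
  have h := ((contDiffOn_transition he he').restrict_scalars ℝ).of_le (m := ∞) le_top
  simpa using h

/-- Charts of a Riemann surface have nonzero complex linear derivatives. -/
theorem exists_deriv_chart_eq [IsManifold 𝓘(ℝ, ℂ) ∞ B] {b₀ b : B}
    (hb : b ∈ (chartAt ℂ b₀).source) :
    ∃ c : ℂ, c ≠ 0 ∧ ∀ z, (deriv' (chartAt ℂ b₀) b : ℂ →L[ℝ] ℂ) z = c * z := by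
  set e := chartAt ℂ b with he
  have hmem : chartAt ℂ b b ∈ (e.symm ≫ₕ chartAt ℂ b₀).source := by
    rw [OpenPartialHomeomorph.trans_source]
    refine ⟨mem_chart_target ℂ b, ?_⟩
    rw [Set.mem_preimage, e.left_inv (mem_chart_source ℂ b)]
    exact hb
  have hC : DifferentiableAt ℂ (e.symm ≫ₕ chartAt ℂ b₀) (e b) :=
    ((contDiffOn_transition (chart_mem_atlas ℂ b) (chart_mem_atlas ℂ b₀)).contDiffAt
      ((e.symm ≫ₕ chartAt ℂ b₀).open_source.mem_nhds hmem)).differentiableAt (by simp)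
  have h1 : (deriv' (chartAt ℂ b₀) b : ℂ →L[ℝ] ℂ) =
      fderiv ℝ (e.symm ≫ₕ chartAt ℂ b₀) (e b) := by
    rw [deriv', (mdiff_chart (E := ℂ) b₀ hb).mfderiv]
    simp [writtenInExtChartAt, extChartAt, he]
    rfl
  have h2 := (hC.hasFDerivAt.restrictScalars ℝ).fderiv
  have h3 : ∀ z, (deriv' (chartAt ℂ b₀) b : ℂ →L[ℝ] ℂ) z =
      fderiv ℂ (e.symm ≫ₕ chartAt ℂ b₀) (e b) 1 * z := by
    intro z
    rw [h1, h2, ContinuousLinearMap.coe_restrictScalars', mul_comm, ← smul_eq_mul, ← map_smul,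
      smul_eq_mul, mul_one]
  refine ⟨_, fun h0 => ?_, h3⟩
  have h4 := congrArg (fun f => f (1 : ℂ)) (deriv_chart_symm_comp_deriv_chart hb)
  rw [ContinuousLinearMap.comp_apply, h3, h0, zero_mul, map_zero] at h4
  exact zero_ne_one h4

end RiemannSurface

/-! ### The projection of a smooth symplectic family -/

section Family
variable {E : Type*} [NormedAddCommGroup E] [NormedSpace ℝ E]
  {X : Type*} [TopologicalSpace X] [ChartedSpace E X]
  {G : Type*} [NormedAddCommGroup G] [NormedSpace ℝ G]
  {F : Type*} [TopologicalSpace F] [ChartedSpace G F]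
  {B : Type*} [TopologicalSpace B] [ChartedSpace ℂ B] {π : X → B}

theorem IsSmoothTrivialization.contMDiffOn_proj {e : Bundle.Trivialization F π}
    (he : IsSmoothTrivialization (E := E) (G := G) e) :
    ContMDiffOn 𝓘(ℝ, E) 𝓘(ℝ, ℂ) ∞ π e.source := by
  refine (contMDiff_fst.comp_contMDiffOn he.1).congr fun x hx => ?_
  exact (e.coe_fst hx).symm

variable {P : PoissonStructure E X}

theorem IsSmoothSymplecticFamily.contMDiff (h : IsSmoothSymplecticFamily G F π P) :
    ContMDiff 𝓘(ℝ, E) 𝓘(ℝ, ℂ) ∞ π := fun x => by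
  obtain ⟨e, he, hs⟩ := h.trivial (π x)
  exact hs.contMDiffOn_proj.contMDiffAt (e.open_source.mem_nhds (e.mem_source.2 he))

/-- The projection of a family is a submersion, as it has local sections. -/
theorem IsSmoothSymplecticFamily.surjective_deriv (h : IsSmoothSymplecticFamily G F π P) (x : X) :
    Function.Surjective (deriv' π x : E →L[ℝ] ℂ) := by
  obtain ⟨e, he, hs⟩ := h.trivial (π x)
  have hx : x ∈ e.source := e.mem_source.2 he
  -- the local section through `x` that is constant in the trivialization
  set s : B → X := fun b => e.toOpenPartialHomeomorph.symm (b, (e x).2) with hsdef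
  have hex : ((π x, (e x).2) : B × F) = e x := Prod.ext (e.coe_fst hx).symm rfl
  have hsx : s (π x) = x := by
    rw [hsdef]
    simp only [hex]
    exact e.toOpenPartialHomeomorph.left_inv hx
  have hsm : MDifferentiableAt 𝓘(ℝ, ℂ) 𝓘(ℝ, E) s (π x) := by
    have h1 : ContMDiffAt (𝓘(ℝ, ℂ).prod 𝓘(ℝ, G)) 𝓘(ℝ, E) ∞ e.toOpenPartialHomeomorph.symm
        (π x, (e x).2) := by
      rw [hex]
      exact hs.2.contMDiffAt (e.open_target.mem_nhds (e.map_source hx))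
    have h2 : ContMDiffAt 𝓘(ℝ, ℂ) (𝓘(ℝ, ℂ).prod 𝓘(ℝ, G)) ∞ (fun b : B => (b, (e x).2)) (π x) :=
      contMDiffAt_id.prodMk contMDiffAt_const
    exact (h1.comp (π x) h2).mdifferentiableAt (by simp)
  have hπ : MDifferentiableAt 𝓘(ℝ, E) 𝓘(ℝ, ℂ) π (s (π x)) :=
    (h.contMDiff _).mdifferentiableAt (by simp)
  have hid : (fun b => π (s b)) =ᶠ[𝓝 (π x)] id := by
    filter_upwards [e.open_baseSet.mem_nhds he] with b hb
    exact e.proj_symm_apply' hb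
  have hcomp := mfderiv_comp (π x) hπ hsm
  rw [show π ∘ s = fun b => π (s b) from rfl, hid.mfderiv_eq, mfderiv_id] at hcomp
  intro c
  refine ⟨(deriv' s (π x) : ℂ →L[ℝ] E) c, ?_⟩
  have h3 := congrArg (fun f : ℂ →L[ℝ] ℂ => f c) hcomp
  rw [hsx] at h3
  exact h3.symm

/-- The leafwise symplectic form is nondegenerate: if `u = P ξ` is in its kernel, then
`f(P ξ) = -ξ(P f) = 0` for all covectors `f`. -/
theorem IsSmoothSymplecticFamily.eq_zero_of_isLeafForm (h : IsSmoothSymplecticFamily G F π P)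
    {x : X} {w : E [⋀^Fin 2]→L[ℝ] ℝ} (hw : P.IsLeafForm x w) {u : E}
    (hu : (deriv' π x : E →L[ℝ] ℂ) u = 0)
    (huv : ∀ v, (deriv' π x : E →L[ℝ] ℂ) v = 0 → w ![u, v] = 0) : u = 0 := by
  obtain ⟨ξ, rfl⟩ := (h.range_eq x u).2 hu
  by_contra hne
  obtain ⟨f, hf⟩ := SeparatingDual.exists_ne_zero (R := ℝ) hne
  refine hf ?_
  rw [P.skew, ← hw ξ f, huv _ ((h.range_eq x _).1 ⟨f, rfl⟩), neg_zero]

/-- Whether a `2`-covector extends the leafwise symplectic form depends only on its values on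
vertical vectors. -/
theorem IsSmoothSymplecticFamily.isLeafForm_congr (h : IsSmoothSymplecticFamily G F π P)
    {x : X} {w w' : E [⋀^Fin 2]→L[ℝ] ℝ} (hw : P.IsLeafForm x w)
    (hww' : ∀ u v, (deriv' π x : E →L[ℝ] ℂ) u = 0 → (deriv' π x : E →L[ℝ] ℂ) v = 0 →
      w' ![u, v] = w ![u, v]) : P.IsLeafForm x w' := fun ξ η => by
  rw [hww' _ _ ((h.range_eq x _).1 ⟨ξ, rfl⟩) ((h.range_eq x _).1 ⟨η, rfl⟩), hw]

/-- The local coordinate `z ∘ π` on the total space, for the chart `z` of the base at `b`. -/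
def baseCoord (π : X → B) (b : B) (x : X) : ℂ := chartAt ℂ b (π x)

/-- The domain of `baseCoord π b`. -/
def baseDomain (π : X → B) (b : B) : Set X := π ⁻¹' (chartAt ℂ b).source

theorem isOpen_baseDomain (hπ : ContMDiff 𝓘(ℝ, E) 𝓘(ℝ, ℂ) ∞ π) (b : B) : IsOpen (baseDomain π b) :=
  (chartAt ℂ b).open_source.preimage hπ.continuous

variable [IsManifold 𝓘(ℝ, ℂ) ∞ B]

theorem contMDiffAt_baseCoord (hπ : ContMDiff 𝓘(ℝ, E) 𝓘(ℝ, ℂ) ∞ π) {b : B} {x : X}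
    (hx : x ∈ baseDomain π b) :
    ContMDiffAt 𝓘(ℝ, E) 𝓘(ℝ, ℂ) ∞ (baseCoord π b) x :=
  ContMDiffAt.comp x ((contMDiffOn_chart (I := 𝓘(ℝ, ℂ)) (n := ∞) (x := b) _ hx).contMDiffAt
    ((chartAt ℂ b).open_source.mem_nhds hx)) (hπ x)

/-- The differentials of the local coordinates of the base are nonzero complex multiples of `dπ`,
which is read in the preferred chart at each point and need not be closed. -/
theorem exists_deriv_baseCoord_eq [IsManifold 𝓘(ℂ, ℂ) ω B]
    (hπ : ContMDiff 𝓘(ℝ, E) 𝓘(ℝ, ℂ) ∞ π) {b : B} {x : X}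
    (hx : x ∈ baseDomain π b) :
    ∃ c : ℂ, c ≠ 0 ∧ (deriv' (baseCoord π b) x : E →L[ℝ] ℂ) = c • (deriv' π x : E →L[ℝ] ℂ) := by
  obtain ⟨c, hc, h⟩ := exists_deriv_chart_eq hx
  refine ⟨c, hc, ?_⟩
  have h1 : mfderiv 𝓘(ℝ, E) 𝓘(ℝ, ℂ) (baseCoord π b) x =
      (mfderiv 𝓘(ℝ, ℂ) 𝓘(ℝ, ℂ) (chartAt ℂ b) (π x)).comp (mfderiv 𝓘(ℝ, E) 𝓘(ℝ, ℂ) π x) :=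
    mfderiv_comp x (mdiff_chart b hx) ((hπ x).mdifferentiableAt (by simp))
  ext v
  exact (congrArg (fun f : E →L[ℝ] ℂ => f v) h1).trans (h _)

end Family

/-! ### The line spanned by the exponential of a two-form -/

section Line
variable {E : Type*} [NormedAddCommGroup E] [NormedSpace ℝ E]

theorem oneForm_smul (c : ℂ) (θ : E →L[ℝ] ℂ) : oneForm (c • θ) = c • oneForm θ := by
  ext v; rfl

theorem oneSpinor_smul (c : ℂ) (θ : E →L[ℝ] ℂ) : oneSpinor (c • θ) = c • oneSpinor θ := by
  rw [oneSpinor, oneForm_smul]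
  exact homogSpinor_smul c _

theorem oneSpinor_one (θ : E →L[ℝ] ℂ) : oneSpinor θ 1 = oneForm θ := Pi.single_eq_same _ _

theorem oneSpinor_of_ne {k : ℕ} (hk : k ≠ 1) (θ : E →L[ℝ] ℂ) : oneSpinor θ k = 0 :=
  Pi.single_eq_of_ne hk _

theorem expWedge_oneSpinor_one (σ : E [⋀^Fin 2]→L[ℝ] ℂ) (θ : E →L[ℝ] ℂ) :
    expWedge σ (oneSpinor θ) 1 = oneForm θ := by
  rw [expWedge_apply_of_lowest σ (k := 1) (fun l hl => oneSpinor_of_ne hl.ne θ) (by norm_num),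
    oneSpinor_one]

theorem oneForm_ne_zero {θ : E →L[ℝ] ℂ} (hθ : Function.Surjective θ) : oneForm θ ≠ 0 := by
  obtain ⟨e, he⟩ := hθ 1
  intro h
  have := congrArg (fun f => f ![e]) h
  simp [he] at this

theorem expWedge_oneSpinor_ne_zero (σ : E [⋀^Fin 2]→L[ℝ] ℂ) {θ : E →L[ℝ] ℂ}
    (hθ : Function.Surjective θ) : expWedge σ (oneSpinor θ) ≠ 0 := fun h =>
  oneForm_ne_zero hθ (by rw [← expWedge_oneSpinor_one σ θ, h]; rfl)

theorem surjective_smul {c : ℂ} (hc : c ≠ 0) {θ : E →L[ℝ] ℂ} (hθ : Function.Surjective θ) :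
    Function.Surjective (c • θ : E →L[ℝ] ℂ) := fun z => by
  obtain ⟨v, hv⟩ := hθ (c⁻¹ * z)
  exact ⟨v, by rw [_root_.smul_apply, hv, smul_eq_mul, mul_inv_cancel_left₀ hc]⟩

variable {X : Type*} [TopologicalSpace X] [ChartedSpace E X]
  {B : Type*} [TopologicalSpace B] [ChartedSpace ℂ B] {π : X → B}

/-- The line `κ_I` is spanned by `dπ`. -/
theorem mem_transverseLine_iff {x : X} {ρ : Spinor E} :
    ρ ∈ transverseLine π x ↔ ∃ c : ℂ, c • oneSpinor (deriv' π x : E →L[ℝ] ℂ) = ρ := by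
  constructor
  · rintro ⟨L, rfl⟩
    refine ⟨L 1, ?_⟩
    rw [← oneSpinor_smul]
    refine congrArg oneSpinor ?_
    ext v
    change L 1 * _ = L ((deriv' π x : E →L[ℝ] ℂ) v)
    rw [mul_comm, ← smul_eq_mul, ← map_smul, smul_eq_mul, mul_one]
    rfl
  · rintro ⟨c, rfl⟩
    refine ⟨c • ContinuousLinearMap.id ℂ ℂ, ?_⟩
    rw [← oneSpinor_smul]
    rfl

/-- The line `e^σ ∧ κ_I` is spanned by `e^σ ∧ dπ`. -/
theorem image_transverseLine (σ : E [⋀^Fin 2]→L[ℝ] ℂ) (x : X) :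
    expWedge σ '' transverseLine π x =
      (Submodule.span ℂ {expWedge σ (oneSpinor (deriv' π x : E →L[ℝ] ℂ))} : Set (Spinor E)) := by
  ext ρ
  rw [SetLike.mem_coe, Submodule.mem_span_singleton]
  constructor
  · rintro ⟨τ, hτ, rfl⟩
    obtain ⟨c, rfl⟩ := mem_transverseLine_iff.1 hτ
    exact ⟨c, (expWedge_smul _ _ _).symm⟩
  · rintro ⟨c, rfl⟩
    exact ⟨_, mem_transverseLine_iff.2 ⟨c, rfl⟩, expWedge_smul _ _ _⟩

theorem isPure_of_mem_line {σ : E [⋀^Fin 2]→L[ℝ] ℂ} {θ : E →L[ℝ] ℂ}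
    (hθ : Function.Surjective θ) {ρ : Spinor E}
    (hρ : ρ ∈ Submodule.span ℂ {expWedge σ (oneSpinor θ)}) (h0 : ρ ≠ 0) : IsPure ρ := by
  obtain ⟨c, rfl⟩ := Submodule.mem_span_singleton.1 hρ
  have hc : c ≠ 0 := fun h => h0 (by rw [h, zero_smul])
  rw [← expWedge_smul, ← oneSpinor_smul]
  exact isPure_expWedge _ (surjective_smul hc hθ)

theorem hasRealRankZero_of_mem_line {σ : E [⋀^Fin 2]→L[ℝ] ℂ} {θ : E →L[ℝ] ℂ}
    (hθ : Function.Surjective θ)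
    (hσ : ∀ u, θ u = 0 → (∀ v, θ v = 0 → (σ ![u, v]).im = 0) → u = 0) {ρ : Spinor E}
    (hρ : ρ ∈ Submodule.span ℂ {expWedge σ (oneSpinor θ)}) (h0 : ρ ≠ 0) : HasRealRankZero ρ := by
  obtain ⟨c, rfl⟩ := Submodule.mem_span_singleton.1 hρ
  have hc : c ≠ 0 := fun h => h0 (by rw [h, zero_smul])
  rw [← expWedge_smul, ← oneSpinor_smul]
  have hk : ∀ u, (c • θ) u = 0 ↔ θ u = 0 := fun u => by
    rw [_root_.smul_apply, smul_eq_zero]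
    exact or_iff_right hc
  refine hasRealRankZero_expWedge (surjective_smul hc hθ) fun u hu hv => ?_
  exact hσ u ((hk u).1 hu) fun v h => hv v ((hk v).2 h)

end Line

/-! ### Sections of the canonical line -/

section Sections
variable {E : Type*} [NormedAddCommGroup E] [NormedSpace ℝ E]
  {X : Type*} [TopologicalSpace X] [ChartedSpace E X] [IsManifold 𝓘(ℝ, E) ∞ X]

section Exact
variable {g : X → ℂ} {U : Set X} {x : X}

theorem oneForm_deriv_eventuallyEq (hU : IsOpen U)
    (hg : ∀ x ∈ U, ContMDiffAt 𝓘(ℝ, E) 𝓘(ℝ, ℂ) ∞ g x) (hx : x ∈ U) :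
    (fun z => oneForm (deriv' g z : E →L[ℝ] ℂ)) =ᶠ[𝓝 x]
      extD fun z => ContinuousAlternatingMap.constOfIsEmpty ℝ E (Fin 0) (g z) := by
  filter_upwards [hU.mem_nhds hx] with z hz
  exact (extD_constOfIsEmpty ((hg z hz).mdifferentiableAt (by simp))).symm

theorem smoothFormOn_constOfIsEmpty (hU : IsOpen U)
    (hg : ∀ x ∈ U, ContMDiffAt 𝓘(ℝ, E) 𝓘(ℝ, ℂ) ∞ g x) :
    SmoothFormOn (fun z => ContinuousAlternatingMap.constOfIsEmpty ℝ E (Fin 0) (g z)) U :=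
  (smoothFormOn_iff hU).2 fun z hz => smoothFormAt_constOfIsEmpty (hg z hz)

theorem smoothFormAt_oneForm_deriv (hU : IsOpen U)
    (hg : ∀ x ∈ U, ContMDiffAt 𝓘(ℝ, E) 𝓘(ℝ, ℂ) ∞ g x) (hx : x ∈ U) :
    SmoothFormAt (fun z => oneForm (deriv' g z : E →L[ℝ] ℂ)) x :=
  (((smoothFormOn_constOfIsEmpty hU hg).extD hU).smoothFormAt hU hx).congr
    (oneForm_deriv_eventuallyEq hU hg hx)

theorem smoothFormAt_oneSpinor_deriv (hU : IsOpen U)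
    (hg : ∀ x ∈ U, ContMDiffAt 𝓘(ℝ, E) 𝓘(ℝ, ℂ) ∞ g x) (hx : x ∈ U) (k : ℕ) :
    SmoothFormAt (fun z => oneSpinor (deriv' g z : E →L[ℝ] ℂ) k) x := by
  by_cases hk : k = 1
  · subst hk
    simp only [oneSpinor_one]
    exact smoothFormAt_oneForm_deriv hU hg hx
  · simp only [oneSpinor_of_ne hk]
    exact smoothFormAt_zero x

/-- `d (dg) = 0`. -/
theorem extDSpinor_oneSpinor_deriv (hU : IsOpen U)
    (hg : ∀ x ∈ U, ContMDiffAt 𝓘(ℝ, E) 𝓘(ℝ, ℂ) ∞ g x) (hx : x ∈ U) :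
    extDSpinor (fun z => oneSpinor (deriv' g z : E →L[ℝ] ℂ)) x = 0 := by
  funext k
  cases k with
  | zero => rfl
  | succ k =>
    change extD (fun z => oneSpinor (deriv' g z : E →L[ℝ] ℂ) k) x = 0
    by_cases hk : k = 1
    · subst hk
      simp only [oneSpinor_one]
      rw [extD_congr (oneForm_deriv_eventuallyEq hU hg hx)]
      exact extD_extD hU (smoothFormOn_constOfIsEmpty hU hg) hx
    · simp only [oneSpinor_of_ne hk]
      exact extD_zero x

end Exact

/-- The ratio of two proportional smooth forms is smooth where the denominator does not vanish. -/
theorem contMDiffAt_of_eventually_eq_smul {k : ℕ} {α β : X → E [⋀^Fin k]→L[ℝ] ℂ} {f : X → ℂ}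
    {x : X} (hα : SmoothFormAt α x) (hβ : SmoothFormAt β x) (h : ∀ᶠ z in 𝓝 x, α z = f z • β z)
    (h0 : β x ≠ 0) : ContMDiffAt 𝓘(ℝ, E) 𝓘(ℝ, ℂ) ∞ f x := by
  have hx := mem_chart_source E x
  refine contMDiffAt_of_comp_chart_symm ?_
  -- near `x`, the function is the quotient of the values of both forms on a fixed tuple of vectors
  obtain ⟨v, hv⟩ : ∃ v, inChart β x (chartAt E x x) v ≠ 0 := by
    by_contra! hcon
    refine h0 ?_
    rw [← inChart_compContinuousLinearMap β hx]
    ext v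
    exact hcon _
  have hev : ∀ {γ : X → E [⋀^Fin k]→L[ℝ] ℂ}, SmoothFormAt γ x →
      ContDiffAt ℝ ∞ (fun y => inChart γ x y v) (chartAt E x x) := fun hγ =>
    (ContinuousAlternatingMap.apply ℝ E ℂ v).contDiff.contDiffAt.comp _ (hγ x hx)
  refine ((hev hα).mul ((hev hβ).inv hv)).congr_of_eventuallyEq ?_
  have hcont := (hev hβ).continuousAt.eventually_ne hv
  have hback : Filter.Tendsto (chartAt E x).symm (𝓝 (chartAt E x x)) (𝓝 x) := by
    have := (chartAt E x).continuousAt_symm (mem_chart_target E x)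
    rwa [ContinuousAt, (chartAt E x).left_inv hx] at this
  filter_upwards [hcont, hback.eventually h] with y hy hy'
  rw [Pi.inv_apply, eq_mul_inv_iff_mul_eq₀ hy]
  have : inChart α x y v = (f ((chartAt E x).symm y) • inChart β x y) v := by
    rw [inChart, hy']
    rfl
  rw [this]
  rfl

variable [FiniteDimensional ℝ E]

/-- A section `f e^σ ∧ dg` satisfies `d_H ρ = (df / f) ∧ ρ`, if `(dσ + H) ∧ dg = 0`. -/
theorem dTwisted_section {H : X → E [⋀^Fin 3]→L[ℝ] ℝ} {σ : X → E [⋀^Fin 2]→L[ℝ] ℂ} {g f : X → ℂ}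
    {ρ : X → Spinor E} {U : Set X} (hU : IsOpen U)
    (hg : ∀ x ∈ U, ContMDiffAt 𝓘(ℝ, E) 𝓘(ℝ, ℂ) ∞ g x) {x : X} (hx : x ∈ U)
    (hσ : SmoothFormAt σ x) (hf : ContMDiffAt 𝓘(ℝ, E) 𝓘(ℝ, ℂ) ∞ f x) (hf0 : f x ≠ 0)
    (hρ : ∀ᶠ z in 𝓝 x, ρ z = f z • expWedge (σ z) (oneSpinor (deriv' g z : E →L[ℝ] ℂ)))
    (hK : wedgeSpinor (extD σ x + toC (H x)) (oneSpinor (deriv' g x : E →L[ℝ] ℂ)) = 0) :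
    dTwisted H ρ x = wedgeSpinor ((f x)⁻¹ • oneForm (deriv' f x : E →L[ℝ] ℂ)) (ρ x) := by
  -- the function `f` as a form of degree zero, so that the Leibniz rule applies
  set c : X → E [⋀^Fin 0]→L[ℝ] ℂ := fun z => ContinuousAlternatingMap.constOfIsEmpty ℝ E (Fin 0) (f z)
    with hc
  have hcs : SmoothFormAt c x := smoothFormAt_constOfIsEmpty hf
  have hdg := smoothFormAt_oneSpinor_deriv hU hg hx
  have hcz : ∀ z ρ', wedgeSpinor (c z) ρ' = f z • ρ' := fun z ρ' => wedgeSpinor_zero_degree _ _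
  have hρ' : ρ =ᶠ[𝓝 x] fun z => expWedge (σ z)
      (wedgeSpinor (c z) (oneSpinor (deriv' g z : E →L[ℝ] ℂ))) := by
    filter_upwards [hρ] with z hz
    rw [hz, hcz, expWedge_smul]
  have h1 : dTwisted H ρ x = dTwisted H (fun z => expWedge (σ z)
      (wedgeSpinor (c z) (oneSpinor (deriv' g z : E →L[ℝ] ℂ)))) x := by
    rw [dTwisted_eq, dTwisted_eq, extDSpinor_congr hρ', hρ'.self_of_nhds]
  rw [h1, dTwisted_expWedge H hσ fun k => hcs.wedgeSpinor hdg k, extDSpinor_wedgeSpinor hcs hdg,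
    extDSpinor_oneSpinor_deriv hU hg hx, wedgeSpinor_zero, smul_zero, add_zero, hcz,
    wedgeSpinor_smul, hK, smul_zero, add_zero, expWedge_wedgeSpinor, hρ.self_of_nhds, hc,
    extD_constOfIsEmpty (hf.mdifferentiableAt (by simp)), wedgeSpinor_smul, smul_wedgeSpinor,
    smul_smul, mul_inv_cancel₀ hf0, one_smul]
  rfl

end Sections

/-- A linear map that takes the same value at all the points in an average takes that value at the
average. -/
theorem map_finsum_smul_of_forall_eq {ι A C : Type*} [AddCommGroup A] [Module ℝ A]
    [AddCommGroup C] [Module ℝ C] (T : A →ₗ[ℝ] C) {t : ι → ℝ} (hfin : t.support.Finite)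
    (hsum : ∑ᶠ i, t i = 1) {α : ι → A} {c : C} (h : ∀ i, t i ≠ 0 → T (α i) = c) :
    T (∑ᶠ i, t i • α i) = c := by
  have hfin' : (Function.support fun i => t i • α i).Finite :=
    hfin.subset fun i hi => left_ne_zero_of_smul hi
  rw [show T (∑ᶠ i, t i • α i) = T.toAddMonoidHom (∑ᶠ i, t i • α i) from rfl,
    AddMonoidHom.map_finsum _ hfin']
  have h1 : ∀ i, T.toAddMonoidHom (t i • α i) = t i • c := fun i => by
    change T (t i • α i) = _
    rw [map_smul]
    by_cases hi : t i = 0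
    · rw [hi, zero_smul, zero_smul]
    · rw [h i hi]
  rw [finsum_congr h1, ← finsum_smul, hsum, one_smul]

/-! ### Generalized complex structures from extensions of the symplectic form -/

section Existence
variable {E : Type*} [NormedAddCommGroup E] [NormedSpace ℝ E]
  {X : Type*} [TopologicalSpace X] [ChartedSpace E X]
  {G : Type*} [NormedAddCommGroup G] [NormedSpace ℝ G]
  {F : Type*} [TopologicalSpace F] [ChartedSpace G F]
  {B : Type*} [TopologicalSpace B] [ChartedSpace ℂ B]
  {π : X → B} {P : PoissonStructure E X}

theorem toC_apply {k : ℕ} (b : E [⋀^Fin k]→L[ℝ] ℝ) (v : Fin k → E) : toC b v = (b v : ℂ) := rfl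

theorem SmoothFormAt.toC {k : ℕ} {b : X → E [⋀^Fin k]→L[ℝ] ℝ} {x : X} (hb : SmoothFormAt b x) :
    SmoothFormAt (fun z => toC (b z)) x := hb.clm_comp Complex.ofRealCLM

theorem extD_toC [IsManifold 𝓘(ℝ, E) ∞ X] {k : ℕ} {b : X → E [⋀^Fin k]→L[ℝ] ℝ} {x : X}
    (hb : SmoothFormAt b x) : extD (fun z => toC (b z)) x = toC (extD b x) :=
  extD_clm_comp hb Complex.ofRealCLM

variable [FiniteDimensional ℝ E] [IsManifold 𝓘(ℝ, E) ∞ X] [IsManifold 𝓘(ℂ, ℂ) ω B]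

/-- The spinors `e^{i w} ∧ κ_I`, for a real extension `w` of the leafwise symplectic form. -/
def IsSmoothSymplecticFamily.almostGenCplx (h : IsSmoothSymplecticFamily G F π P)
    {w : X → E [⋀^Fin 2]→L[ℝ] ℝ} (hws : ∀ x, SmoothFormAt w x)
    (hw : ∀ x, P.IsLeafForm x (w x)) : AlmostGenCplx E X where
  line x := Submodule.span ℂ {expWedge (Complex.I • toC (w x)) (oneSpinor (deriv' π x))}
  smooth x₀ := by
    have := isManifold_real B
    have hU := isOpen_baseDomain h.contMDiff (π x₀)
    refine ⟨baseDomain π (π x₀),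
      fun x => expWedge (Complex.I • toC (w x)) (oneSpinor (deriv' (baseCoord π (π x₀)) x)),
      hU, mem_chart_source ℂ (π x₀), fun k => ?_, fun x hx => ?_⟩
    · rw [smoothFormOn_iff hU]
      intro x hx
      exact SmoothFormAt.expWedge (smoothFormAt_const_smul (hws x).toC _)
        (smoothFormAt_oneSpinor_deriv hU (fun z hz => contMDiffAt_baseCoord h.contMDiff hz) hx) k
    · obtain ⟨c, hc, hd⟩ := exists_deriv_baseCoord_eq h.contMDiff hx
      simp only [hd]
      refine ⟨expWedge_oneSpinor_ne_zero _ (surjective_smul hc (h.surjective_deriv x)), ?_⟩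
      rw [oneSpinor_smul, expWedge_smul]
      exact (Submodule.span_singleton_smul_eq (IsUnit.mk0 c hc) _).symm
  pure x ρ hρ h0 := isPure_of_mem_line (h.surjective_deriv x) hρ h0
  realRankZero x ρ hρ h0 := by
    refine hasRealRankZero_of_mem_line (h.surjective_deriv x) (fun u hu hv => ?_) hρ h0
    refine h.eq_zero_of_isLeafForm (hw x) hu fun v hv' => ?_
    have := hv v hv'
    rwa [ContinuousAlternatingMap.smul_apply, toC_apply, smul_eq_mul, Complex.I_mul_im,
      Complex.ofReal_re] at this

theorem IsSmoothSymplecticFamily.induces_almostGenCplx (h : IsSmoothSymplecticFamily G F π P)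
    {w : X → E [⋀^Fin 2]→L[ℝ] ℝ} (hws : ∀ x, SmoothFormAt w x)
    (hw : ∀ x, P.IsLeafForm x (w x)) : (h.almostGenCplx hws hw).Induces π P := by
  refine fun x => ⟨0, w x, hw x, ?_⟩
  rw [image_transverseLine]
  have : toC (0 : E [⋀^Fin 2]→L[ℝ] ℝ) = 0 := by
    ext v
    simp [toC_apply]
  rw [this, zero_add]
  rfl

variable [T2Space X] [SecondCountableTopology X]

/-- The structure `e^{i w} ∧ κ_I` is integrable if `(i dw + H) ∧ κ_I = 0`.  A section is locally of
the form `f_b e^{i w} ∧ d(z_b ∘ π)`, so that `d_H ρ = (df_b / f_b) ∧ ρ`; the sum of the covectors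
`df_b / f_b`, weighted by a partition of unity, is the covector `ξ` on the whole domain of the
section. -/
theorem IsSmoothSymplecticFamily.isIntegrable_almostGenCplx
    (h : IsSmoothSymplecticFamily G F π P)
    {w : X → E [⋀^Fin 2]→L[ℝ] ℝ} (hws : ∀ x, SmoothFormAt w x)
    (hw : ∀ x, P.IsLeafForm x (w x)) {H : X → E [⋀^Fin 3]→L[ℝ] ℝ}
    (hK : ∀ x, wedgeSpinor (Complex.I • toC (extD w x) + toC (H x))
      (oneSpinor (deriv' π x : E →L[ℝ] ℂ)) = 0) :
    (h.almostGenCplx hws hw).IsIntegrable H := by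
  intro U ρ hU hρs hρ
  have := isManifold_real B
  have hV := fun b => isOpen_baseDomain h.contMDiff b
  have hσ : ∀ x, SmoothFormAt (fun z => Complex.I • toC (w z)) x := fun x =>
    smoothFormAt_const_smul (hws x).toC _
  -- the coefficient of `ρ` with respect to the section `e^{i w} ∧ d(z ∘ π)`
  have hex : ∀ b x, x ∈ U → x ∈ baseDomain π b → ∃ c : ℂ, c ≠ 0 ∧
      ρ x = c • expWedge (Complex.I • toC (w x))
        (oneSpinor (deriv' (baseCoord π b) x : E →L[ℝ] ℂ)) := by
    intro b x hx hb
    obtain ⟨a, ha⟩ := Submodule.mem_span_singleton.1 (hρ x hx).1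
    obtain ⟨c, hc, hd⟩ := exists_deriv_baseCoord_eq h.contMDiff hb
    refine ⟨a * c⁻¹, mul_ne_zero (fun h0 => (hρ x hx).2 ?_) (inv_ne_zero hc), ?_⟩
    · rw [← ha, h0, zero_smul]
    · rw [← ha, hd, oneSpinor_smul, expWedge_smul, smul_smul, inv_mul_cancel_right₀ hc]
  choose! f hf0 hf using hex
  have hfs : ∀ b x, x ∈ U → x ∈ baseDomain π b → ContMDiffAt 𝓘(ℝ, E) 𝓘(ℝ, ℂ) ∞ (f b) x := by
    intro b x hx hb
    obtain ⟨c, hc, hd⟩ := exists_deriv_baseCoord_eq h.contMDiff hb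
    -- in degree one, the section is `f_b d(z_b ∘ π)`
    refine contMDiffAt_of_eventually_eq_smul ((hρs 1).smoothFormAt hU hx)
      (smoothFormAt_oneForm_deriv (hV b) (fun z hz => contMDiffAt_baseCoord h.contMDiff hz) hb)
      ?_ ?_
    · filter_upwards [hU.mem_nhds hx, (hV b).mem_nhds hb] with z hz hz'
      rw [hf b z hz hz', Pi.smul_apply, expWedge_oneSpinor_one]
    · rw [hd]
      exact oneForm_ne_zero (surjective_smul hc (h.surjective_deriv x))
  have hlocal : ∀ b x, x ∈ U → x ∈ baseDomain π b → dTwisted H ρ x =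
      wedgeSpinor ((f b x)⁻¹ • oneForm (deriv' (f b) x : E →L[ℝ] ℂ)) (ρ x) := by
    intro b x hx hb
    obtain ⟨c, hc, hd⟩ := exists_deriv_baseCoord_eq h.contMDiff hb
    refine dTwisted_section (hV b) (fun z hz => contMDiffAt_baseCoord h.contMDiff hz) hb (hσ x)
      (hfs b x hx hb) (hf0 b x hx hb) ?_ ?_
    · filter_upwards [hU.mem_nhds hx, (hV b).mem_nhds hb] with z hz hz'
      exact hf b z hz hz'
    · rw [hd, oneSpinor_smul, wedgeSpinor_smul, extD_const_smul (hws x).toC, extD_toC (hws x), hK x,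
        smul_zero]
  have : LocallyCompactSpace X := ChartedSpace.locallyCompactSpace E X
  obtain ⟨φ, hφ⟩ := SmoothPartitionOfUnity.exists_isSubordinate 𝓘(ℝ, E) (isClosed_univ (X := X))
    (baseDomain π) hV fun x _ => Set.mem_iUnion.2 ⟨π x, mem_chart_source ℂ (π x)⟩
  set ξ : X → E [⋀^Fin 1]→L[ℝ] ℂ := fun x =>
    ∑ᶠ b, φ b x • ((f b x)⁻¹ • oneForm (deriv' (f b) x : E →L[ℝ] ℂ)) with hξ
  have hzero : SmoothVectorFieldOn (fun _ : X => (0 : E)) U :=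
    (Bundle.contMDiff_zeroSection ℝ (TangentSpace 𝓘(ℝ, E) : X → Type _)).contMDiffOn
  -- no vector field is needed: `d_H ρ = ξ ∧ ρ`
  refine ⟨fun x => ⟨0, 0, ξ x⟩, hzero, hzero, ?_, fun x hx => ?_⟩
  · rw [smoothFormOn_iff hU]
    intro x hx
    refine smoothFormAt_finsum φ.locallyFinite (fun b => (φ b).contMDiff x) fun b hb => ?_
    have hb' := hφ b hb
    refine SmoothFormAt.complex_smul ?_ (smoothFormAt_oneForm_deriv ((hV b).inter hU)
      (fun z hz => hfs b z hz.2 hz.1) ⟨hb', hx⟩)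
    exact contMDiffAt_of_comp_chart_symm ((contDiffAt_comp_chart_symm (hfs b x hx hb')
      (mem_chart_source E x)).inv (by
        rw [(chartAt E x).left_inv (mem_chart_source E x)]; exact hf0 b x hx hb'))
  · have hact : (⟨0, 0, ξ x⟩ : GenVec E).act (ρ x) = wedgeSpinor (ξ x) (ρ x) := by
      funext k
      change (ρ x (k + 1)).curryLeft 0 + Complex.I • (ρ x (k + 1)).curryLeft 0 +
        wedgeSpinor (ξ x) (ρ x) k = _
      rw [map_zero, smul_zero, add_zero, zero_add]
    rw [hact]
    symm
    refine map_finsum_smul_of_forall_eq (((wedgeSpinorBilin (E := E) (a := 1)).flip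
      (ρ x)).restrictScalars ℝ) (φ.locallyFinite.point_finite x) (φ.sum_eq_one (Set.mem_univ x))
      fun b hb => ?_
    exact (hlocal b x hx (hφ b (subset_tsupport _ hb))).symm

/-- If an extension `w` of the leafwise symplectic form and a closed real `3`-form `H` satisfy
`(H + i dw) ∧ κ_I = 0`, then `e^{i w} ∧ κ_I` is a generalized complex structure. -/
theorem IsSmoothSymplecticFamily.isGeneralizedComplex
    (h : IsSmoothSymplecticFamily G F π P)
    {w : X → E [⋀^Fin 2]→L[ℝ] ℝ} (hws : ∀ x, SmoothFormAt w x)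
    (hw : ∀ x, P.IsLeafForm x (w x)) {H : X → E [⋀^Fin 3]→L[ℝ] ℝ} (hHs : ∀ x, SmoothFormAt H x)
    (hH : ∀ x, extD H x = 0)
    (hK : ∀ x, wedgeSpinor (Complex.I • toC (extD w x) + toC (H x))
      (oneSpinor (deriv' π x : E →L[ℝ] ℂ)) = 0) : IsGeneralizedComplex π P :=
  ⟨H, h.almostGenCplx hws hw, (smoothFormOn_iff isOpen_univ).2 fun x _ => hHs x, hH,
    h.isIntegrable_almostGenCplx hws hw hK, h.induces_almostGenCplx hws hw⟩

end Existence

/-! ### Types along the base -/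

section Types
variable {E : Type*} [NormedAddCommGroup E] [NormedSpace ℝ E]
  {X : Type*} [TopologicalSpace X] [ChartedSpace E X]
  {B : Type*} [TopologicalSpace B] [ChartedSpace ℂ B] {π : X → B}

theorem apply_eq_zero_of_mem_filt_three {n : ℕ} (hn : 2 ≤ n) {α : Omega E X 3}
    (hα : α ∈ filt π n 3) (x : X) {y y' : E} (hy : (deriv' π x : E →L[ℝ] ℂ) y = 0)
    (hy' : (deriv' π x : E →L[ℝ] ℂ) y' = 0) (a : E) : α.1 x ![y, y', a] = 0 :=
  hα x _ {0, 1} (fun i hi => by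
    rcases Finset.mem_insert.1 hi with rfl | hi
    · exact hy
    · rw [Finset.mem_singleton.1 hi]; exact hy') (by rw [Finset.card_pair (by decide)]; omega)

theorem apply_eq_zero_of_mem_filt_two {α : Omega E X 2} (hα : α ∈ filt π 1 2) (x : X) {y y' : E}
    (hy : (deriv' π x : E →L[ℝ] ℂ) y = 0) (hy' : (deriv' π x : E →L[ℝ] ℂ) y' = 0) :
    α.1 x ![y, y'] = 0 :=
  hα x _ {0, 1} (fun i hi => by
    rcases Finset.mem_insert.1 hi with rfl | hi
    · exact hy
    · rw [Finset.mem_singleton.1 hi]; exact hy') (by rw [Finset.card_pair (by decide)]; omega)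

/-- The type of a form in `F_1 Ω^3`, expressed by its values on two vertical arguments. -/
theorem apply_of_mem_typeForms_three {p q : ℕ} {α : Omega E X 3} (hα : α ∈ typeForms π p q 1 3)
    (x : X) {y y' a b : E} {l : ℂ} (hy : (deriv' π x : E →L[ℝ] ℂ) y = 0)
    (hy' : (deriv' π x : E →L[ℝ] ℂ) y' = 0)
    (hab : (deriv' π x : E →L[ℝ] ℂ) a = l * (deriv' π x : E →L[ℝ] ℂ) b) :
    α.1 x ![y, y', a] = l ^ p * (starRingEnd ℂ l) ^ q * α.1 x ![y, y', b] := by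
  refine hα.2 x l ![y, y', b] ![y, y', a] {0, 1} (by rw [Finset.card_pair (by decide)])
    (fun i hi => ?_) fun i hi => ?_
  · rcases Finset.mem_insert.1 hi with rfl | hi
    · exact ⟨hy, rfl⟩
    · rw [Finset.mem_singleton.1 hi]; exact ⟨hy', rfl⟩
  · fin_cases i
    · simp at hi
    · simp at hi
    · exact hab

/-- A `4`-form in `F_3` vanishes, as the base has real dimension two. -/
theorem eq_zero_of_mem_filt_three_four (hπ : ∀ x, Function.Surjective (deriv' π x : E →L[ℝ] ℂ))
    {α : Omega E X 4} (hα : α ∈ filt π 3 4) (x : X) : α.1 x = 0 := by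
  refine eq_zero_of_curryLeft_curryLeft_vertical (hπ x) fun y y' hy hy' => ?_
  ext v
  exact hα x (Matrix.vecCons y (Matrix.vecCons y' v)) {0, 1} (fun i hi => by
    rcases Finset.mem_insert.1 hi with rfl | hi
    · exact hy
    · rw [Finset.mem_singleton.1 hi]; exact hy') (by rw [Finset.card_pair (by decide)]; omega)

/-- A `4`-form of type `(0, 2)` along the base vanishes, as the base has complex dimension one. -/
theorem eq_zero_of_mem_typeForms_zero_two
    (hπ : ∀ x, Function.Surjective (deriv' π x : E →L[ℝ] ℂ))
    {α : Omega E X 4} (hα : α ∈ typeForms π 0 2 2 4) (x : X) : α.1 x = 0 := by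
  refine eq_zero_of_curryLeft_curryLeft_vertical (hπ x) fun y y' hy hy' => ?_
  obtain ⟨e₁, h₁⟩ := hπ x 1
  obtain ⟨e₂, h₂⟩ := hπ x Complex.I
  set τ := ((α.1 x).curryLeft y).curryLeft y' with hτ
  have hvert : ∀ z, (deriv' π x : E →L[ℝ] ℂ) z = 0 → τ.curryLeft z = 0 := fun z hz => by
    ext v
    refine hα.1 x (Matrix.vecCons y (Matrix.vecCons y' (Matrix.vecCons z v))) {0, 1, 2}
      (fun i hi => ?_) (by rw [Finset.card_eq_three.2 ⟨0, 1, 2, by decide, by decide, by decide, rfl⟩]; omega)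
    rcases Finset.mem_insert.1 hi with rfl | hi
    · exact hy
    rcases Finset.mem_insert.1 hi with rfl | hi
    · exact hy'
    · rw [Finset.mem_singleton.1 hi]; exact hz
  have hsame : ∀ w : E, (τ.curryLeft w).curryLeft w = 0 := τ.curryLeft_same
  have hv2 : ∀ w z, (deriv' π x : E →L[ℝ] ℂ) z = 0 → (τ.curryLeft w).curryLeft z = 0 :=
    fun w z hz => by
      rw [curryLeft_curryLeft_swap, hvert z hz]
      ext; simp
  -- multiplication by `i` along the base is a rotation, which preserves two-forms
  have h12 : τ ![e₁, e₂] = 0 := by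
    have h := hα.2 x Complex.I ![y, y', e₁, e₂] ![y, y', e₂, -e₁] {0, 1}
      (by rw [Finset.card_pair (by decide)]) (fun i hi => by
        rcases Finset.mem_insert.1 hi with rfl | hi
        · exact ⟨hy, rfl⟩
        · rw [Finset.mem_singleton.1 hi]; exact ⟨hy', rfl⟩) (fun i hi => by
        fin_cases i
        · simp at hi
        · simp at hi
        · simp [h₁, h₂]
        · simp [h₁, h₂])
    have h3 : τ ![e₂, -e₁] = τ ![e₁, e₂] := by
      rw [two_covector_swap]
      have h4 := congrArg (fun f => f ![e₂]) (τ.curryLeft.map_neg e₁)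
      change τ ![-e₁, e₂] = -τ ![e₁, e₂] at h4
      rw [h4, neg_neg]
    change τ ![e₂, -e₁] = _ * τ ![e₁, e₂] at h
    rw [h3] at h
    simp at h
    linear_combination h / 2
  have h12' : (τ.curryLeft e₁).curryLeft e₂ = 0 := by
    ext v
    obtain rfl : v = ![] := Subsingleton.elim _ _
    exact h12
  refine eq_zero_of_curryLeft_eq_zero h₁ h₂ ?_ ?_ hvert
  · exact eq_zero_of_curryLeft_eq_zero h₁ h₂ (hsame _) h12' (hv2 _)
  · refine eq_zero_of_curryLeft_eq_zero h₁ h₂ ?_ (hsame _) (hv2 _)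
    rw [curryLeft_curryLeft_swap, h12']
    ext; simp

/-- The real part of a complex covector. -/
def reForm {k : ℕ} (α : E [⋀^Fin k]→L[ℝ] ℂ) : E [⋀^Fin k]→L[ℝ] ℝ :=
  Complex.reCLM.compContinuousAlternatingMap α

/-- The imaginary part of a complex covector. -/
def imForm {k : ℕ} (α : E [⋀^Fin k]→L[ℝ] ℂ) : E [⋀^Fin k]→L[ℝ] ℝ :=
  Complex.imCLM.compContinuousAlternatingMap α

@[simp] theorem reForm_apply {k : ℕ} (α : E [⋀^Fin k]→L[ℝ] ℂ) (v : Fin k → E) :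
    reForm α v = (α v).re := rfl

@[simp] theorem imForm_apply {k : ℕ} (α : E [⋀^Fin k]→L[ℝ] ℂ) (v : Fin k → E) :
    imForm α v = (α v).im := rfl

theorem Omega.smoothFormAt {k : ℕ} (α : Omega E X k) (x : X) : SmoothFormAt α.1 x :=
  α.2.smoothFormAt isOpen_univ (Set.mem_univ x)

theorem FibCoh.mk_eq_mk_iff [IsManifold 𝓘(ℝ, E) ∞ X] {n m : ℕ} {α β : cocycles (E := E) π n m} :
    FibCoh.mk π n m α = FibCoh.mk π n m β ↔ α.1 - β.1 ∈ coboundaries (E := E) π n m :=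
  Submodule.Quotient.eq _

end Types

/-! ### Pluriharmonic classes give generalized complex structures -/

section Backward
variable {E : Type*} [NormedAddCommGroup E] [NormedSpace ℝ E] [FiniteDimensional ℝ E]
  {X : Type*} [TopologicalSpace X] [ChartedSpace E X] [IsManifold 𝓘(ℝ, E) ∞ X]
  [T2Space X] [SecondCountableTopology X]
  {G : Type*} [NormedAddCommGroup G] [NormedSpace ℝ G]
  {F : Type*} [TopologicalSpace F] [ChartedSpace G F]
  {B : Type*} [TopologicalSpace B] [ChartedSpace ℂ B] [IsManifold 𝓘(ℂ, ℂ) ω B]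
  {π : X → B} {P : PoissonStructure E X}

/-- Suppose that `a` extends the leafwise symplectic form and that `da = β + γ`, where `β` and `γ`
are closed and of type `(0, 1)` and `(1, 0)` on two vertical arguments.  Then `w = Re a` and
`H = Im β - Im γ` satisfy `H + i dw = i (conj β + γ)`, which has type `(1, 0)`. -/
theorem IsSmoothSymplecticFamily.isGeneralizedComplex_of_decomposition
    (h : IsSmoothSymplecticFamily G F π P) {a : Omega E X 2} {β γ : Omega E X 3}
    (ha : ∀ x, P.IsLeafForm x (reForm (a.1 x))) (hd : dOmega 2 a = β + γ)
    (hβ : dOmega 3 β = 0) (hγ : dOmega 3 γ = 0)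
    (hβt : ∀ (x : X) (y y' u v : E) (l : ℂ), (deriv' π x : E →L[ℝ] ℂ) y = 0 →
      (deriv' π x : E →L[ℝ] ℂ) y' = 0 →
      (deriv' π x : E →L[ℝ] ℂ) u = l * (deriv' π x : E →L[ℝ] ℂ) v →
      β.1 x ![y, y', u] = starRingEnd ℂ l * β.1 x ![y, y', v])
    (hγt : ∀ (x : X) (y y' u v : E) (l : ℂ), (deriv' π x : E →L[ℝ] ℂ) y = 0 →
      (deriv' π x : E →L[ℝ] ℂ) y' = 0 →
      (deriv' π x : E →L[ℝ] ℂ) u = l * (deriv' π x : E →L[ℝ] ℂ) v →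
      γ.1 x ![y, y', u] = l * γ.1 x ![y, y', v]) : IsGeneralizedComplex π P := by
  have hre : ∀ x, extD (fun z => reForm (a.1 z)) x = reForm (extD a.1 x) := fun x =>
    extD_clm_comp (a.smoothFormAt x) Complex.reCLM
  have him : ∀ {ζ : Omega E X 3} x, extD (fun z => imForm (ζ.1 z)) x = imForm (extD ζ.1 x) :=
    fun {ζ} x => extD_clm_comp (ζ.smoothFormAt x) Complex.imCLM
  have hims : ∀ {ζ : Omega E X 3} x, SmoothFormAt (fun z => imForm (ζ.1 z)) x :=
    fun {ζ} x => (ζ.smoothFormAt x).clm_comp Complex.imCLM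
  refine h.isGeneralizedComplex (w := fun x => reForm (a.1 x))
    (H := fun x => imForm (β.1 x) - imForm (γ.1 x))
    (fun x => (a.smoothFormAt x).clm_comp Complex.reCLM) ha
    (fun x => (hims x).sub (hims x)) (fun x => ?_) fun x => ?_
  · rw [extD_sub (hims x) (hims x), him, him]
    have h1 : extD β.1 x = 0 := congrArg (fun ζ : Omega E X 4 => ζ.1 x) hβ
    have h2 : extD γ.1 x = 0 := congrArg (fun ζ : Omega E X 4 => ζ.1 x) hγ
    rw [h1, h2, sub_self]
  · refine wedge_eq_zero_of_type (h.surjective_deriv x) fun u v l y y' huv hy hy' => ?_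
    have h1 : extD a.1 x = β.1 x + γ.1 x := congrArg (fun ζ : Omega E X 3 => ζ.1 x) hd
    have key : ∀ z, (Complex.I • toC (extD (fun z => reForm (a.1 z)) x) +
        toC (imForm (β.1 x) - imForm (γ.1 x))) ![y, y', z] =
        Complex.I * (starRingEnd ℂ (β.1 x ![y, y', z]) + γ.1 x ![y, y', z]) := fun z => by
      rw [hre, h1]
      simp only [ContinuousAlternatingMap.add_apply, ContinuousAlternatingMap.smul_apply, toC_apply,
        ContinuousAlternatingMap.sub_apply, reForm_apply, imForm_apply, smul_eq_mul]
      apply Complex.ext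
      · simp; ring
      · simp
    rw [key, key, hβt x y y' u v l hy hy' huv, hγt x y y' u v l hy hy' huv, map_mul,
      Complex.conj_conj]
    ring

/-- A representative `α` of `[ω]` satisfies `dα = β + γ` with `β`, `γ` of types `(0, 1)` and
`(1, 0)` only modulo `d (F_1)` and `F_2`, and `dβ` vanishes only modulo `d (F_2)` and forms that are
in `F_3` or of type `(0, 2)`, which are zero.  Corrections `μ` in `F_1` and `τ`, `ν` in `F_2` turn
both into equalities without affecting the values on the vertical vectors that matter.  -/
theorem IsSmoothSymplecticFamily.isGeneralizedComplex_of_isPluriharmonic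
    (h : IsSmoothSymplecticFamily G F π P) (hp : IsPluriharmonic π P) :
    IsGeneralizedComplex π P := by
  -- `α` represents `[ω]`, `β` represents the `(0, 1)` part of its derivative, `γ` the `(1, 0)`
  -- part, and `ε` the `(0, 2)` part of the derivative of the class of `β`, whose `(1, 1)` part
  -- vanishes
  obtain ⟨c, c', ⟨α, b, hb, hαb, rfl⟩, ⟨-, ⟨β, hβ, rfl⟩, ⟨γ, hγ, hγe⟩⟩, ⟨-, -, ⟨ε, hε, hεe⟩⟩⟩ := hp
  have hγ' : (γ.1 : Omega E X 3) ∈ typeForms π 1 0 1 3 := hγ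
  have hβ' : (β.1 : Omega E X 3) ∈ typeForms π 0 1 1 3 := hβ
  have hε' : (ε.1 : Omega E X 4) ∈ typeForms π 0 2 2 4 := hε
  have h1 : FibCoh.mk π 1 3 γ = FibCoh.mk π 1 3 (dCocycles π 0 2 α - β) := hγe.trans rfl
  have h2 : FibCoh.mk π 2 4 ε = FibCoh.mk π 2 4 (dCocycles π 1 3 β) := by
    rw [hεe, sub_zero]; rfl
  rw [FibCoh.mk_eq_mk_iff] at h1 h2
  obtain ⟨_, ⟨μ, hμ, rfl⟩, ν, hν, h3⟩ := Submodule.mem_sup.1 h1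
  obtain ⟨_, ⟨τ, hτ, rfl⟩, η, hη, h4⟩ := Submodule.mem_sup.1 h2
  have hε0 : ε.1 = 0 := Subtype.ext (funext (eq_zero_of_mem_typeForms_zero_two h.surjective_deriv hε'))
  have hη0 : η = 0 := Subtype.ext (funext (eq_zero_of_mem_filt_three_four h.surjective_deriv hη))
  have h5 : dOmega 3 τ = -dOmega 3 β.1 := by
    rw [hη0, hε0, add_zero, zero_sub] at h4
    exact h4
  have h6 : dOmega 2 μ + ν = γ.1 - (dOmega 2 α.1 - β.1) := h3
  have hclosed : dOmega 3 (β.1 + τ) = 0 := by rw [map_add, h5, add_neg_cancel]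
  have hd : dOmega 2 (α.1 + μ) = (β.1 + τ) + (γ.1 - ν - τ) := by
    rw [map_add, eq_sub_of_add_eq h6]
    abel
  refine h.isGeneralizedComplex_of_decomposition (a := α.1 + μ) (β := β.1 + τ)
    (γ := γ.1 - ν - τ) (fun x => ?_) hd hclosed ?_ ?_ ?_
  · refine h.isLeafForm_congr (hb x) fun u v hu hv => ?_
    have h7 : (α.1 + μ).1 x ![u, v] = α.1.1 x ![u, v] + μ.1 x ![u, v] := rfl
    rw [reForm_apply, h7, apply_eq_zero_of_mem_filt_two hμ x hu hv, hαb, add_zero]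
    rfl
  · have h8 := dOmega_dOmega 2 (α.1 + μ)
    rw [hd, map_add, hclosed, zero_add] at h8
    exact h8
  · intro x y y' u v l hy hy' huv
    have h9 : ∀ z, (β.1 + τ).1 x ![y, y', z] = β.1.1 x ![y, y', z] + τ.1 x ![y, y', z] :=
      fun z => rfl
    rw [h9, h9, apply_eq_zero_of_mem_filt_three le_rfl hτ x hy hy',
      apply_eq_zero_of_mem_filt_three le_rfl hτ x hy hy',
      apply_of_mem_typeForms_three hβ' x hy hy' huv]
    ring
  · intro x y y' u v l hy hy' huv
    have h9 : ∀ z, (γ.1 - ν - τ).1 x ![y, y', z] =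
      γ.1.1 x ![y, y', z] - ν.1 x ![y, y', z] - τ.1 x ![y, y', z] := fun z => rfl
    rw [h9, h9, apply_eq_zero_of_mem_filt_three le_rfl hτ x hy hy',
      apply_eq_zero_of_mem_filt_three le_rfl hτ x hy hy',
      apply_eq_zero_of_mem_filt_three le_rfl hν x hy hy',
      apply_eq_zero_of_mem_filt_three le_rfl hν x hy hy',
      apply_of_mem_typeForms_three hγ' x hy hy' huv]
    ring

end Backward

/-! ### Division by a one-form -/

section Division
variable {E : Type*} [NormedAddCommGroup E] [NormedSpace ℝ E]

theorem oneForm_symm (η : E [⋀^Fin 1]→L[ℝ] ℂ) : ∃ θ : E →L[ℝ] ℂ, oneForm θ = η :=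
  ⟨(ContinuousAlternatingMap.ofSubsingleton ℝ E ℂ (0 : Fin 1)).symm η,
    (ContinuousAlternatingMap.ofSubsingleton ℝ E ℂ (0 : Fin 1)).apply_symm_apply η⟩

theorem wedgeSpinor_oneSpinor_eq_iff {k : ℕ} {τ : E [⋀^Fin k]→L[ℝ] ℂ} {θ : E →L[ℝ] ℂ}
    {ζ : E [⋀^Fin (k + 1)]→L[ℝ] ℂ} :
    wedgeSpinor τ (oneSpinor θ) = homogSpinor ζ ↔ wedge rfl τ (oneForm θ) = ζ := by
  rw [wedgeSpinor_oneSpinor, ← sub_eq_zero, ← homogSpinor_sub, homogSpinor_eq_zero_iff, sub_eq_zero]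

/-- The equation `S ∧ η = ζ` is solved by `S = ι_e ζ / η(e)` as soon as it has a solution. -/
theorem wedge_smul_curryLeft {η : E [⋀^Fin 1]→L[ℝ] ℂ} {e : E} (he : η ![e] ≠ 0)
    {ζ : E [⋀^Fin 3]→L[ℝ] ℂ} {τ : E [⋀^Fin 2]→L[ℝ] ℂ} (h : wedge rfl τ η = ζ) :
    wedge (k := 3) rfl ((η ![e])⁻¹ • ζ.curryLeft e) η = ζ := by
  obtain ⟨θ, rfl⟩ := oneForm_symm η
  have he' : θ e ≠ 0 := he
  change wedge (k := 3) rfl ((θ e)⁻¹ • ζ.curryLeft e) _ = ζ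
  rw [← wedgeSpinor_oneSpinor_eq_iff] at h ⊢
  have h1 : homogSpinor (ζ.curryLeft e) =
      wedgeSpinor (τ.curryLeft e) (oneSpinor θ) + θ e • homogSpinor τ := by
    rw [← contract_homogSpinor, ← h, contract_wedgeSpinor_oneSpinor]
    norm_num
  have h2 : ζ.curryLeft e = wedge rfl (τ.curryLeft e) (oneForm θ) + θ e • τ := by
    have := congrFun h1 2
    rw [homogSpinor_same, Pi.add_apply, Pi.smul_apply, homogSpinor_same,
      wedgeSpinor_oneSpinor] at this
    rw [this]
    exact congrArg (· + _) (homogSpinor_same (wedge rfl (τ.curryLeft e) (oneForm θ)))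
  -- `θ ∧ θ = 0`
  have h3 : wedgeSpinor (wedge rfl (τ.curryLeft e) (oneForm θ) : E [⋀^Fin 2]→L[ℝ] ℂ)
      (oneSpinor θ) = 0 := by
    have hsq : wedgeSpinor (oneForm θ) (oneSpinor θ) = 0 :=
      wedgeSpinor_oneSpinor_eq_zero_iff.2 fun u v => rfl
    set κ : E [⋀^Fin 2]→L[ℝ] ℂ := wedge rfl (τ.curryLeft e) (oneForm θ) with hκ
    -- with `κ = ι_e τ ∧ θ`, the antiderivation rule for `κ ∧ θ` and for `κ` gives terms that cancel
    have hc : ∀ u, contract u (wedgeSpinor κ (oneSpinor θ)) = 0 := by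
      intro u
      rw [contract_wedgeSpinor_oneSpinor]
      have h4 := contract_wedgeSpinor_oneSpinor u (τ.curryLeft e) θ
      rw [wedgeSpinor_oneSpinor, contract_homogSpinor, ← hκ] at h4
      have h5 : κ.curryLeft u = (τ.curryLeft e) ![u] • oneForm θ - θ u • τ.curryLeft e := by
        have h6 := congrFun h4 1
        rw [homogSpinor_same, Pi.add_apply, Pi.smul_apply, homogSpinor_same,
          wedgeSpinor_zero_degree, Pi.smul_apply, oneSpinor_one] at h6
        rw [h6, sub_eq_add_neg, ← neg_smul]
        congr 2
        · change (τ.curryLeft e) _ = _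
          congr 1
          funext i
          fin_cases i; rfl
        · norm_num
      rw [h5, sub_wedgeSpinor, smul_wedgeSpinor, smul_wedgeSpinor, hsq, smul_zero, zero_sub,
        wedgeSpinor_oneSpinor, ← hκ]
      norm_num
    rw [wedgeSpinor_oneSpinor, homogSpinor_eq_zero_iff]
    refine homogSpinor_ext fun u => ?_
    rw [← wedgeSpinor_oneSpinor, hc, (homogSpinor_eq_zero_iff (α := 0)).2 rfl]
    rfl
  rw [h2, smul_add, smul_smul, inv_mul_cancel₀ he', one_smul, add_wedgeSpinor, smul_wedgeSpinor, h3,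
    smul_zero, zero_add, h]

/-- The component of degree three of `e^σ ∧ θ` is `σ ∧ θ`; together with the component `θ` of
degree one, it determines `σ` as far as the line of `e^σ ∧ θ` does. -/
theorem expWedge_oneSpinor_three (σ : E [⋀^Fin 2]→L[ℝ] ℂ) (θ : E →L[ℝ] ℂ) :
    expWedge σ (oneSpinor θ) 3 = wedge rfl σ (oneForm θ) := by
  have h0 : (wedgeSpinor σ)^[0] (oneSpinor θ) 3 = 0 := oneSpinor_of_ne (by norm_num) θ
  have h1 : (wedgeSpinor σ)^[1] (oneSpinor θ) 3 = wedge rfl σ (oneForm θ) := by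
    rw [Function.iterate_one, wedgeSpinor_oneSpinor]
    exact homogSpinor_same (wedge rfl σ (oneForm θ))
  have hl : ∀ l < 3, wedgeSpinor σ (oneSpinor θ) l = 0 := fun l hl =>
    wedgeSpinor_oneSpinor_apply_of_ne _ _ hl.ne
  have h2 : (wedgeSpinor σ)^[2] (oneSpinor θ) 3 = 0 := by
    rw [Function.iterate_succ_apply', Function.iterate_one]
    exact wedgeSpinor_apply_eq_zero σ hl (by norm_num)
  have h3 : (wedgeSpinor σ)^[3] (oneSpinor θ) 3 = 0 := by
    rw [Function.iterate_succ_apply', Function.iterate_succ_apply', Function.iterate_one]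
    exact wedgeSpinor_apply_eq_zero σ (k := 5)
      (fun l hl' => wedgeSpinor_apply_eq_zero σ hl (by omega)) (by norm_num)
  rw [expWedge, Finset.sum_range_succ, Finset.sum_range_succ, Finset.sum_range_succ,
    Finset.sum_range_one, h0, h1, h2, h3]
  simp

end Division

section SmoothDivision
variable {E : Type*} [NormedAddCommGroup E] [NormedSpace ℝ E]
  {V : Type*} [NormedAddCommGroup V] [NormedSpace ℝ V]

theorem inChart_self {k : ℕ} (S : E → E [⋀^Fin k]→L[ℝ] V) (x₀ : E) : inChart S x₀ = S := by
  funext y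
  have h : (deriv' ((chartAt E x₀).symm : E → E) y : E →L[ℝ] E) = ContinuousLinearMap.id ℝ E := by
    rw [chartAt_self_eq]
    exact mfderiv_id
  rw [inChart, h, chartAt_self_eq]
  ext v
  rfl

variable [FiniteDimensional ℝ E]
  {X : Type*} [TopologicalSpace X] [ChartedSpace E X] [IsManifold 𝓘(ℝ, E) ∞ X]

/-- If the equation `s ∧ η = ζ` can be solved pointwise and `η` has no zero at `x₀`, then it has a
smooth solution near `x₀`. -/
theorem exists_smooth_wedge_eq {η : X → E [⋀^Fin 1]→L[ℝ] ℂ} {ζ : X → E [⋀^Fin 3]→L[ℝ] ℂ}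
    {U : Set X} (hU : IsOpen U) (hη : ∀ x ∈ U, SmoothFormAt η x) (hζ : ∀ x ∈ U, SmoothFormAt ζ x)
    (h : ∀ x ∈ U, ∃ τ : E [⋀^Fin 2]→L[ℝ] ℂ, wedge rfl τ (η x) = ζ x) {x₀ : X} (hx₀ : x₀ ∈ U)
    (h0 : η x₀ ≠ 0) :
    ∃ (W : Set X) (s : X → E [⋀^Fin 2]→L[ℝ] ℂ), IsOpen W ∧ x₀ ∈ W ∧ W ⊆ U ∧
      ∀ x ∈ W, SmoothFormAt s x ∧ wedge rfl (s x) (η x) = ζ x := by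
  set c := chartAt E x₀ with hc
  have hxc : x₀ ∈ c.source := mem_chart_source E x₀
  -- in the chart at `x₀`, divide by `η(e)` for a fixed vector `e`
  obtain ⟨e, he⟩ : ∃ e : E, inChart η x₀ (c x₀) ![e] ≠ 0 := by
    by_contra! hcon
    refine h0 ?_
    rw [← inChart_compContinuousLinearMap η hxc]
    ext v
    have h1 : ∀ v : Fin 1 → E, inChart η x₀ (c x₀) v = 0 := fun v => by
      rw [one_covector_eta v, hcon]
    exact h1 _
  have hcη : ContinuousAt (fun x => inChart η x₀ (c x) ![e]) x₀ := by
    have h1 := (hη x₀ hx₀ x₀ hxc).continuousAt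
    have h2 : ContinuousAt (fun y => inChart η x₀ y ![e]) (c x₀) :=
      (ContinuousAlternatingMap.apply ℝ E ℂ ![e]).continuous.continuousAt.comp h1
    exact ContinuousAt.comp (f := c) (g := fun y => inChart η x₀ y ![e]) h2 (c.continuousAt hxc)
  obtain ⟨W', hW', hW'o, hxW'⟩ := eventually_nhds_iff.1 (hcη.eventually_ne he)
  set S : E → E [⋀^Fin 2]→L[ℝ] ℂ := fun y =>
    (inChart η x₀ y ![e])⁻¹ • (inChart ζ x₀ y).curryLeft e with hS
  refine ⟨W' ∩ (U ∩ c.source), fun x => (S (c x)).compContinuousLinearMap (deriv' c x : E →L[ℝ] E),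
    hW'o.inter (hU.inter c.open_source), ⟨hxW', hx₀, hxc⟩, fun x hx => hx.2.1, fun x hx => ⟨?_, ?_⟩⟩
  · refine smoothFormAt_pullback (α := S) c.open_source (contMDiffOn_chart (x := x₀)) hx.2.2 ?_
    intro y₀ _
    rw [inChart_self, chartAt_self_eq]
    have h1 := hη x hx.2.1 x₀ hx.2.2
    have h2 := hζ x hx.2.1 x₀ hx.2.2
    have h3 : ContDiffAt ℝ ∞ (fun y => inChart η x₀ y ![e]) (c x) :=
      (ContinuousAlternatingMap.apply ℝ E ℂ ![e]).contDiff.contDiffAt.comp _ h1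
    have h4 : ContDiffAt ℝ ∞ (fun y => (inChart ζ x₀ y).curryLeft e) (c x) :=
      ((ContinuousAlternatingMap.curryLeftLI (𝕜 := ℝ) (E := E) (F := ℂ)
        (n := 2)).contDiff.contDiffAt.comp _ h2).clm_apply contDiffAt_const
    exact (h3.inv (hW' x hx.1)).smul h4
  · have hz : c.symm (c x) = x := c.left_inv hx.2.2
    obtain ⟨τ, hτ⟩ := h x hx.2.1
    have h1 : wedge rfl (τ.compContinuousLinearMap (deriv' c.symm (c x) : E →L[ℝ] E))
        (inChart η x₀ (c x)) = inChart ζ x₀ (c x) := by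
      rw [inChart, inChart, ← hc, hz, ← hτ, wedge_compContinuousLinearMap]
    have h2 := wedge_smul_curryLeft (hW' x hx.1) h1
    have h3 := congrArg (fun f => f.compContinuousLinearMap (deriv' c x : E →L[ℝ] E)) h2
    simp only [wedge_compContinuousLinearMap] at h3
    rw [inChart_compContinuousLinearMap η hx.2.2, inChart_compContinuousLinearMap ζ hx.2.2] at h3
    exact h3

end SmoothDivision

/-! ### Conjugation and types -/

section TypeOneZero
variable {E : Type*} [NormedAddCommGroup E] [NormedSpace ℝ E]
  {X : Type*} [TopologicalSpace X] [ChartedSpace E X]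
  {B : Type*} [TopologicalSpace B] [ChartedSpace ℂ B] {π : X → B}

/-- The complex conjugate of a covector. -/
def conjForm {k : ℕ} (α : E [⋀^Fin k]→L[ℝ] ℂ) : E [⋀^Fin k]→L[ℝ] ℂ :=
  Complex.conjCLE.toContinuousLinearMap.compContinuousAlternatingMap α

@[simp] theorem conjForm_apply {k : ℕ} (α : E [⋀^Fin k]→L[ℝ] ℂ) (v : Fin k → E) :
    conjForm α v = starRingEnd ℂ (α v) := rfl

/-- The complex conjugate of a form. -/
def conjOmega {k : ℕ} (α : Omega E X k) : Omega E X k :=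
  ⟨fun x => conjForm (α.1 x), (smoothFormOn_iff isOpen_univ).2 fun x _ =>
    (α.smoothFormAt x).clm_comp Complex.conjCLE.toContinuousLinearMap⟩

theorem dOmega_conjOmega [IsManifold 𝓘(ℝ, E) ∞ X] {k : ℕ} (α : Omega E X k) :
    dOmega k (conjOmega α) = conjOmega (dOmega k α) :=
  Subtype.ext (funext fun x => extD_clm_comp (α.smoothFormAt x) _)

/-- A `3`-form `K` with `K ∧ κ_I = 0` is in `F_1` and has type `(1, 0)`. -/
theorem mem_typeForms_of_wedge_eq_zero (hπ : ∀ x, Function.Surjective (deriv' π x : E →L[ℝ] ℂ))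
    {K : Omega E X 3} (hK : ∀ x, wedgeSpinor (K.1 x) (oneSpinor (deriv' π x : E →L[ℝ] ℂ)) = 0) :
    K ∈ typeForms π 1 0 1 3 := by
  have hne : ∀ x, (deriv' π x : E →L[ℝ] ℂ) ≠ 0 := fun x h => by
    obtain ⟨e, he⟩ := hπ x 1
    rw [h] at he
    simp at he
  refine ⟨fun x v s hs hc => ?_, fun x l v w s hc hs ht => ?_⟩
  · have hcard : s = Finset.univ := by
      rw [← Finset.card_eq_iff_eq_univ, Fintype.card_fin]
      have := Finset.card_le_univ s
      rw [Fintype.card_fin] at this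
      omega
    exact apply_vertical_eq_zero (hne x) (hK x) v fun i => hs i (hcard ▸ Finset.mem_univ i)
  · obtain ⟨j, hj⟩ : ∃ j, sᶜ = {j} := by
      rw [← Finset.card_eq_one, Finset.card_compl, Fintype.card_fin]
      omega
    have hjs : j ∉ s := by
      rw [← Finset.mem_compl, hj]
      exact Finset.mem_singleton_self j
    have hsucc : ∀ i, j.succAbove i ∈ s := fun i => by
      by_contra h
      rw [← Finset.mem_compl, hj, Finset.mem_singleton] at h
      exact Fin.succAbove_ne j i h
    have hvw : j.removeNth w = j.removeNth v := funext fun i => (hs _ (hsucc i)).2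
    have hfront : ∀ u : Fin 3 → E, K.1 x u =
        (-1) ^ (j : ℕ) • K.1 x (Matrix.vecCons (u j) (j.removeNth u)) := fun u => by
      have := (K.1 x).toAlternatingMap.map_insertNth j (u j) (j.removeNth u)
      rw [Fin.insertNth_self_removeNth] at this
      exact this
    have hkey : K.1 x (Matrix.vecCons (w j) (j.removeNth v)) =
        l * K.1 x (Matrix.vecCons (v j) (j.removeNth v)) :=
      apply_vecCons_of_wedge_eq_zero (hπ x) (hK x) (w j) (v j) l _ (ht j hjs)
        fun i => (hs _ (hsucc i)).1
    rw [hfront w, hfront v, hvw, hkey, pow_one, pow_zero, mul_one, mul_smul_comm]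

theorem conjOmega_mem_typeForms {p q n m : ℕ} {α : Omega E X m} (hα : α ∈ typeForms π p q n m) :
    conjOmega α ∈ typeForms π q p n m := by
  refine ⟨fun x v s hs hc => ?_, fun x l v w s hc hs ht => ?_⟩
  · change starRingEnd ℂ (α.1 x v) = 0
    rw [hα.1 x v s hs hc, map_zero]
  · change starRingEnd ℂ (α.1 x w) = _ * starRingEnd ℂ (α.1 x v)
    rw [hα.2 x l v w s hc hs ht, map_mul, map_mul, map_pow, map_pow, Complex.conj_conj]
    ring

/-- Every `2`-form has type `(0, 0)` along the base, as an element of `F_0`. -/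
theorem mem_typeForms_zero (α : Omega E X 2) : α ∈ typeForms π 0 0 0 2 := by
  refine ⟨fun x v s hs hc => ?_, fun x l v w s hc hs ht => ?_⟩
  · have := Finset.card_le_univ s
    rw [Fintype.card_fin] at this
    omega
  · have hcard : s = Finset.univ := by
      rw [← Finset.card_eq_iff_eq_univ, Fintype.card_fin]
      omega
    have hvw : w = v := funext fun i => (hs i (hcard ▸ Finset.mem_univ i)).2
    rw [hvw]
    simp

end TypeOneZero

/-! ### Generalized complex structures give pluriharmonic classes -/

section Forward
variable {E : Type*} [NormedAddCommGroup E] [NormedSpace ℝ E]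
  {X : Type*} [TopologicalSpace X] [ChartedSpace E X] [IsManifold 𝓘(ℝ, E) ∞ X]
  {G : Type*} [NormedAddCommGroup G] [NormedSpace ℝ G]
  {F : Type*} [TopologicalSpace F] [ChartedSpace G F]
  {B : Type*} [TopologicalSpace B] [ChartedSpace ℂ B]
  {π : X → B} {P : PoissonStructure E X}

/-- If `σ` is a complex `2`-form whose imaginary part extends the leafwise symplectic form, `H` is
closed and `K = dσ + H` satisfies `K ∧ κ_I = 0`, then `d (Im σ)` is the sum of the closed forms
`(i/2) conj K` and `-(i/2) K`, of types `(0, 1)` and `(1, 0)`. -/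
theorem IsSmoothSymplecticFamily.isPluriharmonic_of_wedge_eq_zero
    (h : IsSmoothSymplecticFamily G F π P) {σ : Omega E X 2} {H : X → E [⋀^Fin 3]→L[ℝ] ℝ}
    (hHs : ∀ x, SmoothFormAt H x) (hH : ∀ x, extD H x = 0)
    (hσ : ∀ x, P.IsLeafForm x (imForm (σ.1 x)))
    (hK : ∀ x, wedgeSpinor (extD σ.1 x + toC (H x))
      (oneSpinor (deriv' π x : E →L[ℝ] ℂ)) = 0) : IsPluriharmonic π P := by
  set H' : Omega E X 3 := ⟨fun x => toC (H x), (smoothFormOn_iff isOpen_univ).2 fun x _ =>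
    (hHs x).toC⟩ with hH'
  have hdH : dOmega 3 H' = 0 := Subtype.ext (funext fun x => by
    change extD (fun z => toC (H z)) x = 0
    rw [extD_toC (hHs x), hH]
    ext v
    simp [toC_apply])
  set K : Omega E X 3 := dOmega 2 σ + H' with hKdef
  have hdK : dOmega 3 K = 0 := by rw [hKdef, map_add, dOmega_dOmega, hdH, add_zero]
  have hKt : K ∈ typeForms π 1 0 1 3 := mem_typeForms_of_wedge_eq_zero h.surjective_deriv hK
  set β : Omega E X 3 := (Complex.I / 2) • conjOmega K with hβ
  set γ : Omega E X 3 := (-(Complex.I / 2)) • K with hγ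
  -- this is `Im σ`
  set w : Omega E X 2 := (Complex.I / 2) • (conjOmega σ - σ) with hw
  have hβt : β ∈ typeForms π 0 1 1 3 := Submodule.smul_mem _ _ (conjOmega_mem_typeForms hKt)
  have hγt : γ ∈ typeForms π 1 0 1 3 := Submodule.smul_mem _ _ hKt
  have hdβ : dOmega 3 β = 0 := by
    rw [hβ, map_smul, dOmega_conjOmega, hdK]
    refine Subtype.ext (funext fun x => ?_)
    ext v
    change Complex.I / 2 * starRingEnd ℂ 0 = 0
    rw [map_zero, mul_zero]
  have hdγ : dOmega 3 γ = 0 := by rw [hγ, map_smul, hdK, smul_zero]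
  have hdw : dOmega 2 w = β + γ := by
    rw [hw, hβ, hγ, map_smul, map_sub, dOmega_conjOmega]
    refine Subtype.ext (funext fun x => ?_)
    ext v
    change Complex.I / 2 * (starRingEnd ℂ ((dOmega 2 σ).1 x v) - (dOmega 2 σ).1 x v) =
      Complex.I / 2 * starRingEnd ℂ ((dOmega 2 σ).1 x v + (H x v : ℂ)) +
        -(Complex.I / 2) * ((dOmega 2 σ).1 x v + (H x v : ℂ))
    -- the contributions of the real form `H` cancel
    rw [map_add, Complex.conj_ofReal]
    ring
  have hwx : ∀ x, w.1 x = toC (imForm (σ.1 x)) := fun x => by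
    ext v
    change Complex.I / 2 * (starRingEnd ℂ (σ.1 x v) - σ.1 x v) = ((σ.1 x v).im : ℂ)
    apply Complex.ext <;> simp
    ring
  have hmem0 : ∀ m, (0 : Omega E X m) ∈ filt π 2 m := fun m => Submodule.zero_mem _
  let w' : cocycles (E := E) π 0 2 := ⟨w, (mem_typeForms_zero w).1, by
    change dOmega 2 w ∈ filt π 1 3
    rw [hdw]
    exact Submodule.add_mem _ hβt.1 hγt.1⟩
  let β' : cocycles (E := E) π 1 3 := ⟨β, hβt.1, by
    change dOmega 3 β ∈ filt π 2 4
    rw [hdβ]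
    exact hmem0 4⟩
  let γ' : cocycles (E := E) π 1 3 := ⟨γ, hγt.1, by
    change dOmega 3 γ ∈ filt π 2 4
    rw [hdγ]
    exact hmem0 4⟩
  have hβc : FibCoh.mk π 1 3 β' ∈ typeClasses π 0 1 1 3 := Submodule.mem_map_of_mem hβt
  have hgw : gaussManin π 0 2 (FibCoh.mk π 0 2 w') - FibCoh.mk π 1 3 β' = FibCoh.mk π 1 3 γ' := by
    have h1 : dCocycles π 0 2 w' - β' = γ' := Subtype.ext (by
      change dOmega 2 w - β = γ
      rw [hdw, add_sub_cancel_left])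
    rw [← h1]
    rfl
  have hgβ : gaussManin π 1 3 (FibCoh.mk π 1 3 β') = 0 := by
    have h1 : dCocycles π 1 3 β' = 0 := Subtype.ext hdβ
    change FibCoh.mk π 2 4 (dCocycles π 1 3 β') = 0
    rw [h1, map_zero]
  refine ⟨FibCoh.mk π 0 2 w', FibCoh.mk π 1 3 β', ⟨w', fun x => imForm (σ.1 x), hσ, hwx, rfl⟩,
    ⟨Submodule.mem_map_of_mem (mem_typeForms_zero w), hβc, ?_⟩, ⟨hβc, Submodule.zero_mem _, ?_⟩⟩
  · rw [hgw]
    exact Submodule.mem_map_of_mem hγt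
  · rw [hgβ, sub_zero]
    exact Submodule.zero_mem _

variable [FiniteDimensional ℝ E] [T2Space X] [SecondCountableTopology X]

/-- The pointwise exponents of a generalized complex structure inducing `(P, I)` can be replaced by
the values of one smooth complex `2`-form. -/
theorem AlmostGenCplx.Induces.exists_smooth_exponent {J : AlmostGenCplx E X}
    (hJ : J.Induces π P) (h : IsSmoothSymplecticFamily G F π P) :
    ∃ σ : Omega E X 2, (∀ x, P.IsLeafForm x (imForm (σ.1 x))) ∧
      ∀ x, J.line x = Submodule.span ℂ {expWedge (σ.1 x) (oneSpinor (deriv' π x))} := by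
  choose b w hw hline using hJ
  set τ : X → E [⋀^Fin 2]→L[ℝ] ℂ := fun x => toC (b x) + Complex.I • toC (w x) with hτ
  have hline' : ∀ x, J.line x =
      Submodule.span ℂ {expWedge (τ x) (oneSpinor (deriv' π x : E →L[ℝ] ℂ))} := fun x =>
    SetLike.coe_injective ((hline x).trans (image_transverseLine _ x))
  -- smooth local exponents: the components `ρ_1 = c θ` and `ρ_3 = c σ ∧ θ` of a smooth section `ρ`
  -- determine `σ` modulo multiples of `θ` by division
  have hloc : ∀ x₀, ∃ (W : Set X) (s : X → E [⋀^Fin 2]→L[ℝ] ℂ), IsOpen W ∧ x₀ ∈ W ∧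
      ∀ x ∈ W, SmoothFormAt s x ∧ wedgeSpinor (s x) (oneSpinor (deriv' π x : E →L[ℝ] ℂ)) =
        wedgeSpinor (τ x) (oneSpinor (deriv' π x : E →L[ℝ] ℂ)) := by
    intro x₀
    obtain ⟨U, ρ, hU, hx₀, hρs, hρ⟩ := J.smooth x₀
    have hc : ∀ x ∈ U, ∃ c : ℂ, c ≠ 0 ∧
        ρ x = expWedge (τ x) (oneSpinor (c • (deriv' π x : E →L[ℝ] ℂ))) := by
      intro x hx
      obtain ⟨hne, hl⟩ := hρ x hx
      have hmem : ρ x ∈ J.line x := by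
        rw [hl]
        exact Submodule.mem_span_singleton_self _
      rw [hline' x] at hmem
      obtain ⟨c, hc⟩ := Submodule.mem_span_singleton.1 hmem
      refine ⟨c, fun h0 => hne ?_, ?_⟩
      · rw [← hc, h0, zero_smul]
      · rw [oneSpinor_smul, expWedge_smul, hc]
    obtain ⟨W, s, hW, hxW, hWU, hs⟩ := exists_smooth_wedge_eq (η := fun x => ρ x 1)
      (ζ := fun x => ρ x 3) hU (fun x hx => (hρs 1).smoothFormAt hU hx)
      (fun x hx => (hρs 3).smoothFormAt hU hx) (fun x hx => by
        obtain ⟨c, -, hc⟩ := hc x hx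
        exact ⟨τ x, by rw [hc, expWedge_oneSpinor_one, expWedge_oneSpinor_three]⟩) hx₀ (by
        obtain ⟨c, hc0, hc⟩ := hc x₀ hx₀
        simp only [hc, expWedge_oneSpinor_one]
        exact oneForm_ne_zero (surjective_smul hc0 (h.surjective_deriv x₀)))
    refine ⟨W, s, hW, hxW, fun x hx => ⟨(hs x hx).1, ?_⟩⟩
    obtain ⟨c, hc0, hc⟩ := hc x (hWU hx)
    have h1 := (hs x hx).2
    rw [hc, expWedge_oneSpinor_one, expWedge_oneSpinor_three] at h1
    have h2 : wedgeSpinor (s x) (oneSpinor (c • (deriv' π x : E →L[ℝ] ℂ))) =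
        wedgeSpinor (τ x) (oneSpinor (c • (deriv' π x : E →L[ℝ] ℂ))) := by
      rw [wedgeSpinor_oneSpinor, wedgeSpinor_oneSpinor]
      exact congrArg homogSpinor h1
    rw [oneSpinor_smul, wedgeSpinor_smul, wedgeSpinor_smul] at h2
    exact smul_right_injective _ hc0 h2
  choose W s hW hxW hs using hloc
  have : LocallyCompactSpace X := ChartedSpace.locallyCompactSpace E X
  obtain ⟨φ, hφ⟩ := SmoothPartitionOfUnity.exists_isSubordinate 𝓘(ℝ, E) (isClosed_univ (X := X))
    W hW fun x _ => Set.mem_iUnion.2 ⟨x, hxW x⟩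
  set σ : X → E [⋀^Fin 2]→L[ℝ] ℂ := fun x => ∑ᶠ i, φ i x • s i x with hσ
  have hσs : ∀ x, SmoothFormAt σ x := fun x =>
    smoothFormAt_finsum φ.locallyFinite (fun i => (φ i).contMDiff x) fun i hi => (hs i x (hφ i hi)).1
  have hστ : ∀ x, wedgeSpinor (σ x) (oneSpinor (deriv' π x : E →L[ℝ] ℂ)) =
      wedgeSpinor (τ x) (oneSpinor (deriv' π x : E →L[ℝ] ℂ)) := fun x =>
    map_finsum_smul_of_forall_eq (((wedgeSpinorBilin (E := E) (a := 2)).flip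
      (oneSpinor (deriv' π x : E →L[ℝ] ℂ))).restrictScalars ℝ) (φ.locallyFinite.point_finite x)
      (φ.sum_eq_one (Set.mem_univ x)) fun i hi =>
      (hs i x (hφ i (subset_tsupport _ hi))).2
  -- the products `σ ∧ θ` agree with `τ ∧ θ`, hence so do the lines, and the values on the fibres
  refine ⟨⟨σ, (smoothFormOn_iff isOpen_univ).2 fun x _ => hσs x⟩, fun x => ?_, fun x => ?_⟩
  · refine h.isLeafForm_congr (hw x) fun u v hu hv => ?_
    have hne : (deriv' π x : E →L[ℝ] ℂ) ≠ 0 := fun h0 => by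
      obtain ⟨e, he⟩ := h.surjective_deriv x 1
      rw [h0] at he
      simp at he
    have h1 : wedgeSpinor (σ x - τ x) (oneSpinor (deriv' π x : E →L[ℝ] ℂ)) = 0 := by
      rw [sub_wedgeSpinor, hστ, sub_self]
    have h2 := apply_vertical_eq_zero_two hne h1 hu hv
    rw [ContinuousAlternatingMap.sub_apply, sub_eq_zero] at h2
    change (σ x ![u, v]).im = _
    rw [h2, hτ]
    simp [toC_apply]
  · rw [hline' x, ← expWedge_congr (hστ x)]

variable [IsManifold 𝓘(ℂ, ℂ) ω B]

/-- Integrability is applied to the sections `e^σ ∧ dg`, where `g` is a local coordinate of the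
base. -/
theorem IsSmoothSymplecticFamily.isPluriharmonic_of_isGeneralizedComplex
    (h : IsSmoothSymplecticFamily G F π P) (hg : IsGeneralizedComplex π P) :
    IsPluriharmonic π P := by
  obtain ⟨H, J, hHs, hH, hint, hind⟩ := hg
  obtain ⟨σ, hσ, hline⟩ := hind.exists_smooth_exponent h
  have := isManifold_real B
  refine h.isPluriharmonic_of_wedge_eq_zero
    (fun x => hHs.smoothFormAt isOpen_univ (Set.mem_univ x)) hH hσ fun x => ?_
  have hV := isOpen_baseDomain h.contMDiff (π x)
  have hx : x ∈ baseDomain π (π x) := mem_chart_source ℂ (π x)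
  have hg : ∀ z ∈ baseDomain π (π x), ContMDiffAt 𝓘(ℝ, E) 𝓘(ℝ, ℂ) ∞ (baseCoord π (π x)) z :=
    fun z hz => contMDiffAt_baseCoord h.contMDiff hz
  obtain ⟨a, -, -, -, ha⟩ := hint (baseDomain π (π x))
    (fun z => expWedge (σ.1 z) (oneSpinor (deriv' (baseCoord π (π x)) z : E →L[ℝ] ℂ))) hV
    (fun k => (smoothFormOn_iff hV).2 fun z hz => (σ.smoothFormAt z).expWedge
      (smoothFormAt_oneSpinor_deriv hV hg hz) k) fun z hz => by
        obtain ⟨c, hc, hd⟩ := exists_deriv_baseCoord_eq h.contMDiff hz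
        rw [hd]
        refine ⟨?_, expWedge_oneSpinor_ne_zero _ (surjective_smul hc (h.surjective_deriv z))⟩
        rw [hline, oneSpinor_smul, expWedge_smul]
        exact Submodule.smul_mem _ _ (Submodule.mem_span_singleton_self _)
  have h1 := ha x hx
  rw [dTwisted_expWedge H (σ.smoothFormAt x) (smoothFormAt_oneSpinor_deriv hV hg hx),
    extDSpinor_oneSpinor_deriv hV hg hx, zero_add, act_expWedge] at h1
  have h2 := sub_eq_zero.1 (expWedge_injective _ ((expWedge_sub _ _ _).trans (sub_eq_zero.2 h1)))
  obtain ⟨c, hc, hd⟩ := exists_deriv_baseCoord_eq h.contMDiff hx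
  -- the right hand side has degrees zero and two, the left hand side has degree four
  have h3 : wedgeSpinor (extD σ.1 x + toC (H x))
      (oneSpinor (deriv' (baseCoord π (π x)) x : E →L[ℝ] ℂ)) = 0 := by
    funext l
    by_cases hl : l = 4
    · subst hl
      rw [h2, Pi.add_apply, Pi.add_apply, Pi.smul_apply, contract_oneSpinor, contract_oneSpinor,
        homogSpinor_of_ne (by norm_num), homogSpinor_of_ne (by norm_num),
        wedgeSpinor_oneSpinor_apply_of_ne _ _ (by norm_num), smul_zero, add_zero, add_zero]
      rfl
    · exact wedgeSpinor_oneSpinor_apply_of_ne _ _ hl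
  rw [hd, oneSpinor_smul, wedgeSpinor_smul] at h3
  exact (smul_eq_zero.1 h3).resolve_left hc

end Forward

/-! ### Symplectic fibre bundles -/

section SymplecticBundle
variable {E : Type*} [NormedAddCommGroup E] [NormedSpace ℝ E]
  {X : Type*} [TopologicalSpace X] [ChartedSpace E X]
  {G : Type*} [NormedAddCommGroup G] [NormedSpace ℝ G]
  {F : Type*} [TopologicalSpace F] [ChartedSpace G F]
  {B : Type*} [TopologicalSpace B] [ChartedSpace ℂ B]
  {π : X → B} {P : PoissonStructure E X}

theorem IsSmoothSymplecticFamily.isLeafForm_unique (h : IsSmoothSymplecticFamily G F π P)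
    {x : X} {w w' : E [⋀^Fin 2]→L[ℝ] ℝ} (hw : P.IsLeafForm x w) (hw' : P.IsLeafForm x w')
    {u v : E} (hu : (deriv' π x : E →L[ℝ] ℂ) u = 0) (hv : (deriv' π x : E →L[ℝ] ℂ) v = 0) :
    w ![u, v] = w' ![u, v] := by
  obtain ⟨ξ, rfl⟩ := (h.range_eq x u).2 hu
  obtain ⟨η, rfl⟩ := (h.range_eq x v).2 hv
  rw [hw, hw']

/-- Averages of extensions of the leafwise symplectic form are extensions again. -/
theorem PoissonStructure.IsLeafForm.finsum {x : X} {ι : Type*} {t : ι → ℝ}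
    (hfin : t.support.Finite) (hsum : ∑ᶠ i, t i = 1) {w : ι → E [⋀^Fin 2]→L[ℝ] ℝ}
    (hw : ∀ i, t i ≠ 0 → P.IsLeafForm x (w i)) : P.IsLeafForm x (∑ᶠ i, t i • w i) := fun ξ η =>
  map_finsum_smul_of_forall_eq
    (ContinuousAlternatingMap.apply ℝ E ℝ ![P.map x ξ, P.map x η]).toLinearMap hfin hsum
    fun i hi => hw i hi ξ η

theorem deriv_comp_proj_eq_zero (hπ : ContMDiff 𝓘(ℝ, E) 𝓘(ℝ, ℂ) ∞ π) {φ : B → ℝ}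
    (hφ : ContMDiff 𝓘(ℝ, ℂ) 𝓘(ℝ, ℝ) ∞ φ) {x : X} {y : E}
    (hy : (deriv' π x : E →L[ℝ] ℂ) y = 0) :
    (deriv' (fun z => φ (π z)) x : E →L[ℝ] ℝ) y = 0 := by
  have h1 : mfderiv 𝓘(ℝ, E) 𝓘(ℝ, ℝ) (fun z => φ (π z)) x =
      (mfderiv 𝓘(ℝ, ℂ) 𝓘(ℝ, ℝ) φ (π x)).comp (mfderiv 𝓘(ℝ, E) 𝓘(ℝ, ℂ) π x) :=
    mfderiv_comp x ((hφ (π x)).mdifferentiableAt (by simp)) ((hπ x).mdifferentiableAt (by simp))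
  have h2 := congrArg (fun f : E →L[ℝ] ℝ => f y) h1
  refine h2.trans ?_
  change (deriv' φ (π x) : ℂ →L[ℝ] ℝ) ((deriv' π x : E →L[ℝ] ℂ) y) = 0
  rw [hy, map_zero]

variable [IsManifold 𝓘(ℝ, E) ∞ X]

/-- If `κ` is closed and vanishes on two vertical vectors, and `f` is constant along the fibres,
then `d (f κ) = df ∧ κ` vanishes as soon as two of its arguments are vertical. -/
theorem extD_smul_apply_vertical {f : X → ℝ} {κ : X → E [⋀^Fin 2]→L[ℝ] ℝ} {x : X}
    (hf : ContMDiffAt 𝓘(ℝ, E) 𝓘(ℝ, ℝ) ∞ f x) (hκ : SmoothFormAt κ x) (hd : extD κ x = 0)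
    {y y' : E} (hy : (deriv' f x : E →L[ℝ] ℝ) y = 0) (hy' : (deriv' f x : E →L[ℝ] ℝ) y' = 0)
    (h0 : κ x ![y, y'] = 0) (a : E) : extD (fun z => f z • κ z) x ![y, y', a] = 0 := by
  have h2 : (2 : Fin 3).removeNth ![y, y', a] = ![y, y'] := by
    funext i
    fin_cases i <;> rfl
  rw [extD_smul_apply hf hκ, hd, Fin.sum_univ_three, h2, h0]
  simp [hy, hy']

variable [FiniteDimensional ℝ E] [FiniteDimensional ℝ G] [IsManifold 𝓘(ℝ, G) ∞ F]
  [T2Space X] [SecondCountableTopology X] [T2Space B] [SecondCountableTopology B]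
  [IsManifold 𝓘(ℂ, ℂ) ω B]

/-- The pullbacks of the symplectic form of the fibre by local symplectic trivializations, averaged
with functions on the base, extend the leafwise symplectic form to a `2`-form `w` with `dw` in
`F_2`; this condition allows `H = 0`. -/
theorem IsSmoothSymplecticFamily.isGeneralizedComplex_of_isSymplecticFibreBundle
    (h : IsSmoothSymplecticFamily G F π P) (hs : IsSymplecticFibreBundle G F π P) :
    IsGeneralizedComplex π P := by
  obtain ⟨σ, hσs, hσ, -, htriv⟩ := hs
  choose e he hes hleaf using htriv
  have := isManifold_real B
  have hπ := h.contMDiff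
  set w : B → X → E [⋀^Fin 2]→L[ℝ] ℝ := fun b x =>
    (σ (e b x).2).compContinuousLinearMap (deriv' (fun z => (e b z).2) x : E →L[ℝ] G) with hw
  have hpr : ∀ b, ContMDiffOn 𝓘(ℝ, E) 𝓘(ℝ, G) ∞ (fun z => (e b z).2) (e b).source := fun b =>
    contMDiff_snd.comp_contMDiffOn (hes b).1
  have hσs' : ∀ y, SmoothFormAt σ y := fun y => hσs.smoothFormAt isOpen_univ (Set.mem_univ y)
  have hws : ∀ b, ∀ x ∈ (e b).source, SmoothFormAt (w b) x := fun b x hx =>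
    smoothFormAt_pullback (e b).open_source (hpr b) hx (hσs' _)
  have hwd : ∀ b, ∀ x ∈ (e b).source, extD (w b) x = 0 := fun b x hx => by
    have h1 := extD_pullback (e b).open_source (hpr b) hx (hσs' (e b x).2)
    refine h1.trans ?_
    rw [hσ]
    ext v
    rfl
  have : LocallyCompactSpace B := ChartedSpace.locallyCompactSpace ℂ B
  obtain ⟨φ, hφ⟩ := SmoothPartitionOfUnity.exists_isSubordinate 𝓘(ℝ, ℂ) (isClosed_univ (X := B))
    (fun b => (e b).baseSet) (fun b => (e b).open_baseSet) fun b _ => Set.mem_iUnion.2 ⟨b, he b⟩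
  set ψ : B → X → ℝ := fun b x => φ b (π x) with hψ
  have hψs : ∀ b x, ContMDiffAt 𝓘(ℝ, E) 𝓘(ℝ, ℝ) ∞ (ψ b) x := fun b x =>
    ((φ b).contMDiff (π x)).comp x (hπ x)
  have hlf : LocallyFinite fun b => Function.support (ψ b) :=
    φ.locallyFinite.preimage_continuous hπ.continuous
  have hψsum : ∀ x, ∑ᶠ b, ψ b x = 1 := fun x => φ.sum_eq_one (Set.mem_univ (π x))
  have hψsrc : ∀ b x, x ∈ tsupport (ψ b) → x ∈ (e b).source := fun b x hx =>
    (e b).mem_source.2 (hφ b (tsupport_comp_subset_preimage (φ b) hπ.continuous hx))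
  have hfin : ∀ x, (Function.support fun b => ψ b x).Finite := fun x => hlf.point_finite x
  have hbar : ∀ x, P.IsLeafForm x (∑ᶠ b, ψ b x • w b x) := fun x =>
    PoissonStructure.IsLeafForm.finsum (hfin x) (hψsum x) fun b hb =>
      hleaf b x (hψsrc b x (subset_tsupport _ hb))
  have hbars : ∀ x, SmoothFormAt (fun z => ∑ᶠ b, ψ b z • w b z) x := fun x =>
    smoothFormAt_finsum hlf (fun b => hψs b x) fun b hb => hws b x (hψsrc b x hb)
  have hzero : ∀ x, extD (fun _ : X => (0 : E [⋀^Fin 3]→L[ℝ] ℝ)) x = 0 := fun x => extD_zero x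
  -- near `x`, the average is `w_b₀ + ∑ ψ_b (w_b - w_b₀)`, where the forms `w_b - w_b₀` are closed
  -- and vanish along the fibres
  have hdw : ∀ x y y' a, (deriv' π x : E →L[ℝ] ℂ) y = 0 → (deriv' π x : E →L[ℝ] ℂ) y' = 0 →
      extD (fun z => ∑ᶠ b, ψ b z • w b z) x ![y, y', a] = 0 := by
    intro x y y' a hy hy'
    set b₀ := π x with hb₀
    have hx₀ : x ∈ (e b₀).source := (e b₀).mem_source.2 (he b₀)
    obtain ⟨s, hs⟩ := exists_finset_finsum_eq hlf (fun b z => w b z - w b₀ z) x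
    have hev : (fun z => ∑ᶠ b, ψ b z • w b z) =ᶠ[𝓝 x]
        fun z => w b₀ z + ∑ b ∈ s, ψ b z • (w b z - w b₀ z) := by
      filter_upwards [hs] with z hz
      have hfin' : ∀ α : B → E [⋀^Fin 2]→L[ℝ] ℝ, (Function.support fun b => ψ b z • α b).Finite :=
        fun α => (hfin z).subset fun b hb => left_ne_zero_of_smul hb
      rw [← hz]
      simp only [smul_sub]
      rw [finsum_sub_distrib (hfin' _) (hfin' _), ← finsum_smul, hψsum, one_smul, add_sub_cancel]
    have hterm : ∀ b, SmoothFormAt (fun z => ψ b z • (w b z - w b₀ z)) x ∧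
        extD (fun z => ψ b z • (w b z - w b₀ z)) x ![y, y', a] = 0 := by
      intro b
      by_cases hb : x ∈ tsupport (ψ b)
      · have hxb := hψsrc b x hb
        have hd : SmoothFormAt (fun z => w b z - w b₀ z) x := (hws b x hxb).sub (hws b₀ x hx₀)
        refine ⟨hd.smul (hψs b x), extD_smul_apply_vertical (hψs b x) hd ?_
          (deriv_comp_proj_eq_zero hπ (φ b).contMDiff hy)
          (deriv_comp_proj_eq_zero hπ (φ b).contMDiff hy') ?_ a⟩
        · rw [extD_sub (hws b x hxb) (hws b₀ x hx₀), hwd b x hxb, hwd b₀ x hx₀, sub_self]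
        · rw [ContinuousAlternatingMap.sub_apply, sub_eq_zero]
          exact h.isLeafForm_unique (hleaf b x hxb) (hleaf b₀ x hx₀) hy hy'
      · have hev0 : (fun z => ψ b z • (w b z - w b₀ z)) =ᶠ[𝓝 x]
            fun _ => (0 : E [⋀^Fin 2]→L[ℝ] ℝ) := by
          filter_upwards [(isClosed_tsupport (ψ b)).isOpen_compl.mem_nhds hb] with z hz
          rw [image_eq_zero_of_notMem_tsupport hz, zero_smul]
        refine ⟨(smoothFormAt_zero x).congr hev0, ?_⟩
        rw [extD_congr hev0, extD_zero]
        rfl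
    rw [extD_congr hev, extD_add (hws b₀ x hx₀) (SmoothFormAt.sum fun b _ => (hterm b).1),
      hwd b₀ x hx₀, zero_add, extD_sum fun b _ => (hterm b).1, ContinuousAlternatingMap.sum_apply]
    exact Finset.sum_eq_zero fun b _ => (hterm b).2
  refine h.isGeneralizedComplex hbars hbar (H := fun _ => 0) (fun x => smoothFormAt_zero x) hzero
    fun x => wedge_eq_zero_of_type (h.surjective_deriv x) fun u v l y y' _ hy hy' => ?_
  have key : ∀ a, (Complex.I • toC (extD (fun z => ∑ᶠ b, ψ b z • w b z) x) +
      toC (0 : E [⋀^Fin 3]→L[ℝ] ℝ)) ![y, y', a] = 0 := fun a => by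
    rw [ContinuousAlternatingMap.add_apply, ContinuousAlternatingMap.smul_apply, toC_apply,
      toC_apply, hdw x y y' a hy hy']
    simp
  rw [key, key, mul_zero]

end SymplecticBundle

end GenCplx

end

theorem mainTheorem7
    {E : Type*} [NormedAddCommGroup E] [NormedSpace ℝ E] [FiniteDimensional ℝ E]
    {X : Type*} [TopologicalSpace X] [T2Space X] [SecondCountableTopology X]
    [ChartedSpace E X] [IsManifold 𝓘(ℝ, E) ∞ X]
    {G : Type*} [NormedAddCommGroup G] [NormedSpace ℝ G] [FiniteDimensional ℝ G]
    {F : Type*} [TopologicalSpace F] [ChartedSpace G F] [IsManifold 𝓘(ℝ, G) ∞ F]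
    {B : Type*} [TopologicalSpace B] [T2Space B] [SecondCountableTopology B]
    [ChartedSpace ℂ B] [IsManifold 𝓘(ℂ, ℂ) ω B]
    (π : X → B) (P : GenCplx.PoissonStructure E X)
    (hfam : GenCplx.IsSmoothSymplecticFamily G F π P) :
    (GenCplx.IsGeneralizedComplex π P ↔ GenCplx.IsPluriharmonic π P) ∧
    (GenCplx.IsSymplecticFibreBundle G F π P → GenCplx.IsGeneralizedComplex π P) :=
  ⟨⟨hfam.isPluriharmonic_of_isGeneralizedComplex, hfam.isGeneralizedComplex_of_isPluriharmonic⟩,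
    hfam.isGeneralizedComplex_of_isSymplecticFibreBundle⟩
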